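/- For a real $n\times n$ matrix $A$ and an entrywise nonnegative real $n\times n$ matrix $\Delta$, let the regularity radius be $$r(A,\Delta)=\min\{\delta\ge 0 \mid \text{the interval matrix } [A-\delta\Delta,\,A+\delta\Delta] \text{ contains a singular matrix}\},$$ with $r(A,\Delta)=\infty$ if there is no such $\delta$. \textbf{Proposition.} There is an algorithm which, given rational matrices $A,\Delta\in\mathbb{Q}^{n\times n}$ of any order $n$ and a rational number $\varepsilon>0$, such that * $A$ is tridiagonal and unreduced (non-degenerate), i.e. $A_{ij}=0$ for $|i-j|>1$ and $A_{ij}\ne 0$ for $|i-j|=1$, * $\Delta\ge 0$ entrywise, and $A_{ij}=0\Rightarrow\Delta_{ij}=0$ for all $i,j$, decides whether $r(A,\Delta)=\infty$ and, if it is finite, computes a rational number $\tilde r$ with $|\tilde r-r(A,\Delta)|\le\varepsilon$, in time polynomial in the total bit length of the input $(n,\varepsilon,A,\Delta)$. (Numbers are written in binary, rationals as numerator and denominator; time is measured in the bit model, i.e. on a random access machine with logarithmic cost, which is polynomially equivalent to a Turing machine.) -/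

import Mathlib

open scoped NNReal ENNReal

/-! ### The regularity radius -/

/-- The interval matrix `[A - E, A + E]` is singular: it contains a singular matrix. -/
def IntervalSingular {n : ℕ} (A E : Matrix (Fin n) (Fin n) ℝ) : Prop :=
  ∃ M : Matrix (Fin n) (Fin n) ℝ,
    (∀ i j, A i j - E i j ≤ M i j ∧ M i j ≤ A i j + E i j) ∧ M.det = 0

/-- The regularity radius: the least `δ ≥ 0` for which `[A - δ Δ, A + δ Δ]` is singular, and `∞`
if there is none (for `Δ ≥ 0` the infimum is attained by compactness). -/
noncomputable def regularityRadius {n : ℕ} (A Δ : Matrix (Fin n) (Fin n) ℝ) : ℝ≥0∞ :=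
  sInf {r : ℝ≥0∞ | ∃ δ : ℝ≥0, r = (δ : ℝ≥0∞) ∧ IntervalSingular A ((δ : ℝ) • Δ)}

/-! ### Random access machines with logarithmic (bit) cost

A program is a structured (while) program over finitely many registers and an unbounded memory
that is addressed indirectly. Registers and memory cells hold integers of arbitrary size. An
instruction is charged by the bit lengths of the addresses and the numbers that it handles;
multiplication and division are charged by the product of the bit lengths. Polynomial time in this
model is the same as polynomial time on Turing machines. -/

namespace RAM

/-- A memory configuration: `reg i` is the `i`-th register, `mem a` the cell with address `a`. -/
@[ext] structure Config where
  reg : ℕ → ℤ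
  mem : ℤ → ℤ

/-- `reg x := v` -/
def Config.setReg (s : Config) (x : ℕ) (v : ℤ) : Config :=
  ⟨Function.update s.reg x v, s.mem⟩

/-- `mem a := v` -/
def Config.setMem (s : Config) (a v : ℤ) : Config :=
  ⟨s.reg, Function.update s.mem a v⟩

/-- The bit length of an integer, with one unit for the sign (so it is positive, also at `0`). -/
def bits (z : ℤ) : ℕ := z.natAbs.size + 1

/-- The arithmetical operations. -/
inductive Op
  | add | sub | mul | div

/-- The value of an operation; `div` is integer division (with value `0` for the divisor `0`). -/
def Op.eval : Op → ℤ → ℤ → ℤ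
  | .add, a, b => a + b
  | .sub, a, b => a - b
  | .mul, a, b => a * b
  | .div, a, b => a / b

/-- The bit cost of an operation. -/
def Op.cost : Op → ℤ → ℤ → ℕ
  | .add, a, b => bits a + bits b
  | .sub, a, b => bits a + bits b
  | .mul, a, b => bits a * bits b
  | .div, a, b => bits a * bits b

/-- Programs. -/
inductive Prog
  /-- do nothing -/
  | skip
  /-- `reg x := c` -/
  | const (x : ℕ) (c : ℤ)
  /-- `reg x := reg y ∘ reg z` -/
  | arith (o : Op) (x y z : ℕ)
  /-- `reg x := mem (reg y)` -/
  | load (x y : ℕ)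
  /-- `mem (reg x) := reg y` -/
  | store (x y : ℕ)
  /-- `P; Q` -/
  | seq (P Q : Prog)
  /-- `if reg x > 0 then P else Q` -/
  | ite (x : ℕ) (P Q : Prog)
  /-- `while reg x > 0 do P` -/
  | loop (x : ℕ) (P : Prog)

/-- `Run P s s' t`: the program `P`, started in the configuration `s`, halts in the configuration
`s'`, and the total cost of the instructions and tests that it executes is `t`. -/
inductive Run : Prog → Config → Config → ℕ → Prop
  | skip (s : Config) : Run .skip s s 1
  | const (s : Config) (x : ℕ) (c : ℤ) : Run (.const x c) s (s.setReg x c) (bits c)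
  | arith (s : Config) (o : Op) (x y z : ℕ) :
      Run (.arith o x y z) s (s.setReg x (o.eval (s.reg y) (s.reg z)))
        (o.cost (s.reg y) (s.reg z))
  | load (s : Config) (x y : ℕ) :
      Run (.load x y) s (s.setReg x (s.mem (s.reg y)))
        (bits (s.reg y) + bits (s.mem (s.reg y)))
  | store (s : Config) (x y : ℕ) :
      Run (.store x y) s (s.setMem (s.reg x) (s.reg y)) (bits (s.reg x) + bits (s.reg y))
  | seq {P Q : Prog} {s s' s'' : Config} {t t' : ℕ} (hP : Run P s s' t) (hQ : Run Q s' s'' t') :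
      Run (.seq P Q) s s'' (t + t')
  | iteTrue {x : ℕ} {P Q : Prog} {s s' : Config} {t : ℕ} (hx : 0 < s.reg x) (hP : Run P s s' t) :
      Run (.ite x P Q) s s' (bits (s.reg x) + t)
  | iteFalse {x : ℕ} {P Q : Prog} {s s' : Config} {t : ℕ} (hx : s.reg x ≤ 0)
      (hQ : Run Q s s' t) : Run (.ite x P Q) s s' (bits (s.reg x) + t)
  | loopStop {x : ℕ} {P : Prog} {s : Config} (hx : s.reg x ≤ 0) :
      Run (.loop x P) s s (bits (s.reg x))
  | loopStep {x : ℕ} {P : Prog} {s s' s'' : Config} {t t' : ℕ} (hx : 0 < s.reg x)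
      (hP : Run P s s' t) (hl : Run (.loop x P) s' s'' t') :
      Run (.loop x P) s s'' (bits (s.reg x) + t + t')

/-- The machine is deterministic: the final configuration and the cost are unique. -/
theorem Run.deterministic {P : Prog} {s s₁ s₂ : Config} {t₁ t₂ : ℕ}
    (h₁ : Run P s s₁ t₁) (h₂ : Run P s s₂ t₂) : s₁ = s₂ ∧ t₁ = t₂ := by
  induction h₁ generalizing s₂ t₂ with
  | skip | const | arith | load | store => cases h₂; exact ⟨rfl, rfl⟩
  | seq _ _ ihP ihQ =>
    cases h₂ with
    | seq hP hQ =>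
      obtain ⟨rfl, rfl⟩ := ihP hP
      obtain ⟨rfl, rfl⟩ := ihQ hQ
      exact ⟨rfl, rfl⟩
  | iteTrue hx _ ih =>
    cases h₂ with
    | iteTrue _ hP => obtain ⟨rfl, rfl⟩ := ih hP; exact ⟨rfl, rfl⟩
    | iteFalse hx' _ => omega
  | iteFalse hx _ ih =>
    cases h₂ with
    | iteTrue hx' _ => omega
    | iteFalse _ hQ => obtain ⟨rfl, rfl⟩ := ih hQ; exact ⟨rfl, rfl⟩
  | loopStop hx =>
    cases h₂ with
    | loopStop _ => exact ⟨rfl, rfl⟩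
    | loopStep hx' _ _ => omega
  | loopStep hx _ _ ihP ihl =>
    cases h₂ with
    | loopStop hx' => omega
    | loopStep _ hP hl =>
      obtain ⟨rfl, rfl⟩ := ihP hP
      obtain ⟨rfl, rfl⟩ := ihl hl
      exact ⟨rfl, rfl⟩

/-- The initial configuration for the input `l`: the cells `0, …, l.length - 1` hold the entries
of `l`, everything else is `0`. -/
def initial (l : List ℤ) : Config where
  reg := fun _ => 0
  mem := fun a => if 0 ≤ a then l.getD a.toNat 0 else 0

/-- The size of an input: its total bit length. -/
def inputSize (l : List ℤ) : ℕ := (l.map bits).sum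

/-- The problem "given (the encoding of) an instance `x`, find integers `p`, `q` with `Spec x p q`"
is solvable in polynomial time: one program halts on every instance within a time that is
polynomial in the bit length of the input, with a correct answer in the registers `0` and `1`. -/
def SolvableInPolyTime {ι : Type*} (encode : ι → List ℤ) (Spec : ι → ℤ → ℤ → Prop) : Prop :=
  ∃ (P : Prog) (time : Polynomial ℕ), ∀ x : ι, ∃ (s : Config) (t : ℕ),
    Run P (initial (encode x)) s t ∧ t ≤ time.eval (inputSize (encode x)) ∧
      Spec x (s.reg 0) (s.reg 1)

end RAM

/-! ### The computational problem -/

/-- An instance: an unreduced tridiagonal rational matrix `A`, a nonnegative rational matrix `Δ`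
that vanishes wherever `A` does, and a rational precision `ε > 0`. -/
structure TridiagonalInstance where
  n : ℕ
  A : Matrix (Fin n) (Fin n) ℚ
  Δ : Matrix (Fin n) (Fin n) ℚ
  ε : ℚ
  tridiagonal : ∀ i j : Fin n, (i : ℕ) + 1 < j ∨ (j : ℕ) + 1 < i → A i j = 0
  unreduced : ∀ i j : Fin n, (i : ℕ) + 1 = j → A i j ≠ 0 ∧ A j i ≠ 0
  nonneg : ∀ i j, 0 ≤ Δ i j
  zeroPattern : ∀ i j, A i j = 0 → Δ i j = 0
  ε_pos : 0 < ε

/-- The entries of a rational matrix, row by row, each as numerator and denominator. -/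
def encodeMatrix {n : ℕ} (M : Matrix (Fin n) (Fin n) ℚ) : List ℤ :=
  (List.finRange n).flatMap fun i => (List.finRange n).flatMap fun j =>
    [(M i j).num, ((M i j).den : ℤ)]

/-- The encoding of an instance: `n`, the precision, the matrix `A`, the matrix `Δ`. -/
def TridiagonalInstance.encode (x : TridiagonalInstance) : List ℤ :=
  [(x.n : ℤ), x.ε.num, (x.ε.den : ℤ)] ++ encodeMatrix x.A ++ encodeMatrix x.Δ

/-- The regularity radius `r(A, Δ)` of an instance. -/
noncomputable def TridiagonalInstance.radius (x : TridiagonalInstance) : ℝ≥0∞ :=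
  regularityRadius (x.A.map (fun q : ℚ => (q : ℝ))) (x.Δ.map (fun q : ℚ => (q : ℝ)))

/-- `(p, q)` represents the extended number `r` with precision `ε`: `q = 0` stands for `∞` and is
used exactly if `r = ∞`; otherwise `q > 0` and `p / q` is within `ε` of `r`. -/
def Approximates (r : ℝ≥0∞) (ε : ℝ) (p q : ℤ) : Prop :=
  (r = ⊤ → q = 0) ∧ (r ≠ ⊤ → 0 < q ∧ |(p : ℝ) / (q : ℝ) - r.toReal| ≤ ε)

/-! ### Bit lengths and the cost of arithmetic -/

namespace RAM

/-! For one parameter δ, singularity is decided exactly by following leading minors. They satisfy `D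
(k+1) = a D k - w D (k-1)`, where `a` is a diagonal entry and `w` a product of two opposite
off-diagonal entries; these quantities range independently over intervals
(`intervalSingular_iff_reach`). Only the direction of the pair `(D (k-1), D k)` matters, that is,
the point `x = D k / D (k-1)` of the projective line, which moves by `x ↦ a - w / x`. The question
is whether the last minor can be 0.

A sign is carried along so that `w` is replaced by `w` times the sign of its central value; its
range is then either positive or contains 0. If it is positive, the map is increasing on the
universal cover of the projective line, where points are ordered by turns and then by value
(`St.next_le_next_iff`). If it contains 0 but no reachable state has the value 0, then `1 / x` is an
ordinary real coordinate in which the step is bilinear. In both cases the reachable states remain an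
interval whose ends are images of corners, and everything between them is attained (`St.next_le`,
`St.le_next`, `St.exists_next_equiv_of_between`). In the remaining case `D k = 0` and `w = 0` can
occur together, the pair `(0, 0)` is reached, and a flag records that all later minors can vanish
(`Test.Inv.step`). A row costs boundedly many integer operations, and the bit lengths grow linearly
with the rows (`St.Bounded.next`).

Singularity is monotone in δ, so the radius is found by bisection on the multiples of `1 / q`, with
`q` the denominator of `ε`. The search is finite because the determinant is affine in each
perturbation coefficient: if it vanishes anywhere, it vanishes at a point of size bounded by the
input (`MultiAffine.exists_small_zero`, `intervalSingular_of_le`). This bound has linearly many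
bits, so linearly many tests suffice, and failure up to the bound means that the radius is infinite.

On the machine, a fixed tuple of expressions is one assignment whose time is quadratic in the bit
length (`RAM.reaches_assign`); loops are handled by invariants with fuel (`RAM.reaches_loop`). -/

theorem one_le_bits (z : ℤ) : 1 ≤ bits z := Nat.le_add_left _ _

theorem bits_le_iff {z : ℤ} {B : ℕ} : bits z ≤ B + 1 ↔ z.natAbs < 2 ^ B := by
  rw [bits, Nat.add_le_add_iff_right, Nat.size_le]

theorem natAbs_lt_two_pow_bits (z : ℤ) : z.natAbs < 2 ^ (bits z - 1) := by
  rw [← bits_le_iff]; have := one_le_bits z; omega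

theorem bits_le_of_natAbs_le {y z : ℤ} (h : y.natAbs ≤ z.natAbs) : bits y ≤ bits z :=
  Nat.add_le_add_right (Nat.size_le_size h) 1

theorem bits_add_le (y z : ℤ) : bits (y + z) ≤ bits y + bits z := by
  have hy := natAbs_lt_two_pow_bits y
  have hz := natAbs_lt_two_pow_bits z
  obtain ⟨p, hp⟩ : ∃ p, bits y = p + 1 := ⟨_, (Nat.sub_add_cancel (one_le_bits y)).symm⟩
  obtain ⟨q, hq⟩ : ∃ q, bits z = q + 1 := ⟨_, (Nat.sub_add_cancel (one_le_bits z)).symm⟩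
  rw [hp, Nat.add_sub_cancel] at hy
  rw [hq, Nat.add_sub_cancel] at hz
  rw [hp, hq, show p + 1 + (q + 1) = (p + q + 1) + 1 by ring, bits_le_iff]
  have h1 : 2 ^ p ≤ 2 ^ (p + q) := Nat.pow_le_pow_right (by norm_num) (by omega)
  have h2 : 2 ^ q ≤ 2 ^ (p + q) := Nat.pow_le_pow_right (by norm_num) (by omega)
  have := Int.natAbs_add_le y z
  rw [pow_succ]; omega

theorem bits_neg (z : ℤ) : bits (-z) = bits z := by simp [bits]

theorem bits_mul_le (y z : ℤ) : bits (y * z) ≤ bits y + bits z := by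
  have hy := natAbs_lt_two_pow_bits y
  have hz := natAbs_lt_two_pow_bits z
  obtain ⟨p, hp⟩ : ∃ p, bits y = p + 1 := ⟨_, (Nat.sub_add_cancel (one_le_bits y)).symm⟩
  obtain ⟨q, hq⟩ : ∃ q, bits z = q + 1 := ⟨_, (Nat.sub_add_cancel (one_le_bits z)).symm⟩
  rw [hp, Nat.add_sub_cancel] at hy
  rw [hq, Nat.add_sub_cancel] at hz
  rw [hp, hq]
  suffices h : bits (y * z) ≤ p + q + 1 by omega
  rw [bits_le_iff, Int.natAbs_mul, pow_add]
  exact Nat.mul_lt_mul'' hy hz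

/-- Every operation at most adds bit lengths, so the value of a fixed expression has a length linear
in that of its inputs. -/
theorem Op.bits_eval_le (o : Op) (y z : ℤ) : bits (o.eval y z) ≤ bits y + bits z := by
  cases o with
  | add => exact bits_add_le y z
  | sub => have := bits_add_le y (-z); rwa [bits_neg, ← sub_eq_add_neg] at this
  | mul => exact bits_mul_le y z
  | div =>
    exact (bits_le_of_natAbs_le (Int.natAbs_ediv_le_natAbs y z)).trans (Nat.le_add_right _ _)

theorem Op.cost_le (o : Op) (y z : ℤ) {B : ℕ} (hy : bits y ≤ B) (hz : bits z ≤ B) :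
    o.cost y z ≤ 2 * B ^ 2 := by
  have := one_le_bits y
  have h : bits y * bits z ≤ B * B := Nat.mul_le_mul hy hz
  cases o <;> simp only [Op.cost] <;> nlinarith

/-! ### Compiling expressions -/

/-- Expressions over `K` variables and a read-only memory; `ite c e f` is `e` if `c > 0`
and `f` otherwise. -/
inductive Ex (K : ℕ)
  | var (i : Fin K)
  | lit (z : ℤ)
  | op (o : Op) (e f : Ex K)
  | mem (e : Ex K)
  | ite (c e f : Ex K)

/-- The value of an expression. -/
def Ex.eval {K : ℕ} (m : ℤ → ℤ) (r : Fin K → ℤ) : Ex K → ℤ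
  | var i => r i
  | lit z => z
  | op o e f => o.eval (e.eval m r) (f.eval m r)
  | mem e => m (e.eval m r)
  | ite c e f => if 0 < c.eval m r then e.eval m r else f.eval m r

/-- The program that evaluates an expression into register `d`, with scratch registers above. -/
def Ex.comp {K : ℕ} : Ex K → ℕ → Prog
  | var i, d => .seq (.const d 0) (.arith .add d i d)
  | lit z, d => .const d z
  | op o e f, d => .seq (.seq (e.comp d) (f.comp (d + 1))) (.arith o d d (d + 1))
  | mem e, d => .seq (e.comp d) (.load d d)
  | ite c e f, d => .seq (c.comp d) (.ite d (e.comp d) (f.comp d))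

/-- The constant depends on the expression alone. Intermediate lengths are linear in `B`, and the
product of two lengths makes the time quadratic. Since registers below the destination survive, the
first operand can wait in `d` while the second is computed from `d + 1` upwards. -/
theorem Ex.comp_spec {K : ℕ} (e : Ex K) : ∃ c : ℕ, ∀ (d : ℕ) (s : Config) (B : ℕ), K ≤ d → 1 ≤ B →
    (∀ i : Fin K, bits (s.reg i) ≤ B) → (∀ a, bits (s.mem a) ≤ B) →
    ∃ (s' : Config) (t : ℕ), Run (e.comp d) s s' t ∧ s'.mem = s.mem ∧
      (∀ i < d, s'.reg i = s.reg i) ∧ s'.reg d = e.eval s.mem (fun i => s.reg i) ∧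
      bits (s'.reg d) ≤ c * B ∧ t ≤ c * B ^ 2 := by
  induction e with
  | var i =>
    -- There is no instruction that copies a register: the destination is cleared and the variable
    -- added to it.
    refine ⟨3, fun d s B hd hB hr hm => ⟨_, _, .seq (.const _ _ _) (.arith _ _ _ _ _), ?_⟩⟩
    have hi : (i : ℕ) ≠ d := by omega
    have h1 : bits 0 = 1 := rfl
    have h2 := hr i
    refine ⟨rfl, fun j hj => ?_, ?_, ?_, ?_⟩
    · simp [Config.setReg, hj.ne]
    · simp [Config.setReg, Op.eval, Ex.eval, hi]
    · simp only [Config.setReg, Op.eval, Function.update_self, ne_eq, hi, not_false_eq_true,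
        Function.update_of_ne, add_zero]
      omega
    · simp only [Config.setReg, Op.cost, Function.update_self, ne_eq, hi, not_false_eq_true,
        Function.update_of_ne]
      nlinarith
  | lit z =>
    refine ⟨bits z, fun d s B hd hB hr hm => ⟨_, _, .const _ _ _, rfl, fun j hj => ?_, ?_, ?_, ?_⟩⟩
    · simp [Config.setReg, hj.ne]
    · simp [Config.setReg, Ex.eval]
    · simpa [Config.setReg] using Nat.le_mul_of_pos_right _ hB
    · exact Nat.le_mul_of_pos_right _ (by positivity)
  | op o e f ihe ihf =>
    obtain ⟨c, hc⟩ := ihe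
    obtain ⟨c', hc'⟩ := ihf
    refine ⟨c + c' + 2 * (c + c') ^ 2, fun d s B hd hB hr hm => ?_⟩
    obtain ⟨s1, t1, R1, m1, r1, v1, b1, T1⟩ := hc d s B hd hB hr hm
    obtain ⟨s2, t2, R2, m2, r2, v2, b2, T2⟩ := hc' (d + 1) s1 B (by omega) hB
      (fun i => by rw [r1 i (by omega)]; exact hr i) (fun a => by rw [m1]; exact hm a)
    have h3 : s2.reg d = e.eval s.mem (fun i => s.reg i) := by rw [r2 d (by omega), v1]
    have h4 : s2.reg (d + 1) = f.eval s.mem (fun i => s.reg i) := by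
      rw [v2, m1]; congr 1; funext i; exact r1 i (by omega)
    have b1' : bits (s2.reg d) ≤ c * B := by rw [r2 d (by omega)]; exact b1
    refine ⟨_, _, .seq (.seq R1 R2) (.arith _ _ _ _ _), m2.trans m1, fun j hj => ?_, ?_, ?_, ?_⟩
    · simp only [Config.setReg, ne_eq, hj.ne, not_false_eq_true, Function.update_of_ne]
      rw [r2 j (by omega), r1 j hj]
    · simp [Config.setReg, h3, h4, Ex.eval]
    · simp only [Config.setReg, Function.update_self]
      refine (Op.bits_eval_le _ _ _).trans ?_
      nlinarith
    · have := Op.cost_le o (s2.reg d) (s2.reg (d + 1)) (B := (c + c') * B)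
        (by nlinarith) (by nlinarith)
      calc _ ≤ c * B ^ 2 + c' * B ^ 2 + 2 * ((c + c') * B) ^ 2 := by omega
        _ = _ := by ring
  | mem e ihe =>
    obtain ⟨c, hc⟩ := ihe
    refine ⟨2 * c + 1, fun d s B hd hB hr hm => ?_⟩
    obtain ⟨s1, t1, R1, m1, r1, v1, b1, T1⟩ := hc d s B hd hB hr hm
    have h5 := hm (s1.reg d)
    have h6 : B ≤ B ^ 2 := by nlinarith
    have h7 : c * B ≤ c * B ^ 2 := Nat.mul_le_mul_left _ h6
    refine ⟨_, _, .seq R1 (.load _ _ _), m1, fun j hj => ?_, ?_, ?_, ?_⟩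
    · simp [Config.setReg, hj.ne, r1 j hj]
    · simp [Config.setReg, m1, v1, Ex.eval]
    · simp only [Config.setReg, Function.update_self, m1]
      nlinarith
    · rw [m1]; nlinarith
  | ite c e f ihc ihe ihf =>
    obtain ⟨k, hk⟩ := ihc
    obtain ⟨k1, hk1⟩ := ihe
    obtain ⟨k2, hk2⟩ := ihf
    refine ⟨2 * k + k1 + k2, fun d s B hd hB hr hm => ?_⟩
    obtain ⟨s1, t1, R1, m1, r1, v1, b1, T1⟩ := hk d s B hd hB hr hm
    have h6 : B ≤ B ^ 2 := by nlinarith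
    have h7 : k * B ≤ k * B ^ 2 := Nat.mul_le_mul_left _ h6
    have he : (fun i : Fin K => s1.reg i) = fun i : Fin K => s.reg i :=
      funext fun i => r1 i (by omega)
    by_cases hpos : 0 < s1.reg d
    · obtain ⟨s2, t2, R2, m2, r2, v2, b2, T2⟩ := hk1 d s1 B hd hB
        (fun i => by rw [r1 i (by omega)]; exact hr i) (fun a => by rw [m1]; exact hm a)
      refine ⟨_, _, .seq R1 (.iteTrue hpos R2), m2.trans m1, fun j hj => ?_, ?_, ?_, ?_⟩
      · rw [r2 j hj, r1 j hj]
      · rw [v2, he, m1, Ex.eval, if_pos (by rwa [← v1])]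
      · nlinarith
      · nlinarith
    · obtain ⟨s2, t2, R2, m2, r2, v2, b2, T2⟩ := hk2 d s1 B hd hB
        (fun i => by rw [r1 i (by omega)]; exact hr i) (fun a => by rw [m1]; exact hm a)
      refine ⟨_, _, .seq R1 (.iteFalse (not_lt.1 hpos) R2), m2.trans m1, fun j hj => ?_, ?_, ?_, ?_⟩
      · rw [r2 j hj, r1 j hj]
      · rw [v2, he, m1, Ex.eval, if_neg (by rwa [← v1])]
      · nlinarith
      · nlinarith

/-- Evaluates a list of expressions into the registers `d, d + 1, …`. -/
def compAll {K : ℕ} : List (Ex K) → ℕ → Prog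
  | [], _ => .skip
  | e :: l, d => .seq (e.comp d) (compAll l (d + 1))

theorem compAll_spec {K : ℕ} (l : List (Ex K)) : ∃ c : ℕ, ∀ (d : ℕ) (s : Config) (B : ℕ), K ≤ d →
    1 ≤ B → (∀ i : Fin K, bits (s.reg i) ≤ B) → (∀ a, bits (s.mem a) ≤ B) →
    ∃ (s' : Config) (t : ℕ), Run (compAll l d) s s' t ∧ s'.mem = s.mem ∧
      (∀ i < d, s'.reg i = s.reg i) ∧
      (∀ (i : ℕ) (h : i < l.length), s'.reg (d + i) = l[i].eval s.mem (fun i => s.reg i) ∧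
        bits (s'.reg (d + i)) ≤ c * B) ∧ t ≤ c * B ^ 2 := by
  induction l with
  | nil =>
    refine ⟨1, fun d s B hd hB hr hm => ⟨s, 1, .skip s, rfl, fun _ _ => rfl, ?_, ?_⟩⟩
    · intro i h; simp at h
    · nlinarith
  | cons e l ih =>
    obtain ⟨c, hc⟩ := e.comp_spec
    obtain ⟨c', hc'⟩ := ih
    refine ⟨c + c', fun d s B hd hB hr hm => ?_⟩
    obtain ⟨s1, t1, R1, m1, r1, v1, b1, T1⟩ := hc d s B hd hB hr hm
    obtain ⟨s2, t2, R2, m2, r2, v2, T2⟩ := hc' (d + 1) s1 B (by omega) hB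
      (fun i => by rw [r1 i (by omega)]; exact hr i) (fun a => by rw [m1]; exact hm a)
    have he : (fun i : Fin K => s1.reg i) = fun i : Fin K => s.reg i :=
      funext fun i => r1 i (by omega)
    refine ⟨s2, _, .seq R1 R2, m2.trans m1, fun j hj => ?_, fun i h => ?_, by nlinarith⟩
    · rw [r2 j (by omega), r1 j hj]
    · cases i with
      | zero =>
        simp only [Nat.add_zero, List.getElem_cons_zero]
        rw [r2 d (by omega)]
        exact ⟨v1, b1.trans (Nat.mul_le_mul_right _ (by omega))⟩
      | succ i =>
        obtain ⟨h1, h2⟩ := v2 i (by simpa using h)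
        rw [show d + 1 + i = d + (i + 1) by ring] at h1 h2
        refine ⟨?_, h2.trans (Nat.mul_le_mul_right _ (by omega))⟩
        rw [h1, he, m1, List.getElem_cons_succ]

/-- Copies the registers `K, …, K + j - 1` to `0, …, j - 1`. -/
def copyAll (K : ℕ) : ℕ → Prog
  | 0 => .const (2 * K) 0
  | j + 1 => .seq (copyAll K j) (.arith .add j (K + j) (2 * K))

/-- Register `2 * K` holds the zero for the additions that serve as copies; sources, targets and
this register are disjoint, so no copy spoils a later one. -/
theorem copyAll_spec (K j : ℕ) (hj : j ≤ K) (s : Config) (B : ℕ) (hB : 1 ≤ B)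
    (hb : ∀ i < K, bits (s.reg (K + i)) ≤ B) :
    ∃ (s' : Config) (t : ℕ), Run (copyAll K j) s s' t ∧ s'.mem = s.mem ∧ s'.reg (2 * K) = 0 ∧
      (∀ i < j, s'.reg i = s.reg (K + i)) ∧ (∀ i < K, s'.reg (K + i) = s.reg (K + i)) ∧
      t ≤ (j + 1) * (2 * B) := by
  induction j with
  | zero =>
    refine ⟨_, _, .const _ _ _, rfl, ?_, ?_, ?_, ?_⟩
    · simp [Config.setReg]
    · simp
    · intro i hi
      simp [Config.setReg, show K + i ≠ 2 * K by omega]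
    · have : bits 0 = 1 := rfl
      omega
  | succ j ih =>
    obtain ⟨s1, t1, R1, m1, z1, v1, w1, T1⟩ := ih (by omega)
    refine ⟨_, _, .seq R1 (.arith _ _ _ _ _), m1, ?_, ?_, ?_, ?_⟩
    · simp [Config.setReg, show 2 * K ≠ j by omega, z1]
    · intro i hi
      rcases eq_or_ne i j with rfl | hne
      · simp [Config.setReg, Op.eval, z1, w1 i (by omega)]
      · simp [Config.setReg, hne, v1 i (by omega)]
    · intro i hi
      simp [Config.setReg, show K + i ≠ j by omega, w1 i hi]
    · have : bits 0 = 1 := rfl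
      have := hb j (by omega)
      rw [z1, w1 j (by omega), Op.cost, add_mul _ 1]
      omega

/-! ### Simultaneous assignments and loops -/

/-- The simultaneous assignment of the values of the expressions `es i` to the variables `i`. -/
def assign {K : ℕ} (es : Fin K → Ex K) : Prog :=
  .seq (compAll (List.ofFn es) K) (copyAll K K)

/-- The configuration `s` holds the variables `r` and the memory `m`. -/
def Holds {K : ℕ} (m : ℤ → ℤ) (r : Fin K → ℤ) (s : Config) : Prop :=
  s.mem = m ∧ ∀ i : Fin K, s.reg i = r i

/-- The program `P` transforms the variables `r` to `r'` in time `T`, without changing the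
memory `m`. -/
def Reaches {K : ℕ} (m : ℤ → ℤ) (P : Prog) (r r' : Fin K → ℤ) (T : ℕ) : Prop :=
  ∀ s, Holds m r s → ∃ (s' : Config) (t : ℕ), Run P s s' t ∧ Holds m r' s' ∧ t ≤ T

/-- The result of a simultaneous assignment. -/
def evalAll {K : ℕ} (m : ℤ → ℤ) (es : Fin K → Ex K) (r : Fin K → ℤ) : Fin K → ℤ :=
  fun i => (es i).eval m r

/-- All right-hand sides are evaluated into fresh registers before any variable is overwritten. The
constant is uniform in the memory and in the variables, hence also in the instance. -/
theorem reaches_assign {K : ℕ} (es : Fin K → Ex K) : ∃ c : ℕ, ∀ (m : ℤ → ℤ) (r : Fin K → ℤ)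
    (B : ℕ), 1 ≤ B → (∀ i, bits (r i) ≤ B) → (∀ a, bits (m a) ≤ B) →
    Reaches m (assign es) r (evalAll m es r) (c * B ^ 2) := by
  obtain ⟨c, hc⟩ := compAll_spec (List.ofFn es)
  refine ⟨c + (K + 1) * (2 * (c + 1)), fun m r B hB hr hm s ⟨hs, hs'⟩ => ?_⟩
  subst hs
  obtain ⟨s1, t1, R1, m1, r1, v1, T1⟩ := hc K s B le_rfl hB
    (fun i => by rw [hs']; exact hr i) hm
  obtain ⟨s2, t2, R2, m2, z2, v2, w2, T2⟩ := copyAll_spec K K le_rfl s1 ((c + 1) * B)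
    (by nlinarith) (fun i hi => (v1 i (by simpa using hi)).2.trans (by nlinarith))
  refine ⟨s2, _, .seq R1 R2, ⟨m2.trans m1, fun i => ?_⟩, ?_⟩
  · rw [v2 i i.2, (v1 i (by simp)).1]
    simp [evalAll, hs']
  · have h6 : B ≤ B ^ 2 := by nlinarith
    have h7 : (K + 1) * (2 * ((c + 1) * B)) ≤ (K + 1) * (2 * ((c + 1) * B ^ 2)) := by gcongr
    calc t1 + t2 ≤ c * B ^ 2 + (K + 1) * (2 * ((c + 1) * B ^ 2)) := by omega
      _ = _ := by ring

theorem Reaches.seq {K : ℕ} {m : ℤ → ℤ} {P Q : Prog} {r r' r'' : Fin K → ℤ} {T T' : ℕ}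
    (h : Reaches m P r r' T) (h' : Reaches m Q r' r'' T') :
    Reaches m (.seq P Q) r r'' (T + T') := by
  intro s hs
  obtain ⟨s1, t1, R1, H1, hT1⟩ := h s hs
  obtain ⟨s2, t2, R2, H2, hT2⟩ := h' s1 H1
  exact ⟨s2, _, .seq R1 R2, H2, by omega⟩

theorem Reaches.mono {K : ℕ} {m : ℤ → ℤ} {P : Prog} {r r' : Fin K → ℤ} {T T' : ℕ}
    (h : Reaches m P r r' T) (hT : T ≤ T') : Reaches m P r r' T' := by
  intro s hs
  obtain ⟨s1, t1, R1, H1, hT1⟩ := h s hs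
  exact ⟨s1, t1, R1, H1, hT1.trans hT⟩

/-- The rule for loops: `I f r` is an invariant that allows at most `f` further iterations. -/
theorem reaches_loop {K : ℕ} {m : ℤ → ℤ} {P : Prog} {x : Fin K} {T B : ℕ}
    (I : ℕ → (Fin K → ℤ) → Prop) (hB : ∀ f r, I f r → bits (r x) ≤ B)
    (hI : ∀ f r, I f r → 0 < r x → ∃ f' r', f = f' + 1 ∧ I f' r' ∧ Reaches m P r r' T) :
    ∀ f r, I f r → ∃ f' r', I f' r' ∧ r' x ≤ 0 ∧
      Reaches m (.loop x P) r r' (f * (T + B) + B) := by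
  intro f
  induction f with
  | zero =>
    intro r hr
    rcases le_or_gt (r x) 0 with h0 | h0
    · refine ⟨0, r, hr, h0, fun s hs => ⟨s, _, .loopStop (by rw [hs.2]; exact h0), hs, ?_⟩⟩
      rw [hs.2]
      exact (hB _ _ hr).trans (Nat.le_add_left _ _)
    · obtain ⟨f', r', h, -⟩ := hI _ _ hr h0
      omega
  | succ f ih =>
    intro r hr
    rcases le_or_gt (r x) 0 with h0 | h0
    · refine ⟨_, r, hr, h0, fun s hs => ⟨s, _, .loopStop (by rw [hs.2]; exact h0), hs, ?_⟩⟩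
      rw [hs.2]
      exact (hB _ _ hr).trans (Nat.le_add_left _ _)
    · obtain ⟨f', r', h, hr', H⟩ := hI _ _ hr h0
      obtain rfl : f = f' := by omega
      obtain ⟨f'', r'', hr'', h0'', H'⟩ := ih r' hr'
      refine ⟨f'', r'', hr'', h0'', fun s hs => ?_⟩
      obtain ⟨s1, t1, R1, H1, hT1⟩ := H s hs
      obtain ⟨s2, t2, R2, H2, hT2⟩ := H' s1 H1
      refine ⟨s2, _, .loopStep (by rw [hs.2]; exact h0) R1 R2, H2, ?_⟩
      have := hB _ _ hr
      rw [hs.2, add_mul]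
      omega

end RAM

/-! ### The cover of the projective line and its order -/

/-- A lifted point of the projective line: `v / u` is an extended number (`u > 0`, or `u = 0` and
`v > 0` for infinity), and `m` counts turns. -/
@[ext] structure St (R : Type*) where
  m : ℤ
  u : R
  v : R

namespace St

section Defs

variable {R : Type*} [CommRing R] [LinearOrder R]

def Valid (s : St R) : Prop := 0 < s.u ∨ s.u = 0 ∧ 0 < s.v

/-- The lexicographic order by turns and values. -/
def Le (s t : St R) : Prop := s.m < t.m ∨ s.m = t.m ∧ s.v * t.u ≤ t.v * s.u

/-- The lift of `x ↦ (a - w / x) / d`. -/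
def next (d a w : R) (s : St R) : St R :=
  ⟨if 0 < s.v then s.m + 1 else s.m,
   if 0 < s.v then d * s.v else if 0 < 0 - s.v then 0 - d * s.v else 0,
   if 0 < s.v then a * s.v - w * s.u else if 0 < 0 - s.v then w * s.u - a * s.v else 1⟩

/-- The number of turns after the next step. -/
def turns (s : St R) : ℤ := if 0 < s.v then s.m + 1 else s.m

/-- No state between `s` and `t` has the value `0`. -/
def Apart (s t : St R) : Prop := s.turns = t.turns ∧ t.v ≠ 0

end Defs

variable {s t r : St ℝ} {d a w : ℝ}

theorem Le.refl (s : St ℝ) : s.Le s := Or.inr ⟨rfl, le_rfl⟩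

theorem le_total (s t : St ℝ) : s.Le t ∨ t.Le s := by
  rcases lt_trichotomy s.m t.m with h | h | h
  · exact .inl (.inl h)
  · rcases _root_.le_total (s.v * t.u) (t.v * s.u) with h' | h'
    · exact .inl (.inr ⟨h, h'⟩)
    · exact .inr (.inr ⟨h.symm, h'⟩)
  · exact .inr (.inl h)

theorem Valid.u_nonneg (hs : s.Valid) : 0 ≤ s.u := hs.elim le_of_lt fun h => h.1.ge

theorem Valid.u_pos (hs : s.Valid) (h : s.v ≤ 0) : 0 < s.u :=
  hs.elim id fun h' => absurd h'.2 h.not_gt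

/-- Cross multiplication is transitive because valid denominators are nonnegative; if the middle
point is at infinity, the last one on the same sheet is too. -/
theorem Le.trans (h : s.Le t) (h' : t.Le r) (hs : s.Valid) (ht : t.Valid) (hr : r.Valid) :
    s.Le r := by
  rcases h with h | ⟨h1, h2⟩
  · rcases h' with h' | ⟨h1', h2'⟩
    · exact .inl (h.trans h')
    · exact .inl (h1' ▸ h)
  · rcases h' with h' | ⟨h1', h2'⟩
    · exact .inl (h1.symm ▸ h')
    · refine .inr ⟨h1.trans h1', ?_⟩
      have hs0 := hs.u_nonneg
      have hr0 := hr.u_nonneg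
      rcases ht with ht | ⟨ht, ht'⟩
      · refine le_of_mul_le_mul_right ?_ ht
        nlinarith [mul_le_mul_of_nonneg_right h2 hr0, mul_le_mul_of_nonneg_right h2' hs0]
      · rw [ht, mul_zero] at h2'
        have : r.u = 0 := le_antisymm (nonpos_of_mul_nonpos_right h2' ht') hr0
        rcases hr with hr | hr
        · exact absurd this hr.ne'
        · rw [this, mul_zero]
          exact mul_nonneg hr.2.le hs0

theorem valid_next (hd : 0 < d) (s : St ℝ) : (s.next d a w).Valid := by
  unfold next Valid
  rcases lt_trichotomy s.v 0 with h | h | h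
  · left
    simp only [h.not_gt, if_false, zero_sub, neg_pos, h, if_true]
    nlinarith
  · right; simp [h]
  · left
    simp only [h, if_true]
    positivity

/-- For `w > 0` the map increases on either side of `x = 0` and jumps from infinity to minus
infinity there. Counting one more turn for positive `x`, infinity included, undoes the jump. The
nine cases are the signs of the two values. -/
theorem next_le_next_iff (hd : 0 < d) (hw : 0 < w) (hs : s.Valid) (ht : t.Valid) :
    (s.next d a w).Le (t.next d a w) ↔ s.Le t := by
  have hs0 := hs.u_nonneg
  have ht0 := ht.u_nonneg
  unfold Le next
  -- The step is linear in `(u, v)` with determinant `d * w > 0`, so it preserves the sign of the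
  -- cross product.
  have key : (a * s.v - w * s.u) * (d * t.v) ≤ (a * t.v - w * t.u) * (d * s.v) ↔
      s.v * t.u ≤ t.v * s.u := by
    rw [← sub_nonneg, ← sub_nonneg (b := s.v * t.u), show (a * t.v - w * t.u) * (d * s.v) -
      (a * s.v - w * s.u) * (d * t.v) = (d * w) * (t.v * s.u - s.v * t.u) by ring]
    exact mul_nonneg_iff_of_pos_left (by positivity)
  rcases lt_trichotomy s.v 0 with h | h | h <;> rcases lt_trichotomy t.v 0 with h' | h' | h'
  · simp only [h.not_gt, h'.not_gt, if_false, zero_sub, neg_pos, h, h', if_true]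
    refine or_congr Iff.rfl (and_congr Iff.rfl ?_)
    rw [← key, ← sub_nonneg, ← sub_nonneg (b := (a * s.v - w * s.u) * (d * t.v))]
    ring_nf
  · have := ht.u_pos h'.le
    have h1 : 0 ≤ -(d * s.v) := by nlinarith
    have h2 : s.v * t.u ≤ 0 := by nlinarith
    simp [h.not_gt, h', h, h1, h2]
  · have h2 : s.v * t.u ≤ t.v * s.u := by nlinarith
    have h1 : ¬ ((w * s.u - a * s.v) * (d * t.v) ≤ (a * t.v - w * t.u) * -(d * s.v)) := by
      rw [not_le, ← sub_pos]
      have h3 : s.v * t.u ≤ 0 := by nlinarith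
      have h4 : 0 < t.v * s.u := mul_pos h' (hs.u_pos h.le)
      have := mul_pos (mul_pos hd hw) (sub_pos.2 (h3.trans_lt h4))
      nlinarith
    simp only [h.not_gt, h', h, h1, h2, if_true, if_false, zero_sub, neg_pos, and_true, and_false,
      or_false]
    omega
  · have := hs.u_pos h.le
    have h1 : ¬ (0 ≤ t.v * s.u) := by nlinarith
    have h2 : ¬ (- (d * t.v) ≤ 0) := by nlinarith
    simp [h'.not_gt, h', h, h1, h2]
  · simp [h, h']
  · have := hs.u_pos h.le
    have h2 : 0 ≤ t.v * s.u := by positivity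
    have h3 : ¬ (d * t.v ≤ 0) := by rw [not_le]; positivity
    simp only [h, h', h2, h3, zero_mul, mul_zero, one_mul, lt_irrefl, sub_zero, if_true, if_false,
      and_true, and_false, or_false]
    omega
  · have := ht.u_pos h'.le
    have h1 : ¬ (s.v * t.u ≤ t.v * s.u) := by
      have : 0 < s.v * t.u := by positivity
      nlinarith
    have h3 : (a * s.v - w * s.u) * -(d * t.v) ≤ (w * t.u - a * t.v) * (d * s.v) := by
      have := mul_pos (mul_pos hd hw) (sub_pos.2 (not_le.1 h1))
      rw [← sub_nonneg]
      nlinarith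
    simp only [h, h'.not_gt, h', h1, h3, zero_sub, neg_pos, if_true, if_false, and_false,
      or_false, and_true]
    omega
  · have := ht.u_pos h'.le
    have h1 : ¬ (s.v * t.u ≤ 0) := by
      have : 0 < s.v * t.u := by positivity
      exact this.not_ge
    have h2 : 0 ≤ d * s.v := by positivity
    simp only [h, h', h1, h2, zero_mul, lt_irrefl, sub_zero, if_true, if_false, and_false,
      or_false, mul_zero, one_mul, and_true]
    omega
  · simp only [h, h', if_true, key, add_lt_add_iff_right, add_left_inj]

/-- The position of the next state is an affine function of `u / v`. -/
theorem next_of_ne (h : s.v ≠ 0) :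
    s.next d a w = ⟨s.turns, d * |s.v|, |s.v| * (a - w * (s.u / s.v))⟩ := by
  unfold next turns
  rcases lt_or_gt_of_ne h with h' | h'
  · simp only [h'.not_gt, if_false, zero_sub, neg_pos, h', if_true, abs_of_neg h', mk.injEq,
      true_and]
    constructor
    · ring
    · field_simp
      ring
  · simp only [h', if_true, abs_of_pos h', mk.injEq, true_and]
    field_simp

/-- Equal turns put both images on one sheet with positive denominators, so real numbers are
compared. The coefficients may differ on the two sides and have any sign. -/
theorem next_le_next_iff_of_turns_eq {a' w' : ℝ} (hd : 0 < d) (hs : s.v ≠ 0) (ht : t.v ≠ 0)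
    (h : s.turns = t.turns) : (s.next d a w).Le (t.next d a' w') ↔
      a - w * (s.u / s.v) ≤ a' - w' * (t.u / t.v) := by
  rw [next_of_ne hs, next_of_ne ht]
  have h1 := abs_pos.2 hs
  have h2 := abs_pos.2 ht
  simp only [Le, h, lt_irrefl, true_and, false_or]
  rw [show ∀ x, |s.v| * x * (d * |t.v|) = |s.v| * d * |t.v| * x by intro x; ring,
    show ∀ x, |t.v| * x * (d * |s.v|) = |s.v| * d * |t.v| * x by intro x; ring]
  exact mul_le_mul_iff_right₀ (by positivity)

theorem next_of_eq_zero (h : s.v = 0) : s.next d a w = ⟨s.m, 0, 1⟩ := by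
  simp [next, h]

theorem next_mono_left {a' : ℝ} (hd : 0 < d) (ha : a ≤ a') :
    (s.next d a w).Le (s.next d a' w) := by
  by_cases h : s.v = 0
  · rw [next_of_eq_zero h, next_of_eq_zero h]; exact .refl _
  · rw [next_le_next_iff_of_turns_eq hd h h rfl]; linarith

/-- For a fixed state the image is affine in `w`; the sign of `u / v` decides which end of the range
dominates. -/
theorem next_le_next_lo_or_hi {wl wh : ℝ} (hd : 0 < d) (hl : wl ≤ w) (hh : w ≤ wh) (s : St ℝ) :
    (s.next d a w).Le (s.next d a wl) ∨ (s.next d a w).Le (s.next d a wh) := by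
  by_cases h : s.v = 0
  · rw [next_of_eq_zero h, next_of_eq_zero h]; exact .inl (.refl _)
  · rw [next_le_next_iff_of_turns_eq hd h h rfl, next_le_next_iff_of_turns_eq hd h h rfl]
    rcases le_or_gt 0 (s.u / s.v) with h' | h'
    · left; nlinarith
    · right; nlinarith

theorem next_lo_or_hi_le_next {wl wh : ℝ} (hd : 0 < d) (hl : wl ≤ w) (hh : w ≤ wh) (s : St ℝ) :
    (s.next d a wl).Le (s.next d a w) ∨ (s.next d a wh).Le (s.next d a w) := by
  by_cases h : s.v = 0
  · rw [next_of_eq_zero h, next_of_eq_zero h]; exact .inl (.refl _)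
  · rw [next_le_next_iff_of_turns_eq hd h h rfl, next_le_next_iff_of_turns_eq hd h h rfl]
    rcases le_or_gt 0 (s.u / s.v) with h' | h'
    · right; nlinarith
    · left; nlinarith

theorem Le.turns_le (h : s.Le t) (hs : s.Valid) (ht : t.Valid) : s.turns ≤ t.turns := by
  unfold turns
  rcases h with h | ⟨h1, h2⟩
  · split_ifs <;> omega
  · split_ifs with h3 h4 <;> try omega
    exfalso
    have := mul_pos h3 (ht.u_pos (not_lt.1 h4))
    nlinarith [hs.u_nonneg]

theorem Apart.turns_eq {L U : St ℝ} (h : Apart L U) (hs : s.Valid) (hL : L.Valid)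
    (hU : U.Valid) (h1 : L.Le s) (h2 : s.Le U) : s.turns = U.turns :=
  le_antisymm (h2.turns_le hs hU) (h.1 ▸ h1.turns_le hL hs)

/-- States with the same turns are ordered as follows: positive values and infinity on one sheet,
then negative values on the next, and 0 last. Hence only the upper end has to be checked. -/
theorem Apart.ne_zero {L U : St ℝ} (h : Apart L U) (hs : s.Valid) (hL : L.Valid)
    (hU : U.Valid) (h1 : L.Le s) (h2 : s.Le U) : s.v ≠ 0 := by
  intro h0
  have h3 := h.turns_eq hs hL hU h1 h2
  have h5 := hs.u_pos h0.le
  obtain ⟨-, h4⟩ := h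
  unfold turns at h3
  rw [h0, if_neg (lt_irrefl _)] at h3
  rcases h2 with h2 | ⟨h2, h2'⟩
  · split_ifs at h3 <;> omega
  · split_ifs at h3 with h6
    · omega
    · rw [h0, zero_mul] at h2'
      exact h4 (le_antisymm (not_lt.1 h6) (nonneg_of_mul_nonneg_left h2' h5))

/-- The reciprocal `u / v` is a decreasing coordinate on the states with given turns and nonzero
value; it passes through 0 at infinity, where the sheet changes. -/
theorem le_iff_of_turns_eq (hs : s.v ≠ 0) (ht : t.v ≠ 0) (hs' : s.Valid) (ht' : t.Valid)
    (h : s.turns = t.turns) : s.Le t ↔ t.u / t.v ≤ s.u / s.v := by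
  have h1 := hs'.u_nonneg
  have h2 := ht'.u_nonneg
  unfold turns at h
  unfold Le
  rcases lt_or_gt_of_ne hs with hs | hs <;> rcases lt_or_gt_of_ne ht with ht | ht
  · rw [if_neg hs.not_gt, if_neg ht.not_gt] at h
    rw [← neg_div_neg_eq t.u, ← neg_div_neg_eq s.u, div_le_div_iff₀ (neg_pos.2 ht) (neg_pos.2 hs)]
    simp [h, mul_comm]
  · rw [if_neg hs.not_gt, if_pos ht] at h
    have h3 : ¬ t.u / t.v ≤ s.u / s.v := by
      rw [not_le]
      exact (div_neg_of_pos_of_neg (hs'.u_pos hs.le) hs).trans_le (div_nonneg h2 ht.le)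
    simp only [h3, iff_false]
    omega
  · rw [if_pos hs, if_neg ht.not_gt] at h
    have h3 : t.u / t.v ≤ s.u / s.v :=
      (div_neg_of_pos_of_neg (ht'.u_pos ht.le) ht).le.trans (div_nonneg h1 hs.le)
    simp only [h3, iff_true]
    omega
  · rw [if_pos hs, if_pos ht, add_left_inj] at h
    rw [div_le_div_iff₀ ht hs]
    simp [h, mul_comm]

/-- The product is affine in each factor, so its maximum over a rectangle is taken at a corner. -/
theorem mul_le_of_corners {c x x₀ x₁ y y₀ y₁ : ℝ} (hx₀ : x₀ ≤ x) (hx₁ : x ≤ x₁) (hy₀ : y₀ ≤ y)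
    (hy₁ : y ≤ y₁) (h₀₀ : x₀ * y₀ ≤ c) (h₀₁ : x₀ * y₁ ≤ c) (h₁₀ : x₁ * y₀ ≤ c)
    (h₁₁ : x₁ * y₁ ≤ c) : x * y ≤ c := by
  have key : ∀ z, x₀ * z ≤ c → x₁ * z ≤ c → x * z ≤ c := fun z h h' => by
    rcases le_or_gt 0 z with hz | hz <;> nlinarith
  have h := key y₀ h₀₀ h₁₀
  have h' := key y₁ h₀₁ h₁₁
  rcases le_or_gt 0 x with hz | hz <;> nlinarith

theorem le_mul_of_corners {c x x₀ x₁ y y₀ y₁ : ℝ} (hx₀ : x₀ ≤ x) (hx₁ : x ≤ x₁) (hy₀ : y₀ ≤ y)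
    (hy₁ : y ≤ y₁) (h₀₀ : c ≤ x₀ * y₀) (h₀₁ : c ≤ x₀ * y₁) (h₁₀ : c ≤ x₁ * y₀)
    (h₁₁ : c ≤ x₁ * y₁) : c ≤ x * y := by
  have := mul_le_of_corners (c := -c) (y := -y) (y₀ := -y₁) (y₁ := -y₀) hx₀ hx₁
    (by linarith) (by linarith) (by linarith) (by linarith) (by linarith) (by linarith)
  linarith

/-! ### Images of intervals of states -/

section Step

variable {L U : St ℝ} {al ah wl wh : ℝ}

/-- The image of the interval of states `[L, U]` is bounded above by the images of corners. -/
theorem next_le (hd : 0 < d) (hL : L.Valid) (hU : U.Valid) (h : 0 < wl ∨ Apart L U)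
    (hs : s.Valid) (h1 : L.Le s) (h2 : s.Le U) (ha : a ≤ ah) (hwl : wl ≤ w) (hwh : w ≤ wh)
    {U' : St ℝ} (hU' : U'.Valid) (hLl : (L.next d ah wl).Le U') (hLh : (L.next d ah wh).Le U')
    (hUl : (U.next d ah wl).Le U') (hUh : (U.next d ah wh).Le U') :
    (s.next d a w).Le U' := by
  have v : ∀ {a w : ℝ} (s : St ℝ), (s.next d a w).Valid := fun s => valid_next hd s
  refine (next_mono_left hd ha).trans ?_ (v _) (v _) hU'
  -- For positive `w` monotonicity in the state leaves only the end `U`. Otherwise 0 is avoided and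
  -- `w * (u / v)` is bilinear on a rectangle.
  by_cases hw : 0 < wl
  · refine Le.trans ((next_le_next_iff hd (hw.trans_le hwl) hs hU).2 h2) ?_ (v _) (v _) hU'
    rcases next_le_next_lo_or_hi hd hwl hwh U with h3 | h3
    · exact h3.trans hUl (v _) (v _) hU'
    · exact h3.trans hUh (v _) (v _) hU'
  · have h := h.resolve_left hw
    have hLU := h1.trans h2 hL hs hU
    have e := h.turns_eq hs hL hU h1 h2
    have z := h.ne_zero hs hL hU h1 h2
    have zL := h.ne_zero hL hL hU (.refl _) hLU
    have y1 := (le_iff_of_turns_eq zL z hL hs (h.1.trans e.symm)).1 h1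
    have y2 := (le_iff_of_turns_eq z h.2 hs hU e).1 h2
    have key : ∃ t, (t = L ∨ t = U) ∧ ∃ w', (w' = wl ∨ w' = wh) ∧
        w' * (t.u / t.v) ≤ w * (s.u / s.v) := by
      by_contra! hc
      have c1 := hc L (.inl rfl) wl (.inl rfl)
      have c2 := hc L (.inl rfl) wh (.inr rfl)
      have c3 := hc U (.inr rfl) wl (.inl rfl)
      have c4 := hc U (.inr rfl) wh (.inr rfl)
      -- The corner lemma gives a nonstrict bound, so a contradiction needs a number strictly
      -- between the value and all four corners.
      obtain ⟨c, hc1, hc2⟩ := exists_between (lt_min (lt_min c1 c2) (lt_min c3 c4))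
      simp only [lt_min_iff] at hc2
      have := le_mul_of_corners hwl hwh y2 y1 hc2.2.1.le hc2.1.1.le hc2.2.2.le hc2.1.2.le
      linarith
    obtain ⟨t, ht, w', hw', hle⟩ := key
    have ht' : t.v ≠ 0 ∧ s.turns = t.turns := by
      rcases ht with rfl | rfl
      · exact ⟨zL, e.trans h.1.symm⟩
      · exact ⟨h.2, e⟩
    refine Le.trans ((next_le_next_iff_of_turns_eq hd z ht'.1 ht'.2).2
      (sub_le_sub_left hle ah)) ?_ (v _) (v _) hU'
    rcases ht with rfl | rfl <;> rcases hw' with rfl | rfl <;> assumption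

/-- The image of the interval of states `[L, U]` is bounded below by the images of corners. -/
theorem le_next (hd : 0 < d) (hL : L.Valid) (hU : U.Valid) (h : 0 < wl ∨ Apart L U)
    (hs : s.Valid) (h1 : L.Le s) (h2 : s.Le U) (ha : al ≤ a) (hwl : wl ≤ w) (hwh : w ≤ wh)
    {L' : St ℝ} (hL' : L'.Valid) (hLl : L'.Le (L.next d al wl)) (hLh : L'.Le (L.next d al wh))
    (hUl : L'.Le (U.next d al wl)) (hUh : L'.Le (U.next d al wh)) :
    L'.Le (s.next d a w) := by
  have v : ∀ {a w : ℝ} (s : St ℝ), (s.next d a w).Valid := fun s => valid_next hd s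
  refine Le.trans ?_ (next_mono_left hd ha) hL' (v _) (v _)
  by_cases hw : 0 < wl
  · refine Le.trans ?_ ((next_le_next_iff hd (hw.trans_le hwl) hL hs).2 h1) hL' (v _) (v _)
    rcases next_lo_or_hi_le_next hd hwl hwh L with h3 | h3
    · exact hLl.trans h3 hL' (v _) (v _)
    · exact hLh.trans h3 hL' (v _) (v _)
  · have h := h.resolve_left hw
    have hLU := h1.trans h2 hL hs hU
    have e := h.turns_eq hs hL hU h1 h2
    have z := h.ne_zero hs hL hU h1 h2
    have zL := h.ne_zero hL hL hU (.refl _) hLU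
    have y1 := (le_iff_of_turns_eq zL z hL hs (h.1.trans e.symm)).1 h1
    have y2 := (le_iff_of_turns_eq z h.2 hs hU e).1 h2
    have key : ∃ t, (t = L ∨ t = U) ∧ ∃ w', (w' = wl ∨ w' = wh) ∧
        w * (s.u / s.v) ≤ w' * (t.u / t.v) := by
      by_contra! hc
      have c1 := hc L (.inl rfl) wl (.inl rfl)
      have c2 := hc L (.inl rfl) wh (.inr rfl)
      have c3 := hc U (.inr rfl) wl (.inl rfl)
      have c4 := hc U (.inr rfl) wh (.inr rfl)
      obtain ⟨c, hc2, hc1⟩ := exists_between (max_lt (max_lt c1 c2) (max_lt c3 c4))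
      simp only [max_lt_iff] at hc2
      have := mul_le_of_corners hwl hwh y2 y1 hc2.2.1.le hc2.1.1.le hc2.2.2.le hc2.1.2.le
      linarith
    obtain ⟨t, ht, w', hw', hle⟩ := key
    have ht' : t.v ≠ 0 ∧ t.turns = s.turns := by
      rcases ht with rfl | rfl
      · exact ⟨zL, h.1.trans e.symm⟩
      · exact ⟨h.2, e.symm⟩
    refine Le.trans ?_ ((next_le_next_iff_of_turns_eq hd ht'.1 z ht'.2).2
      (sub_le_sub_left hle al)) hL' (v _) (v _)
    rcases ht with rfl | rfl <;> rcases hw' with rfl | rfl <;> assumption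

/-- Between two states with the same number of turns every value is attained. -/
theorem exists_next_between {s₀ s₁ s' : St ℝ} {w₀ w₁ y₀ y₁ : ℝ} (hd : 0 < d) (ha : al ≤ ah)
    (hw₀ : w₀ ∈ Set.Icc wl wh) (hw₁ : w₁ ∈ Set.Icc wl wh) (hs₀ : s₀.v ≠ 0) (hs₁ : s₁.v ≠ 0)
    (hy₀ : s₀.u / s₀.v ∈ Set.Icc y₀ y₁) (hy₁ : s₁.u / s₁.v ∈ Set.Icc y₀ y₁)
    (h : s₀.turns = s₁.turns) (hs' : s'.Valid) (h₀ : (s₀.next d al w₀).Le s')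
    (h₁ : s'.Le (s₁.next d ah w₁)) :
    s'.m = s₀.turns ∧ 0 < s'.u ∧ ∃ a ∈ Set.Icc al ah, ∃ w ∈ Set.Icc wl wh, ∃ y ∈ Set.Icc y₀ y₁,
      (a - w * y) * s'.u = s'.v * d := by
  rw [next_of_ne hs₀] at h₀
  rw [next_of_ne hs₁] at h₁
  have hm : s'.m = s₀.turns := by
    have h2 : s₀.turns ≤ s'.m := by rcases h₀ with h | h; exacts [h.le, h.1.le]
    have h3 : s'.m ≤ s₁.turns := by rcases h₁ with h | h; exacts [h.le, h.1.le]
    omega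
  have h4 : |s₀.v| * (al - w₀ * (s₀.u / s₀.v)) * s'.u ≤ s'.v * (d * |s₀.v|) := by
    rcases h₀ with h | h
    · exact absurd h (by simp [hm])
    · exact h.2
  have h5 : s'.v * (d * |s₁.v|) ≤ |s₁.v| * (ah - w₁ * (s₁.u / s₁.v)) * s'.u := by
    rcases h₁ with h' | h'
    · exact absurd h' (by simp [hm, h])
    · exact h'.2
  have p₀ := abs_pos.2 hs₀
  have p₁ := abs_pos.2 hs₁
  have hu : 0 < s'.u := by
    rcases hs' with h' | ⟨h', h''⟩
    · exact h'
    · rw [h', mul_zero] at h5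
      have : 0 < s'.v * (d * |s₁.v|) := by positivity
      linarith
  have h6 : al - w₀ * (s₀.u / s₀.v) ≤ s'.v * d / s'.u := by
    rw [le_div_iff₀ hu]
    refine le_of_mul_le_mul_left ?_ p₀
    linarith
  have h7 : s'.v * d / s'.u ≤ ah - w₁ * (s₁.u / s₁.v) := by
    rw [div_le_iff₀ hu]
    refine le_of_mul_le_mul_left ?_ p₁
    linarith
  refine ⟨hm, hu, ?_⟩
  -- All three parameters move along segments at once, a continuous path from the lower corner to
  -- the upper one.
  let f : ℝ → ℝ := fun θ => (AffineMap.lineMap al ah θ : ℝ) - (AffineMap.lineMap w₀ w₁ θ : ℝ) *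
    (AffineMap.lineMap (s₀.u / s₀.v) (s₁.u / s₁.v) θ : ℝ)
  have hf : ContinuousOn f (Set.Icc 0 1) := by
    simp only [f, AffineMap.lineMap_apply_module]
    fun_prop
  obtain ⟨θ, hθ, hθ'⟩ := intermediate_value_Icc (zero_le_one' ℝ) hf
    (show s'.v * d / s'.u ∈ Set.Icc (f 0) (f 1) by
      simpa only [f, AffineMap.lineMap_apply_zero, AffineMap.lineMap_apply_one] using ⟨h6, h7⟩)
  refine ⟨_, (convex_Icc al ah).lineMap_mem ⟨le_rfl, ha⟩ ⟨ha, le_rfl⟩ hθ, _,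
    (convex_Icc wl wh).lineMap_mem hw₀ hw₁ hθ, _, (convex_Icc y₀ y₁).lineMap_mem hy₀ hy₁ hθ, ?_⟩
  rw [eq_div_iff hu.ne'] at hθ'
  exact hθ'

/-- A preimage of a state under `next`. -/
theorem exists_next_equiv (hd : 0 < d) (hw : 0 < w) (a : ℝ) (hs : s.Valid) :
    ∃ t : St ℝ, t.Valid ∧ (t.next d a w).Le s ∧ s.Le (t.next d a w) := by
  have h0 := hs.u_nonneg
  -- The preimage has `u : v = (a * s.u - d * s.v) : (w * s.u)`. The sign of the first entry decides
  -- between the sheets `s.m` and `s.m - 1`, as denominators must not be negative.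
  rcases lt_trichotomy (a * s.u - d * s.v) 0 with h | h | h
  · refine ⟨⟨s.m, -(a * s.u - d * s.v), - (w * s.u)⟩, .inl (by simpa using h), ?_⟩
    rcases hs with hs | ⟨hs, hs'⟩
    · have h1 : 0 < w * s.u := by positivity
      have h2 : ¬ (w * s.u < 0) := h1.not_gt
      simp only [next, Le, neg_pos, h2, if_false, zero_sub, neg_neg, h1, if_true, lt_irrefl,
        true_and, false_or]
      constructor <;> apply le_of_eq <;> ring
    · simp only [next, Le, hs]
      simp
  · have hu : 0 < s.u := hs.elim id fun h' => by
      rw [h'.1] at h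
      have := mul_pos hd h'.2
      linarith
    refine ⟨⟨s.m - 1, 0, 1⟩, .inr ⟨rfl, one_pos⟩, ?_⟩
    simp only [next, Le, one_pos, if_true, mul_one, mul_zero, sub_zero, sub_add_cancel, lt_irrefl,
        true_and, false_or]
    constructor <;> linarith
  · have hu : 0 < s.u := hs.elim id fun h' => by
      rw [h'.1] at h
      have := mul_pos hd h'.2
      linarith
    refine ⟨⟨s.m - 1, a * s.u - d * s.v, w * s.u⟩, .inl h, ?_⟩
    have h1 : 0 < w * s.u := by positivity
    simp only [next, Le, h1, if_true, sub_add_cancel, lt_irrefl, true_and, false_or]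
    constructor <;> apply le_of_eq <;> ring

/-- Every state between the images of corners is attained. -/
theorem exists_next_equiv_of_between {s₀ s₁ s' : St ℝ} {w₀ w₁ : ℝ} (hd : 0 < d)
    (hL : L.Valid) (hU : U.Valid) (hLU : L.Le U) (ha : al ≤ ah) (h : 0 < wl ∨ Apart L U)
    (hs₀ : s₀ = L ∨ s₀ = U) (hs₁ : s₁ = L ∨ s₁ = U)
    (hw₀ : w₀ ∈ Set.Icc wl wh) (hw₁ : w₁ ∈ Set.Icc wl wh)
    (hs' : s'.Valid) (h₀ : (s₀.next d al w₀).Le s') (h₁ : s'.Le (s₁.next d ah w₁)) :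
    ∃ s : St ℝ, s.Valid ∧ L.Le s ∧ s.Le U ∧ ∃ a ∈ Set.Icc al ah, ∃ w ∈ Set.Icc wl wh,
      (s.next d a w).Le s' ∧ s'.Le (s.next d a w) := by
  have v : ∀ {a w : ℝ} (s : St ℝ), (s.next d a w).Valid := fun s => valid_next hd s
  have vs₀ : s₀.Valid := by rcases hs₀ with rfl | rfl <;> assumption
  have vs₁ : s₁.Valid := by rcases hs₁ with rfl | rfl <;> assumption
  -- For positive `w`, invert the map with the coefficients of the upper corner. If the preimage
  -- falls below `L`, the target lies between two images of `L` itself, and varying the coefficients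
  -- at the fixed state `L` reaches it.
  by_cases hw : 0 < wl
  · have p₀ := hw.trans_le hw₀.1
    have p₁ := hw.trans_le hw₁.1
    obtain ⟨t, ht, ht1, ht2⟩ := exists_next_equiv hd p₁ ah hs'
    have hts : t.Le s₁ := (next_le_next_iff hd p₁ ht vs₁).1 (ht1.trans h₁ (v _) hs' (v _))
    have htU : t.Le U := by
      rcases hs₁ with rfl | rfl
      exacts [hts.trans hLU ht hL hU, hts]
    rcases le_total L t with hLt | htL
    · exact ⟨t, ht, hLt, htU, ah, ⟨ha, le_rfl⟩, w₁, hw₁, ht1, ht2⟩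
    have h₁' : s'.Le (L.next d ah w₁) :=
      ht2.trans ((next_le_next_iff hd p₁ ht hL).2 htL) hs' (v _) (v _)
    have h₀' : (L.next d al w₀).Le s' := by
      refine Le.trans ((next_le_next_iff hd p₀ hL vs₀).2 ?_) h₀ (v _) (v _) hs'
      rcases hs₀ with rfl | rfl
      exacts [.refl _, hLU]
    refine ⟨L, hL, .refl _, hLU, ?_⟩
    by_cases hz : L.v = 0
    · rw [next_of_eq_zero hz] at h₁' h₀'
      refine ⟨al, ⟨le_rfl, ha⟩, w₀, hw₀, ?_⟩
      rw [next_of_eq_zero hz]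
      exact ⟨h₀', h₁'⟩
    · obtain ⟨hm, hu, a, ha', w, hw', y, hy, e⟩ := exists_next_between hd ha hw₀ hw₁ hz hz
        (Set.left_mem_Icc.2 le_rfl) (Set.left_mem_Icc.2 le_rfl) rfl hs' h₀' h₁'
      obtain rfl : y = L.u / L.v := by simpa using hy
      refine ⟨a, ha', w, hw', ?_⟩
      rw [next_of_ne hz]
      simp only [Le, hm, lt_irrefl, true_and, false_or]
      exact ⟨by linear_combination |L.v| * e, by linear_combination -|L.v| * e⟩
  · have h := h.resolve_left hw
    have zL := h.ne_zero hL hL hU (.refl _) hLU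
    have hy := (le_iff_of_turns_eq zL h.2 hL hU h.1).1 hLU
    have key : ∀ t, t = L ∨ t = U → t.v ≠ 0 ∧ t.turns = U.turns ∧
        t.u / t.v ∈ Set.Icc (U.u / U.v) (L.u / L.v) := by
      rintro t (rfl | rfl)
      exacts [⟨zL, h.1, hy, le_rfl⟩, ⟨h.2, rfl, le_rfl, hy⟩]
    obtain ⟨z₀, e₀, y₀⟩ := key s₀ hs₀
    obtain ⟨z₁, e₁, y₁⟩ := key s₁ hs₁
    obtain ⟨hm, hu, a, ha', w, hw', y, hy, e⟩ := exists_next_between hd ha hw₀ hw₁ z₀ z₁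
        y₀ y₁ (e₀.trans e₁.symm) hs' h₀ h₁
    rw [e₀] at hm
    -- Any real `y` is the reciprocal of a state with these turns: on the lower sheet for `y ≥ 0`
    -- (at infinity for `y = 0`), on the upper one for `y < 0`.
    obtain ⟨s, vs, zs, ts, ys⟩ : ∃ s : St ℝ, s.Valid ∧ s.v ≠ 0 ∧ s.turns = U.turns ∧
        s.u / s.v = y := by
      rcases le_or_gt 0 y with h0 | h0
      · refine ⟨⟨U.turns - 1, y, 1⟩, ?_, one_ne_zero, by simp [turns], by simp⟩
        rcases h0.eq_or_lt with h0 | h0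
        exacts [.inr ⟨h0.symm, one_pos⟩, .inl h0]
      · refine ⟨⟨U.turns, -y, -1⟩, .inl (by simpa using h0), by simp, ?_, by simp⟩
        rw [turns, if_neg (by norm_num)]
    refine ⟨s, vs, (le_iff_of_turns_eq zL zs hL vs (h.1.trans ts.symm)).2 (ys ▸ hy.2),
      (le_iff_of_turns_eq zs h.2 vs hU ts).2 (ys ▸ hy.1), a, ha', w, hw', ?_⟩
    rw [next_of_ne zs]
    simp only [Le, hm, ts, ys, lt_irrefl, true_and, false_or]
    exact ⟨by linear_combination |s.v| * e, by linear_combination -|s.v| * e⟩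

end Step

end St

/-! ### States as directions of pairs of minors, and integer states -/

namespace St

/-- If `U` is not itself a zero, the turns increase between the ends, and the zero on the sheet
`L.turns`, the last state with the turns of `L`, lies between them. -/
theorem exists_zero_of_not_apart {L U : St ℝ} (hL : L.Valid) (hU : U.Valid) (hLU : L.Le U)
    (h : ¬ Apart L U) : ∃ s : St ℝ, s.Valid ∧ s.v = 0 ∧ L.Le s ∧ s.Le U := by
  by_cases h0 : U.v = 0
  · exact ⟨U, hU, h0, hLU, .refl _⟩
  have h1 : L.turns < U.turns :=
    lt_of_le_of_ne (hLU.turns_le hL hU) fun e => h ⟨e, h0⟩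
  refine ⟨⟨L.turns, 1, 0⟩, .inl one_pos, rfl, ?_, ?_⟩
  · unfold turns Le
    split_ifs with h2
    · left; exact Int.lt_succ _
    · right; simpa using h2
  · unfold turns at h1
    unfold turns Le
    split_ifs at h1 ⊢ with h2 h3 h3
    · rcases lt_or_eq_of_le (Int.le_of_lt_add_one h1) with h4 | h4
      · exact .inl h4
      · exact .inr ⟨h4, by simpa using h3.le⟩
    · exact .inl h1
    · rcases lt_or_eq_of_le (Int.le_of_lt_add_one h1) with h4 | h4
      · exact .inl h4
      · exact .inr ⟨h4, by simpa using h3.le⟩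
    · exact .inl h1

/-- The order is only a preorder; equivalent states have the same direction, up to a positive
factor. -/
theorem exists_scale {s t : St ℝ} (hs : s.Valid) (ht : t.Valid) (h : s.Le t) (h' : t.Le s) :
    ∃ c > 0, t.u = c * s.u ∧ t.v = c * s.v := by
  have e : s.v * t.u = t.v * s.u := by
    rcases h with h | h
    · rcases h' with h' | h' <;> omega
    · rcases h' with h' | h'
      · omega
      · exact le_antisymm h.2 h'.2
  rcases hs with hs | ⟨hs, hs'⟩
  · have hu : 0 < t.u := by
      rcases ht with ht | ⟨ht, ht'⟩
      · exact ht
      · rw [ht, mul_zero] at e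
        exact absurd e.symm (mul_pos ht' hs).ne'
    refine ⟨t.u / s.u, by positivity, by field_simp, ?_⟩
    field_simp
    linarith
  · rw [hs, mul_zero] at e
    have hu : t.u = 0 := (mul_eq_zero.1 e).resolve_left hs'.ne'
    have hv : 0 < t.v := ht.elim (fun h => absurd hu h.ne') fun h => h.2
    refine ⟨t.v / s.v, by positivity, by simp [hs, hu], by field_simp⟩

/-- The state `s` represents the direction of `(p, τ q)`. -/
def Rel (τ : ℝ) (s : St ℝ) (p q : ℝ) : Prop := ∃ c : ℝ, c ≠ 0 ∧ p = c * s.u ∧ τ * q = c * s.v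

theorem Rel.of_equiv {τ p q : ℝ} {s t : St ℝ} (hr : Rel τ s p q) (hs : s.Valid) (ht : t.Valid)
    (h : s.Le t) (h' : t.Le s) : Rel τ t p q := by
  obtain ⟨c, hc, hu, hv⟩ := exists_scale hs ht h h'
  obtain ⟨l, hl, rfl, hq⟩ := hr
  refine ⟨l / c, div_ne_zero hl hc.ne', ?_, ?_⟩
  · rw [hu]; field_simp
  · rw [hv, hq]; field_simp

/-- In the signed ratio `τ q / p` the recurrence becomes the lifted step with coefficients `τ σ a`
and `σ w`; the factor `d` cancels. The disjunction excludes the image `(0, 0)`, which has no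
direction. -/
theorem Rel.next {τ σ d a w p q : ℝ} {s : St ℝ} (hτ : τ * τ = 1) (hσ : σ * σ = 1) (hd : 0 < d)
    (hs : s.Valid) (h : s.v ≠ 0 ∨ w ≠ 0) (hr : Rel τ s p q) :
    Rel (τ * σ) (s.next d (d * (τ * σ * a)) (d * (σ * w))) q (a * q - w * p) := by
  obtain ⟨l, hl, rfl, hq⟩ := hr
  have hτ0 : τ ≠ 0 := by rintro rfl; simp at hτ
  have hσ0 : σ ≠ 0 := by rintro rfl; simp at hσ
  have hq' : q = l * τ * s.v := by linear_combination τ * hq - q * hτ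
  have e : τ * σ * (a * q - w * (l * s.u)) = l * τ / d * (d * (τ * σ * a) * s.v -
      d * (σ * w) * s.u) := by
    rw [hq']; field_simp
  by_cases hv : s.v = 0
  · have hw := h.resolve_left (not_not.2 hv)
    have hu := hs.u_pos hv.le
    rw [next_of_eq_zero hv]
    refine ⟨- (τ * σ * w * (l * s.u)), neg_ne_zero.2 (by positivity), by simp [hq', hv], ?_⟩
    rw [hq', hv]; ring
  · rcases lt_or_gt_of_ne hv with h' | h'
    · refine ⟨-(l * τ / d), neg_ne_zero.2 (by positivity), ?_, ?_⟩
      · simp only [St.next, h'.not_gt, if_false, zero_sub, neg_pos, h', if_true]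
        rw [hq']; field_simp
      · simp only [St.next, h'.not_gt, if_false, zero_sub, neg_pos, h', if_true]
        rw [e]; ring
    · refine ⟨l * τ / d, by positivity, ?_, ?_⟩
      · simp only [St.next, h', if_true]
        rw [hq']; field_simp
      · simp only [St.next, h', if_true]
        rw [e]

/-- The integer state as a real one. -/
def toReal (s : St ℤ) : St ℝ := ⟨s.m, s.u, s.v⟩

theorem toReal_next (d a w : ℤ) (s : St ℤ) : (s.next d a w).toReal = s.toReal.next (d : ℝ) a w := by
  unfold next toReal
  ext
  · simp
  · simp only [zero_sub, neg_pos, Int.cast_pos, Int.cast_lt_zero]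
    split_ifs <;> push_cast <;> rfl
  · simp only [zero_sub, neg_pos, Int.cast_pos, Int.cast_lt_zero]
    split_ifs <;> push_cast <;> rfl

theorem toReal_le_iff (s t : St ℤ) : s.toReal.Le t.toReal ↔ s.Le t := by
  simp only [Le, toReal]
  norm_cast

/-- Comparison, as a number. -/
def leZ (s t : St ℤ) : ℤ :=
  if 0 < t.m - s.m then 1 else if 0 < s.m - t.m then 0 else
    if 0 < s.v * t.u - t.v * s.u then 0 else 1

theorem leZ_pos_iff (s t : St ℤ) : 0 < leZ s t ↔ s.Le t := by
  unfold leZ Le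
  split_ifs <;> simp <;> omega

/-- Choice between two states. -/
def pick (c : ℤ) (s t : St ℤ) : St ℤ :=
  ⟨if 0 < c then s.m else t.m, if 0 < c then s.u else t.u, if 0 < c then s.v else t.v⟩

theorem pick_of_pos {c : ℤ} (h : 0 < c) (s t : St ℤ) : pick c s t = s := by simp [pick, h]

theorem pick_of_not_pos {c : ℤ} (h : ¬ 0 < c) (s t : St ℤ) : pick c s t = t := by simp [pick, h]

def maxZ (s t : St ℤ) : St ℤ := pick (leZ s t) t s

def minZ (s t : St ℤ) : St ℤ := pick (leZ s t) s t

theorem maxZ_spec (s t : St ℤ) : s.toReal.Le (maxZ s t).toReal ∧ t.toReal.Le (maxZ s t).toReal ∧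
    (maxZ s t = s ∨ maxZ s t = t) := by
  unfold maxZ
  by_cases h : 0 < leZ s t
  · rw [pick_of_pos h]
    exact ⟨(toReal_le_iff _ _).2 ((leZ_pos_iff _ _).1 h), .refl _, .inr rfl⟩
  · rw [pick_of_not_pos h]
    rw [leZ_pos_iff, ← toReal_le_iff] at h
    exact ⟨.refl _, (le_total _ _).resolve_left h, .inl rfl⟩

theorem minZ_spec (s t : St ℤ) : (minZ s t).toReal.Le s.toReal ∧ (minZ s t).toReal.Le t.toReal ∧
    (minZ s t = s ∨ minZ s t = t) := by
  unfold minZ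
  by_cases h : 0 < leZ s t
  · rw [pick_of_pos h]
    exact ⟨.refl _, (toReal_le_iff _ _).2 ((leZ_pos_iff _ _).1 h), .inl rfl⟩
  · rw [pick_of_not_pos h]
    rw [leZ_pos_iff, ← toReal_le_iff] at h
    exact ⟨(le_total _ _).resolve_left h, .refl _, .inr rfl⟩

/-- Positive exactly if the two states are `Apart`. -/
def apartZ (s t : St ℤ) : ℤ :=
  if 0 < s.turns - t.turns then 0 else if 0 < t.turns - s.turns then 0 else
    if 0 < t.v then 1 else if 0 < 0 - t.v then 1 else 0

theorem apartZ_pos_iff (s t : St ℤ) : 0 < apartZ s t ↔ Apart s.toReal t.toReal := by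
  have h : ∀ s : St ℤ, s.toReal.turns = s.turns := fun s => by simp [turns, toReal]
  rw [Apart, h, h]
  simp only [apartZ, toReal, ne_eq, Int.cast_eq_zero]
  split_ifs <;> simp <;> omega

/-- The largest image of a corner. -/
def upper (d a wl wh : ℤ) (L U : St ℤ) : St ℤ :=
  maxZ (maxZ (L.next d a wl) (L.next d a wh)) (maxZ (U.next d a wl) (U.next d a wh))

/-- The smallest image of a corner. -/
def lower (d a wl wh : ℤ) (L U : St ℤ) : St ℤ :=
  minZ (minZ (L.next d a wl) (L.next d a wh)) (minZ (U.next d a wl) (U.next d a wh))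

theorem valid_toReal_next {d : ℤ} (hd : 0 < d) (a w : ℤ) (s : St ℤ) :
    (s.next d a w).toReal.Valid := by
  rw [toReal_next]
  exact valid_next (by exact_mod_cast hd) _

/-- The extreme image is an actual image of a corner. This gives attainment, validity and the size
bound, since selecting a maximum causes no growth. -/
theorem upper_eq (d a wl wh : ℤ) (L U : St ℤ) :
    ∃ s w, (s = L ∨ s = U) ∧ (w = wl ∨ w = wh) ∧ upper d a wl wh L U = s.next d a w := by
  unfold upper
  rcases (maxZ_spec (maxZ (L.next d a wl) (L.next d a wh))
    (maxZ (U.next d a wl) (U.next d a wh))).2.2 with h | h <;> rw [h]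
  · rcases (maxZ_spec (L.next d a wl) (L.next d a wh)).2.2 with h | h <;> rw [h]
    exacts [⟨L, wl, .inl rfl, .inl rfl, rfl⟩, ⟨L, wh, .inl rfl, .inr rfl, rfl⟩]
  · rcases (maxZ_spec (U.next d a wl) (U.next d a wh)).2.2 with h | h <;> rw [h]
    exacts [⟨U, wl, .inr rfl, .inl rfl, rfl⟩, ⟨U, wh, .inr rfl, .inr rfl, rfl⟩]

theorem lower_eq (d a wl wh : ℤ) (L U : St ℤ) :
    ∃ s w, (s = L ∨ s = U) ∧ (w = wl ∨ w = wh) ∧ lower d a wl wh L U = s.next d a w := by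
  unfold lower
  rcases (minZ_spec (minZ (L.next d a wl) (L.next d a wh))
    (minZ (U.next d a wl) (U.next d a wh))).2.2 with h | h <;> rw [h]
  · rcases (minZ_spec (L.next d a wl) (L.next d a wh)).2.2 with h | h <;> rw [h]
    exacts [⟨L, wl, .inl rfl, .inl rfl, rfl⟩, ⟨L, wh, .inl rfl, .inr rfl, rfl⟩]
  · rcases (minZ_spec (U.next d a wl) (U.next d a wh)).2.2 with h | h <;> rw [h]
    exacts [⟨U, wl, .inr rfl, .inl rfl, rfl⟩, ⟨U, wh, .inr rfl, .inr rfl, rfl⟩]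

theorem valid_upper {d : ℤ} (hd : 0 < d) (a wl wh : ℤ) (L U : St ℤ) :
    (upper d a wl wh L U).toReal.Valid := by
  obtain ⟨s, w, -, -, h⟩ := upper_eq d a wl wh L U
  exact h ▸ valid_toReal_next hd a w s

theorem valid_lower {d : ℤ} (hd : 0 < d) (a wl wh : ℤ) (L U : St ℤ) :
    (lower d a wl wh L U).toReal.Valid := by
  obtain ⟨s, w, -, -, h⟩ := lower_eq d a wl wh L U
  exact h ▸ valid_toReal_next hd a w s

theorem next_le_upper {d : ℤ} (hd : 0 < d) (a wl wh : ℤ) (L U : St ℤ) {s : St ℤ} {w : ℤ}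
    (hs : s = L ∨ s = U) (hw : w = wl ∨ w = wh) :
    (s.toReal.next (d : ℝ) a w).Le (upper d a wl wh L U).toReal := by
  have v : ∀ w s, (next d a w s).toReal.Valid := fun w s => valid_toReal_next hd a w s
  have vm : ∀ s t : St ℤ, s.toReal.Valid → t.toReal.Valid → (maxZ s t).toReal.Valid :=
    fun s t hs ht => by rcases (maxZ_spec s t).2.2 with h | h <;> rw [h] <;> assumption
  have vu := valid_upper hd a wl wh L U
  rw [← toReal_next]
  rcases hs with rfl | rfl
  · refine Le.trans ?_ (maxZ_spec _ _).1 (v _ _) (vm _ _ (v _ _) (v _ _)) vu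
    rcases hw with rfl | rfl
    exacts [(maxZ_spec _ _).1, (maxZ_spec _ _).2.1]
  · refine Le.trans ?_ (maxZ_spec _ _).2.1 (v _ _) (vm _ _ (v _ _) (v _ _)) vu
    rcases hw with rfl | rfl
    exacts [(maxZ_spec _ _).1, (maxZ_spec _ _).2.1]

theorem lower_le_next {d : ℤ} (hd : 0 < d) (a wl wh : ℤ) (L U : St ℤ) {s : St ℤ} {w : ℤ}
    (hs : s = L ∨ s = U) (hw : w = wl ∨ w = wh) :
    (lower d a wl wh L U).toReal.Le (s.toReal.next (d : ℝ) a w) := by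
  have v : ∀ w s, (next d a w s).toReal.Valid := fun w s => valid_toReal_next hd a w s
  have vm : ∀ s t : St ℤ, s.toReal.Valid → t.toReal.Valid → (minZ s t).toReal.Valid :=
    fun s t hs ht => by rcases (minZ_spec s t).2.2 with h | h <;> rw [h] <;> assumption
  have vu := valid_lower hd a wl wh L U
  rw [← toReal_next]
  rcases hs with rfl | rfl
  · refine Le.trans (minZ_spec _ _).1 ?_ vu (vm _ _ (v _ _) (v _ _)) (v _ _)
    rcases hw with rfl | rfl
    exacts [(minZ_spec _ _).1, (minZ_spec _ _).2.1]
  · refine Le.trans (minZ_spec _ _).2.1 ?_ vu (vm _ _ (v _ _) (v _ _)) (v _ _)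
    rcases hw with rfl | rfl
    exacts [(minZ_spec _ _).1, (minZ_spec _ _).2.1]

end St

/-! ### The singularity test -/

/-- The pairs `(D (k - 1), D k)` of consecutive leading minors that a tridiagonal matrix can have
if its diagonal entries are in `PA k` and its products of opposite off-diagonal entries in
`PW k`. -/
def Reach (PA PW : ℕ → Set ℝ) : ℕ → ℝ → ℝ → Prop
  | 0, p, q => p = 0 ∧ q = 1
  | k + 1, p, q => ∃ p₀, Reach PA PW k p₀ p ∧ ∃ a ∈ PA k, ∃ w ∈ PW k, q = a * p - w * p₀

/-- The state of the singularity test. -/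
structure Test where
  flag : ℤ
  τ : ℤ
  L : St ℤ
  U : St ℤ

/-- The integer coefficients of a step of the singularity test. -/
structure Coef where
  τ : ℤ
  d : ℤ
  al : ℤ
  ah : ℤ
  wl : ℤ
  wh : ℤ

namespace Test

/-- The interval consists of infinity on sheet 0, the direction of the initial pair `(0, 1)`. -/
def init : Test := ⟨0, 1, ⟨0, 0, 1⟩, ⟨0, 0, 1⟩⟩

/-- The flag means that the pair `(0, 0)` is reachable, which persists. As the upper end of the
range of `w` is nonnegative in `Describes`, testing `c.wl` alone shows whether the range contains 0.
-/
def step (c : Coef) (T : Test) : Test where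
  flag := if 0 < T.flag then 1 else if 0 < c.wl then 0 else if 0 < T.L.apartZ T.U then 0 else 1
  τ := c.τ
  L := T.L.lower c.d c.al c.wl c.wh T.U
  U := T.L.upper c.d c.ah c.wl c.wh T.U

/-- Positive if the test has found a singular matrix. -/
def result (T : Test) : ℤ := if 0 < T.flag then 1 else if 0 < T.L.apartZ T.U then 0 else 1

/-- The invariant of the singularity test. -/
structure Inv (PA PW : ℕ → Set ℝ) (k : ℕ) (T : Test) : Prop where
  sign : T.τ = 1 ∨ T.τ = -1
  singular : 0 < T.flag → Reach PA PW k 0 0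
  validL : T.L.toReal.Valid
  validU : T.U.toReal.Valid
  le : ¬ 0 < T.flag → T.L.toReal.Le T.U.toReal
  sound : ¬ 0 < T.flag → ∀ p q, Reach PA PW k p q →
    ∃ s : St ℝ, s.Valid ∧ T.L.toReal.Le s ∧ s.Le T.U.toReal ∧ s.Rel T.τ p q
  complete : ¬ 0 < T.flag → ∀ s : St ℝ, s.Valid → T.L.toReal.Le s → s.Le T.U.toReal →
    ∃ p q, Reach PA PW k p q ∧ s.Rel T.τ p q

theorem inv_init (PA PW : ℕ → Set ℝ) : Inv PA PW 0 init where
  sign := .inl rfl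
  singular h := absurd h (lt_irrefl _)
  validL := .inr (by simp [init, St.toReal])
  validU := .inr (by simp [init, St.toReal])
  le _ := .refl _
  sound _ := by
    rintro p q ⟨rfl, rfl⟩
    exact ⟨⟨0, 0, 1⟩, .inr (by simp), by simp [init, St.toReal, St.Le],
      by simp [init, St.toReal, St.Le], 1, by simp [init]⟩
  complete _ s hs h h' := by
    refine ⟨0, 1, ⟨rfl, rfl⟩, ?_⟩
    have : (St.Rel ((init.τ : ℤ) : ℝ) (init.L.toReal) 0 1) := ⟨1, by simp [init, St.toReal]⟩
    exact this.of_equiv (.inr (by simp [init, St.toReal])) hs h h'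

/-- The coefficients `c` describe the ranges of the `k`-th row. -/
structure Describes (PA PW : ℕ → Set ℝ) (k : ℕ) (τ : ℤ) (c : Coef) : Prop where
  d_pos : 0 < c.d
  al_le : c.al ≤ c.ah
  wh_nonneg : 0 ≤ c.wh
  range : ∃ σ : ℤ, (σ = 1 ∨ σ = -1) ∧ c.τ = τ * σ ∧
    (fun a : ℝ => c.d * (c.τ * a)) '' PA k = Set.Icc (c.al : ℝ) c.ah ∧
    (fun w : ℝ => c.d * (σ * w)) '' PW k = Set.Icc (c.wl : ℝ) c.wh
  wl_le : c.wl ≤ c.wh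

/-- Corner bounds give soundness, attainment of everything between them gives completeness.
Completeness is also what makes the flag exact: a zero found in the interval is a real choice of
entries. -/
theorem Inv.step {PA PW : ℕ → Set ℝ} {k : ℕ} {T : Test} {c : Coef} (h : Inv PA PW k T)
    (hc : Describes PA PW k T.τ c) : Inv PA PW (k + 1) (T.step c) := by
  obtain ⟨σ, hσ, hτ, hA, hW⟩ := hc.range
  have hd : (0 : ℝ) < c.d := by exact_mod_cast hc.d_pos
  have hal : (c.al : ℝ) ≤ c.ah := by exact_mod_cast hc.al_le
  have hwl : (c.wl : ℝ) ≤ c.wh := by exact_mod_cast hc.wl_le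
  have hσ1 : (σ : ℝ) * σ = 1 := by rcases hσ with rfl | rfl <;> norm_num
  have hτ1 : (T.τ : ℝ) * T.τ = 1 := by rcases h.sign with h | h <;> rw [h] <;> norm_num
  have hτ' : (c.τ : ℝ) = T.τ * σ := by exact_mod_cast hτ
  have hσ0 : (σ : ℝ) ≠ 0 := by intro h; rw [h] at hσ1; norm_num at hσ1
  have hA' : ∀ a ∈ PA k, (c.d * (c.τ * a) : ℝ) ∈ Set.Icc (c.al : ℝ) c.ah :=
    fun a ha => hA ▸ Set.mem_image_of_mem _ ha
  have hW' : ∀ w ∈ PW k, (c.d * (σ * w) : ℝ) ∈ Set.Icc (c.wl : ℝ) c.wh :=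
    fun a ha => hW ▸ Set.mem_image_of_mem _ ha
  obtain ⟨a₁, ha₁, -⟩ : (c.al : ℝ) ∈ (fun a : ℝ => c.d * (c.τ * a)) '' PA k := by
    rw [hA]; exact ⟨le_rfl, hal⟩
  obtain ⟨w₁, hw₁, -⟩ : (c.wl : ℝ) ∈ (fun w : ℝ => c.d * (σ * w)) '' PW k := by
    rw [hW]; exact ⟨le_rfl, hwl⟩
  have vL := St.valid_lower hc.d_pos c.al c.wl c.wh T.L T.U
  have vU := St.valid_upper hc.d_pos c.ah c.wl c.wh T.L T.U
  -- An unraised flag is precisely the hypothesis of the lemmas on images of intervals.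
  have hflag : ¬ 0 < (T.step c).flag →
      ¬ 0 < T.flag ∧ (0 < (c.wl : ℝ) ∨ St.Apart T.L.toReal T.U.toReal) := by
    simp only [Test.step]
    split_ifs with h1 h2 h3
    · simp
    · exact fun _ => ⟨h1, .inl (by exact_mod_cast h2)⟩
    · exact fun _ => ⟨h1, .inr ((St.apartZ_pos_iff _ _).1 h3)⟩
    · simp
  have up : ∀ {s : St ℝ} {a w : ℝ}, (0 < (c.wl : ℝ) ∨ St.Apart T.L.toReal T.U.toReal) →
      s.Valid → T.L.toReal.Le s → s.Le T.U.toReal → a ≤ c.ah → c.wl ≤ w → w ≤ c.wh →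
      (s.next (c.d : ℝ) a w).Le (T.step c).U.toReal := fun h1 vs h2 h3 h4 h5 h6 =>
    St.next_le hd h.validL h.validU h1 vs h2 h3 h4 h5 h6 vU
      (St.next_le_upper hc.d_pos _ _ _ _ _ (.inl rfl) (.inl rfl))
      (St.next_le_upper hc.d_pos _ _ _ _ _ (.inl rfl) (.inr rfl))
      (St.next_le_upper hc.d_pos _ _ _ _ _ (.inr rfl) (.inl rfl))
      (St.next_le_upper hc.d_pos _ _ _ _ _ (.inr rfl) (.inr rfl))
  have lo : ∀ {s : St ℝ} {a w : ℝ}, (0 < (c.wl : ℝ) ∨ St.Apart T.L.toReal T.U.toReal) →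
      s.Valid → T.L.toReal.Le s → s.Le T.U.toReal → c.al ≤ a → c.wl ≤ w → w ≤ c.wh →
      (T.step c).L.toReal.Le (s.next (c.d : ℝ) a w) := fun h1 vs h2 h3 h4 h5 h6 =>
    St.le_next hd h.validL h.validU h1 vs h2 h3 h4 h5 h6 vL
      (St.lower_le_next hc.d_pos _ _ _ _ _ (.inl rfl) (.inl rfl))
      (St.lower_le_next hc.d_pos _ _ _ _ _ (.inl rfl) (.inr rfl))
      (St.lower_le_next hc.d_pos _ _ _ _ _ (.inr rfl) (.inl rfl))
      (St.lower_le_next hc.d_pos _ _ _ _ _ (.inr rfl) (.inr rfl))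
  have nondeg : ∀ {s : St ℝ} {w : ℝ}, ¬ 0 < T.flag →
      (0 < (c.wl : ℝ) ∨ St.Apart T.L.toReal T.U.toReal) →
      s.Valid → T.L.toReal.Le s → s.Le T.U.toReal → c.wl ≤ c.d * (σ * w) → s.v ≠ 0 ∨ w ≠ 0 := by
    intro s w h0 h1 vs h2 h3 h4
    rcases h1 with h1 | h1
    · right
      rintro rfl
      simp only [mul_zero] at h4
      linarith
    · exact .inl (h1.ne_zero vs h.validL h.validU h2 h3)
  refine ⟨?_, ?_, vL, vU, ?_, ?_, ?_⟩
  · show c.τ = 1 ∨ c.τ = -1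
    rw [hτ]
    rcases h.sign with h | h <;> rcases hσ with h' | h' <;> simp [h, h']
  · intro hf
    by_cases h0 : 0 < T.flag
    · exact ⟨0, h.singular h0, a₁, ha₁, w₁, hw₁, by simp⟩
    · have h1 : ¬ 0 < c.wl ∧ ¬ St.Apart T.L.toReal T.U.toReal := by
        rw [← St.apartZ_pos_iff]
        simp only [Test.step, h0, if_false] at hf
        split_ifs at hf with h1 h2
        · exact absurd hf (lt_irrefl _)
        · exact absurd hf (lt_irrefl _)
        · exact ⟨h1, h2⟩
      -- The zero state comes from a reachable pair `(p, 0)`; the choice `w = 0` then leads to `(0,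
      -- 0)`.
      obtain ⟨s, vs, s0, h2, h3⟩ := St.exists_zero_of_not_apart h.validL h.validU (h.le h0) h1.2
      obtain ⟨p, q, hr, l, hl, rfl, hq⟩ := h.complete h0 s vs h2 h3
      obtain rfl : q = 0 := by
        rw [s0, mul_zero] at hq
        rcases mul_eq_zero.1 hq with hq | hq
        · rw [hq] at hτ1; norm_num at hτ1
        · exact hq
      obtain ⟨w, hw, e⟩ : (0 : ℝ) ∈ (fun w : ℝ => c.d * (σ * w)) '' PW k := by
        rw [hW]
        exact ⟨by exact_mod_cast not_lt.1 h1.1, by exact_mod_cast hc.wh_nonneg⟩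
      obtain rfl : w = 0 := by simpa [hd.ne', hσ0] using e
      exact ⟨_, hr, a₁, ha₁, 0, hw, by simp⟩
  · intro hf
    obtain ⟨h0, h1⟩ := hflag hf
    have e1 := lo h1 h.validL (.refl _) (h.le h0) le_rfl le_rfl hwl
    have e2 := up h1 h.validL (.refl _) (h.le h0) hal le_rfl hwl
    exact e1.trans e2 vL (St.valid_next hd _) vU
  · rintro hf p q ⟨p₀, hr, a, ha, w, hw, rfl⟩
    obtain ⟨h0, h1⟩ := hflag hf
    obtain ⟨s, vs, h2, h3, hs⟩ := h.sound h0 _ _ hr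
    obtain ⟨A1, A2⟩ := hA' a ha
    obtain ⟨W1, W2⟩ := hW' w hw
    refine ⟨s.next (c.d : ℝ) (c.d * (c.τ * a)) (c.d * (σ * w)), St.valid_next hd _,
      lo h1 vs h2 h3 A1 W1 W2, up h1 vs h2 h3 A2 W1 W2, ?_⟩
    show St.Rel (c.τ : ℝ) _ _ _
    rw [hτ']
    exact hs.next hτ1 hσ1 hd vs (nondeg h0 h1 vs h2 h3 W1)
  · intro hf s' vs' hL' hU'
    obtain ⟨h0, h1⟩ := hflag hf
    obtain ⟨s₀, w₀, hs₀, hw₀, e₀⟩ := St.lower_eq c.d c.al c.wl c.wh T.L T.U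
    obtain ⟨s₁, w₁, hs₁, hw₁, e₁⟩ := St.upper_eq c.d c.ah c.wl c.wh T.L T.U
    have hL'' : (s₀.toReal.next (c.d : ℝ) c.al w₀).Le s' := by
      rw [← St.toReal_next, ← e₀]; exact hL'
    have hU'' : s'.Le (s₁.toReal.next (c.d : ℝ) c.ah w₁) := by
      rw [← St.toReal_next, ← e₁]; exact hU'
    have m : ∀ w, w = c.wl ∨ w = c.wh → (w : ℝ) ∈ Set.Icc (c.wl : ℝ) c.wh := by
      rintro w (rfl | rfl)
      exacts [⟨le_rfl, hwl⟩, ⟨hwl, le_rfl⟩]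
    obtain ⟨s, vs, h2, h3, x, hx, y, hy, h4, h5⟩ := St.exists_next_equiv_of_between hd h.validL
      h.validU (h.le h0) hal h1 (hs₀.imp (congrArg _) (congrArg _))
      (hs₁.imp (congrArg _) (congrArg _)) (m _ hw₀) (m _ hw₁) vs' hL'' hU''
    obtain ⟨a, ha, rfl⟩ := hA.symm ▸ hx
    obtain ⟨w, hw, rfl⟩ := hW.symm ▸ hy
    obtain ⟨p, q, hr, hs⟩ := h.complete h0 s vs h2 h3
    refine ⟨q, a * q - w * p, ⟨p, hr, a, ha, w, hw, rfl⟩, ?_⟩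
    refine St.Rel.of_equiv ?_ (St.valid_next hd _) vs' h4 h5
    show St.Rel (c.τ : ℝ) _ _ _
    simp only [hτ']
    exact hs.next hτ1 hσ1 hd vs (nondeg h0 h1 vs h2 h3 hy.1)

theorem Inv.result_pos_iff {PA PW : ℕ → Set ℝ} {k : ℕ} {T : Test} (h : Inv PA PW k T) :
    0 < T.result ↔ ∃ p, Reach PA PW k p 0 := by
  have hτ : (T.τ : ℝ) ≠ 0 := by rcases h.sign with h | h <;> rw [h] <;> norm_num
  unfold result
  split_ifs with h0 h1
  · exact ⟨fun _ => ⟨0, h.singular h0⟩, fun _ => one_pos⟩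
  · simp only [lt_irrefl, false_iff]
    rintro ⟨p, hp⟩
    obtain ⟨s, vs, h2, h3, l, hl, -, hq⟩ := h.sound h0 _ _ hp
    rw [St.apartZ_pos_iff] at h1
    refine h1.ne_zero vs h.validL h.validU h2 h3 ?_
    simpa [hl] using hq.symm
  · rw [St.apartZ_pos_iff] at h1
    simp only [one_pos, true_iff]
    obtain ⟨s, vs, s0, h2, h3⟩ := St.exists_zero_of_not_apart h.validL h.validU (h.le h0) h1
    obtain ⟨p, q, hr, l, hl, -, hq⟩ := h.complete h0 s vs h2 h3
    obtain rfl : q = 0 := by simpa [s0, hτ] using hq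
    exact ⟨p, hr⟩

end Test

/-! ### Determinants of tridiagonal matrices -/

/-- The tridiagonal matrix with diagonal `a`, superdiagonal `b` and subdiagonal `c`. -/
def triMatrix (a b c : ℕ → ℝ) (n : ℕ) : Matrix (Fin n) (Fin n) ℝ :=
  Matrix.of fun i j => if (i : ℕ) = j then a i else if (i : ℕ) + 1 = j then b i else
    if (j : ℕ) + 1 = i then c j else 0

/-- Consecutive leading minors, by the three-term recurrence. -/
def minors (a w : ℕ → ℝ) : ℕ → ℝ × ℝ
  | 0 => (0, 1)
  | k + 1 => ((minors a w k).2, a k * (minors a w k).2 - w k * (minors a w k).1)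

theorem minors_congr {a w a' w' : ℕ → ℝ} {k : ℕ} (ha : ∀ i < k, a i = a' i)
    (hw : ∀ i < k, w i = w' i) : minors a w k = minors a' w' k := by
  induction k with
  | zero => rfl
  | succ k ih =>
    rw [minors, minors, ih (fun i hi => ha i (by omega)) (fun i hi => hw i (by omega)),
      ha k (by omega), hw k (by omega)]

/-- Choices in different rows are independent, so one for the first `k` rows can be changed freely
at row `k`. Nonemptiness fills in the irrelevant rows beyond. -/
theorem reach_iff {PA PW : ℕ → Set ℝ} (hA : ∀ k, (PA k).Nonempty) (hW : ∀ k, (PW k).Nonempty)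
    (k : ℕ) (p q : ℝ) : Reach PA PW k p q ↔
      ∃ a w : ℕ → ℝ, (∀ i, a i ∈ PA i) ∧ (∀ i, w i ∈ PW i) ∧ minors a w k = (p, q) := by
  induction k generalizing p q with
  | zero =>
    constructor
    · rintro ⟨rfl, rfl⟩
      choose a ha using hA
      choose w hw using hW
      exact ⟨a, w, ha, hw, rfl⟩
    · rintro ⟨a, w, -, -, h⟩
      simp only [minors, Prod.mk.injEq] at h
      exact ⟨h.1.symm, h.2.symm⟩
  | succ k ih =>
    constructor
    · rintro ⟨p₀, hr, x, hx, y, hy, rfl⟩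
      obtain ⟨a, w, ha, hw, h⟩ := (ih _ _).1 hr
      refine ⟨Function.update a k x, Function.update w k y, fun i => ?_, fun i => ?_, ?_⟩
      · rcases eq_or_ne i k with rfl | hi
        · simpa using hx
        · simpa [hi] using ha i
      · rcases eq_or_ne i k with rfl | hi
        · simpa using hy
        · simpa [hi] using hw i
      · rw [minors, minors_congr (a' := a) (w' := w), h]
        · simp
        · intro i hi; simp [hi.ne]
        · intro i hi; simp [hi.ne]
    · rintro ⟨a, w, ha, hw, h⟩
      simp only [minors, Prod.mk.injEq] at h
      exact ⟨(minors a w k).1, (ih _ _).2 ⟨a, w, ha, hw, by rw [← h.1]⟩, a k, ha k, w k, hw k,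
        by rw [← h.1, ← h.2]⟩

/-- Expansion along the last row leaves two terms; the off-diagonal minor is then expanded along its
last column, where only `b n` survives. -/
theorem det_triMatrix_succ_succ (a b c : ℕ → ℝ) (n : ℕ) : (triMatrix a b c (n + 2)).det =
    a (n + 1) * (triMatrix a b c (n + 1)).det - b n * c n * (triMatrix a b c n).det := by
  rw [Matrix.det_succ_row _ (Fin.last (n + 1)), Fin.sum_univ_castSucc, Fin.sum_univ_castSucc]
  have h0 : ∀ i : Fin n, triMatrix a b c (n + 2) (Fin.last (n + 1)) i.castSucc.castSucc = 0 := by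
    intro i
    have := i.2
    simp [triMatrix, show ¬ (n + 1 = i) by omega, show ¬ (n + 1 + 1 = i) by omega,
      show ¬ ((i : ℕ) = n) by omega]
  rw [Finset.sum_eq_zero (fun i _ => by rw [h0]; simp)]
  have h1 : triMatrix a b c (n + 2) (Fin.last (n + 1)) (Fin.last n).castSucc = c n := by
    simp [triMatrix, show ¬ (n + 1 + 1 = n) by omega]
  have h2 : triMatrix a b c (n + 2) (Fin.last (n + 1)) (Fin.last (n + 1)) = a (n + 1) := by
    simp [triMatrix]
  have h3 : (triMatrix a b c (n + 2)).submatrix (Fin.last (n + 1)).succAbove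
      (Fin.last (n + 1)).succAbove = triMatrix a b c (n + 1) := by
    ext i j; simp [triMatrix]
  have h4 : ((triMatrix a b c (n + 2)).submatrix (Fin.last (n + 1)).succAbove
      (Fin.last n).castSucc.succAbove).det = b n * (triMatrix a b c n).det := by
    rw [Matrix.det_succ_column _ (Fin.last n), Fin.sum_univ_castSucc]
    have e : (Fin.last n).castSucc.succAbove (Fin.last n) = Fin.last (n + 1) := by
      simp [Fin.succAbove]
    have h5 : ∀ i : Fin n, triMatrix a b c (n + 2) i.castSucc.castSucc (Fin.last (n + 1)) = 0 := by
      intro i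
      have := i.2
      simp [triMatrix, show ¬ ((i : ℕ) = n + 1) by omega, show ¬ ((i : ℕ) = n) by omega,
        show ¬ (n + 1 + 1 = i) by omega]
    rw [Finset.sum_eq_zero (fun i _ => by simp [e, h5])]
    have h6 : triMatrix a b c (n + 2) (Fin.last n).castSucc (Fin.last (n + 1)) = b n := by
      simp [triMatrix]
    have h7 : ((triMatrix a b c (n + 2)).submatrix (Fin.last (n + 1)).succAbove
      (Fin.last n).castSucc.succAbove).submatrix (Fin.last n).succAbove (Fin.last n).succAbove =
      triMatrix a b c n := by
      ext i j
      have e2 : (Fin.last n).castSucc.succAbove j.castSucc = j.castSucc.castSucc := by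
        simp [Fin.succAbove, Fin.lt_def]
      simp [triMatrix, e2]
    rw [h7]
    simp [e, h6, ← two_mul]
  rw [h1, h2, h3, h4]
  have h8 : (-1 : ℝ) ^ (n + 1 + n) = -1 := by
    rw [show n + 1 + n = 2 * n + 1 by ring, pow_succ, pow_mul]; simp
  simp [← two_mul, h8]
  ring

/-- The value `w 0` is arbitrary, because it multiplies the initial 0 of the recurrence. -/
theorem det_triMatrix (a b c : ℕ → ℝ) (w : ℕ → ℝ) (hw : ∀ k, w (k + 1) = b k * c k) (n : ℕ) :
    (triMatrix a b c n).det = (minors a w n).2 := by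
  induction n using Nat.strong_induction_on with
  | _ n ih =>
    match n with
    | 0 => simp [minors]
    | 1 => simp [minors, triMatrix]
    | n + 2 =>
      rw [det_triMatrix_succ_succ, ih n (by omega), ih (n + 1) (by omega)]
      simp [minors, hw]

/-! ### The ranges of the rows -/

/-- The entries of a matrix, extended by zero. -/
def extendZero {n : ℕ} {R : Type*} [Zero R] (M : Matrix (Fin n) (Fin n) R) (i j : ℕ) : R :=
  if h : i < n ∧ j < n then M ⟨i, h.1⟩ ⟨j, h.2⟩ else 0

section Range

variable {n : ℕ} (A E : Matrix (Fin n) (Fin n) ℝ)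

def entryRange (i j : ℕ) : Set ℝ :=
  Set.Icc (extendZero A i j - extendZero E i j) (extendZero A i j + extendZero E i j)

def diagRange (k : ℕ) : Set ℝ := entryRange A E k k

/-- At `k = 0` truncated subtraction gives a product of diagonal ranges; it is harmless, as `w 0`
does not affect the minors. -/
def prodRange (k : ℕ) : Set ℝ :=
  Set.image2 (· * ·) (entryRange A E (k - 1) k) (entryRange A E k (k - 1))

variable {A E}

theorem entryRange_nonempty (hE : ∀ i j, 0 ≤ E i j) (i j : ℕ) : (entryRange A E i j).Nonempty := by
  refine ⟨extendZero A i j, ?_⟩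
  have : 0 ≤ extendZero E i j := by
    unfold extendZero
    split_ifs with h
    exacts [hE _ _, le_rfl]
  exact ⟨by linarith, by linarith⟩

/-- Each opposite pair of off-diagonal entries enters the determinant only through its own product,
so choosing products from their ranges is the same as choosing entries. -/
theorem intervalSingular_iff_reach (hE : ∀ i j, 0 ≤ E i j)
    (h : ∀ i j : Fin n, (i : ℕ) + 1 < j ∨ (j : ℕ) + 1 < i → A i j = 0 ∧ E i j = 0) :
    IntervalSingular A E ↔ ∃ p, Reach (diagRange A E) (prodRange A E) n p 0 := by
  have e1 := entryRange_nonempty (A := A) hE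
  simp only [reach_iff (PA := diagRange A E) (PW := prodRange A E) (fun k => e1 k k) (fun k => (e1 (k - 1) k).image2 (e1 k (k - 1)))]
  constructor
  · rintro ⟨M, hM, hdet⟩
    have hM' : ∀ i j, extendZero M i j ∈ entryRange A E i j := by
      intro i j
      unfold entryRange extendZero
      split_ifs with h
      exacts [hM _ _, by simp]
    refine ⟨_, fun k => extendZero M k k,
      fun k => extendZero M (k - 1) k * extendZero M k (k - 1), fun k => hM' k k,
      fun k => ⟨_, hM' _ _, _, hM' _ _, rfl⟩, Prod.ext rfl ?_⟩
    rw [← det_triMatrix _ (fun k => extendZero M k (k + 1)) (fun k => extendZero M (k + 1) k) _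
      (fun k => rfl), ← hdet]
    congr 1
    ext i j
    simp only [triMatrix, Matrix.of_apply, extendZero]
    split_ifs with h1 h2 h3 h4 h5 h6
    · congr 1; exact Fin.ext h1
    · omega
    · congr 1; exact Fin.ext h3
    · omega
    · congr 1; exact Fin.ext h5
    · omega
    · obtain ⟨h7, h8⟩ := h i j (by omega)
      have := hM i j
      rw [h7, h8] at this
      linarith [this.1, this.2]
  · rintro ⟨p, a, w, ha, hw, hm⟩
    choose b hb c hc hbc using hw
    refine ⟨triMatrix a (fun k => b (k + 1)) (fun k => c (k + 1)) n, fun i j => ?_, ?_⟩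
    · have key : ∀ x, x ∈ entryRange A E i j → A i j - E i j ≤ x ∧ x ≤ A i j + E i j := by
        intro x hx
        simpa [entryRange, extendZero] using hx
      simp only [triMatrix, Matrix.of_apply]
      split_ifs with h1 h2 h3
      · have := ha i
        rw [diagRange] at this
        nth_rewrite 2 [h1] at this
        exact key _ this
      · have := hb (i + 1)
        rw [Nat.add_sub_cancel] at this
        nth_rewrite 1 [h2] at this
        exact key _ this
      · have := hc (j + 1)
        rw [Nat.add_sub_cancel] at this
        nth_rewrite 1 [h3] at this
        exact key _ this
      · obtain ⟨h7, h8⟩ := h i j (by omega)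
        rw [h7, h8]
        simp
    · rw [det_triMatrix _ _ _ w (fun k => (hbc (k + 1)).symm), hm]

end Range

/-! ### Coefficients -/

def minInt (x y : ℤ) : ℤ := if 0 < y - x then x else y

theorem minInt_eq (x y : ℤ) : minInt x y = min x y := by
  unfold minInt
  split_ifs <;> omega

def absInt (x : ℤ) : ℤ := if 0 < x then x else 0 - x

theorem absInt_eq (x : ℤ) : absInt x = |x| := by
  unfold absInt
  split_ifs with h
  · rw [abs_of_pos h]
  · rw [abs_of_nonpos (not_lt.1 h), zero_sub]

/-- A rational number and a radius, as numerators and denominators. -/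
structure Entry where
  num : ℤ
  den : ℤ
  num' : ℤ
  den' : ℤ

namespace Entry

/-- A common denominator of the entry and of its radius `(j / q) * (num' / den')`. -/
def scale (q : ℤ) (e : Entry) : ℤ := e.den * e.den' * q

def center (q : ℤ) (e : Entry) : ℤ := e.num * e.den' * q

def radius (j : ℤ) (e : Entry) : ℤ := j * (e.num' * e.den)

/-- The lower bound of the interval around the absolute value. -/
def lo (j q : ℤ) (e : Entry) : ℤ := absInt e.num * e.den' * q - e.radius j

def hi (j q : ℤ) (e : Entry) : ℤ := absInt e.num * e.den' * q + e.radius j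

structure Represents (e : Entry) (α ρ : ℝ) (j q : ℤ) : Prop where
  scale_pos : 0 < e.scale q
  center_eq : (e.center q : ℝ) = e.scale q * α
  radius_eq : (e.radius j : ℝ) = e.scale q * ρ
  abs_eq : ((absInt e.num * e.den' * q : ℤ) : ℝ) = e.scale q * |α|
  neg_iff : e.num < 0 ↔ α < 0
  pos_iff : 0 < e.num ↔ 0 < α

theorem represents (r s : ℚ) {j q : ℤ} (hq : 0 < q) :
    (Entry.mk r.num r.den s.num s.den).Represents r ((j / q : ℝ) * s) j q := by
  have h1 : (0 : ℝ) < r.den := by exact_mod_cast r.den_pos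
  have h2 : (0 : ℝ) < s.den := by exact_mod_cast s.den_pos
  have h3 : (0 : ℝ) < q := by exact_mod_cast hq
  have hr : (r.num : ℝ) = r.den * r := by
    have : (r.num : ℚ) = r.den * r := by rw [mul_comm]; exact (Rat.mul_den_eq_num r).symm
    exact_mod_cast this
  have hs : (s.num : ℝ) = s.den * s := by
    have : (s.num : ℚ) = s.den * s := by rw [mul_comm]; exact (Rat.mul_den_eq_num s).symm
    exact_mod_cast this
  refine ⟨?_, ?_, ?_, ?_, ?_, ?_⟩
  · have := r.den_pos
    have := s.den_pos
    simp only [scale]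
    positivity
  · simp only [center, scale]; push_cast; rw [hr]; ring
  · simp only [radius, scale]; push_cast; rw [hs]; field_simp
  · simp only [scale, absInt_eq]; push_cast; rw [hr, abs_mul, abs_of_pos h1]; ring
  · rw [Rat.num_neg]; norm_cast
  · rw [Rat.num_pos]; norm_cast

end Entry

namespace Coef

/-- The sign after a row with the off-diagonal entries `b` and `c`. -/
def sign (τ : ℤ) (b c : Entry) : ℤ := if 0 < 0 - b.num * c.num then 0 - τ else τ

/-- The coefficients of the step for a row with the diagonal entry `a`, the off-diagonal entries
`b` and `c`, the sign `τ` and the perturbation parameter `j / q`. -/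
def ofEntries (τ j q : ℤ) (a b c : Entry) : Coef where
  τ := sign τ b c
  d := a.scale q * (b.scale q * c.scale q)
  al := (sign τ b c * a.center q - a.radius j) * (b.scale q * c.scale q)
  ah := (sign τ b c * a.center q + a.radius j) * (b.scale q * c.scale q)
  wl := a.scale q * minInt (minInt (b.lo j q * c.hi j q) (b.hi j q * c.lo j q))
    (b.lo j q * c.lo j q)
  wh := a.scale q * (b.hi j q * c.hi j q)

theorem image_mul_Icc {d τ α ρ : ℝ} (hd : 0 < d) (hτ : τ = 1 ∨ τ = -1) :
    (fun a : ℝ => d * (τ * a)) '' Set.Icc (α - ρ) (α + ρ) =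
      Set.Icc (d * (τ * α - ρ)) (d * (τ * α + ρ)) := by
  ext y
  constructor
  · rintro ⟨a, ⟨h1, h2⟩, rfl⟩
    refine ⟨mul_le_mul_of_nonneg_left ?_ hd.le, mul_le_mul_of_nonneg_left ?_ hd.le⟩ <;>
      rcases hτ with rfl | rfl <;> linarith
  · rintro ⟨h1, h2⟩
    have h3 : τ * α - ρ ≤ y / d := by rw [le_div_iff₀ hd]; linarith
    have h4 : y / d ≤ τ * α + ρ := by rw [div_le_iff₀ hd]; linarith
    refine ⟨τ * (y / d), ?_, ?_⟩
    · constructor <;> rcases hτ with rfl | rfl <;> linarith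
    · simp only
      rw [← mul_assoc τ, show τ * τ = 1 by rcases hτ with rfl | rfl <;> norm_num]
      field_simp

/-- The last two hypotheses say that the midpoints are nonnegative, so `b₁ * c₁` is the largest
corner. Segments from the other corners to it fill the values between. -/
theorem image2_mul_Icc {b₀ b₁ c₀ c₁ : ℝ} (hb : b₀ ≤ b₁) (hc : c₀ ≤ c₁) (hb' : -b₁ ≤ b₀)
    (hc' : -c₁ ≤ c₀) : Set.image2 (· * ·) (Set.Icc b₀ b₁) (Set.Icc c₀ c₁) =
      Set.Icc (min (min (b₀ * c₁) (b₁ * c₀)) (b₀ * c₀)) (b₁ * c₁) := by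
  have h1 : b₀ * c₁ ≤ b₁ * c₁ := by nlinarith
  have h2 : b₁ * c₀ ≤ b₁ * c₁ := by nlinarith
  have h3 : b₀ * c₀ ≤ b₁ * c₁ := by nlinarith
  ext y
  constructor
  · rintro ⟨b, ⟨hb1, hb2⟩, c, ⟨hc1, hc2⟩, rfl⟩
    exact ⟨St.le_mul_of_corners hb1 hb2 hc1 hc2 (by simp) (by simp) (by simp)
      ((min_le_right _ _).trans h3), St.mul_le_of_corners hb1 hb2 hc1 hc2 h3 h1 h2 le_rfl⟩
  · rintro ⟨hy1, hy2⟩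
    have key : ∀ b ∈ Set.Icc b₀ b₁, ∀ c ∈ Set.Icc c₀ c₁, b * c ≤ y →
        y ∈ Set.image2 (· * ·) (Set.Icc b₀ b₁) (Set.Icc c₀ c₁) := by
      intro b hb1 c hc1 hbc
      let f : ℝ → ℝ := fun θ => (AffineMap.lineMap b b₁ θ : ℝ) * (AffineMap.lineMap c c₁ θ : ℝ)
      have hf : ContinuousOn f (Set.Icc 0 1) := by
        simp only [f, AffineMap.lineMap_apply_module]
        fun_prop
      obtain ⟨θ, hθ, hθ'⟩ := intermediate_value_Icc (zero_le_one' ℝ) hf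
        (show y ∈ Set.Icc (f 0) (f 1) by
          simpa only [f, AffineMap.lineMap_apply_zero, AffineMap.lineMap_apply_one] using
            ⟨hbc, hy2⟩)
      exact ⟨_, (convex_Icc b₀ b₁).lineMap_mem hb1 ⟨hb, le_rfl⟩ hθ, _,
        (convex_Icc c₀ c₁).lineMap_mem hc1 ⟨hc, le_rfl⟩ hθ, hθ'⟩
    rcases min_le_iff.1 hy1 with h | h
    · rcases min_le_iff.1 h with h | h
      · exact key b₀ ⟨le_rfl, hb⟩ c₁ ⟨hc, le_rfl⟩ h
      · exact key b₁ ⟨hb, le_rfl⟩ c₀ ⟨le_rfl, hc⟩ h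
    · exact key b₀ ⟨le_rfl, hb⟩ c₀ ⟨le_rfl, hc⟩ h

theorem mem_Icc_abs_iff {τ α ρ b : ℝ} (hτ : τ = 1 ∨ τ = -1) (h : τ * α = |α|) :
    τ * b ∈ Set.Icc (|α| - ρ) (|α| + ρ) ↔ b ∈ Set.Icc (α - ρ) (α + ρ) := by
  rw [← h]
  rcases hτ with rfl | rfl <;> constructor <;> rintro ⟨h1, h2⟩ <;> constructor <;> linarith

/-- Reflecting each factor so that its centre becomes nonnegative multiplies all products by the
single sign `σ`. -/
theorem image_image2_mul_Icc {σ β γ ρ ρ' : ℝ} (hσ : σ = 1 ∨ σ = -1) (h : σ * (β * γ) = |β| * |γ|) :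
    (fun w : ℝ => σ * w) '' Set.image2 (· * ·) (Set.Icc (β - ρ) (β + ρ))
      (Set.Icc (γ - ρ') (γ + ρ')) =
    Set.image2 (· * ·) (Set.Icc (|β| - ρ) (|β| + ρ)) (Set.Icc (|γ| - ρ') (|γ| + ρ')) := by
  obtain ⟨μ, ν, hμ, hν, hβ, hγ, rfl⟩ : ∃ μ ν : ℝ, (μ = 1 ∨ μ = -1) ∧ (ν = 1 ∨ ν = -1) ∧
      μ * β = |β| ∧ ν * γ = |γ| ∧ σ = μ * ν := by
    have s : ∀ x : ℝ, ∃ μ : ℝ, (μ = 1 ∨ μ = -1) ∧ μ * x = |x| := by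
      intro x
      rcases le_total 0 x with hx | hx
      · exact ⟨1, .inl rfl, by rw [abs_of_nonneg hx, one_mul]⟩
      · exact ⟨-1, .inr rfl, by rw [abs_of_nonpos hx]; ring⟩
    obtain ⟨μ, hμ, hβ⟩ := s β
    obtain ⟨ν, hν, hγ⟩ := s γ
    have sq : ∀ x : ℝ, x = 1 ∨ x = -1 → x * x = 1 := by rintro x (rfl | rfl) <;> norm_num
    have pm : ∀ x y : ℝ, x = 1 ∨ x = -1 → y = 1 ∨ y = -1 → x * y = 1 ∨ x * y = -1 := by
      rintro x y (rfl | rfl) (rfl | rfl) <;> norm_num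
    -- An interval centred at 0 is symmetric, so the sign of its factor is free and is chosen to
    -- match `σ`.
    by_cases hb : β = 0
    · refine ⟨σ * ν, ν, pm _ _ hσ hν, hν, by simp [hb], hγ, ?_⟩
      rw [mul_assoc, sq ν hν, mul_one]
    by_cases hc : γ = 0
    · refine ⟨μ, σ * μ, hμ, pm _ _ hσ hμ, hβ, by simp [hc], ?_⟩
      rw [mul_comm σ, ← mul_assoc, sq μ hμ, one_mul]
    refine ⟨μ, ν, hμ, hν, hβ, hγ, ?_⟩
    rw [← hβ, ← hγ] at h
    have : (σ - μ * ν) * (β * γ) = 0 := by linear_combination h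
    rcases mul_eq_zero.1 this with h' | h'
    · linarith
    · exact absurd h' (mul_ne_zero hb hc)
  have sq : ∀ x : ℝ, x = 1 ∨ x = -1 → x * x = 1 := by rintro x (rfl | rfl) <;> norm_num
  ext y
  constructor
  · rintro ⟨w, ⟨b, hb, c, hc, rfl⟩, rfl⟩
    refine ⟨μ * b, (mem_Icc_abs_iff hμ hβ).2 hb, ν * c, (mem_Icc_abs_iff hν hγ).2 hc, ?_⟩
    simp only; ring
  · rintro ⟨b, hb, c, hc, rfl⟩
    refine ⟨_, ⟨μ * b, (mem_Icc_abs_iff hμ hβ).1 ?_, ν * c, (mem_Icc_abs_iff hν hγ).1 ?_, rfl⟩, ?_⟩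
    · rwa [← mul_assoc, sq μ hμ, one_mul]
    · rwa [← mul_assoc, sq ν hν, one_mul]
    · simp only
      linear_combination (b * c) * ν * ν * sq μ hμ + b * c * sq ν hν

theorem describes {PA PW : ℕ → Set ℝ} {k : ℕ} {τ j q : ℤ} {a b c : Entry}
    {α β γ ρ₁ ρ₂ ρ₃ : ℝ} (ha : a.Represents α ρ₁ j q) (hb : b.Represents β ρ₂ j q)
    (hc : c.Represents γ ρ₃ j q) (h1 : 0 ≤ ρ₁) (h2 : 0 ≤ ρ₂) (h3 : 0 ≤ ρ₃)
    (hτ : τ = 1 ∨ τ = -1) (hPA : PA k = Set.Icc (α - ρ₁) (α + ρ₁))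
    (hPW : PW k = Set.image2 (· * ·) (Set.Icc (β - ρ₂) (β + ρ₂)) (Set.Icc (γ - ρ₃) (γ + ρ₃))) :
    Test.Describes PA PW k τ (ofEntries τ j q a b c) := by
  set σ : ℤ := if 0 < 0 - b.num * c.num then -1 else 1 with hσ
  have hσ1 : σ = 1 ∨ σ = -1 := by rw [hσ]; split_ifs <;> simp
  have hsign : sign τ b c = τ * σ := by
    rw [hσ, sign]; split_ifs <;> ring
  have hsign1 : τ * σ = 1 ∨ τ * σ = -1 := by
    rcases hτ with h | h <;> rcases hσ1 with h' | h' <;> rw [h, h'] <;> norm_num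
  have hsignR : ((τ * σ : ℤ) : ℝ) = 1 ∨ ((τ * σ : ℤ) : ℝ) = -1 :=
    hsign1.imp (fun h => by rw [h]; norm_num) (fun h => by rw [h]; norm_num)
  have hσR : (σ : ℝ) = 1 ∨ (σ : ℝ) = -1 :=
    hσ1.imp (fun h => by rw [h]; norm_num) (fun h => by rw [h]; norm_num)
  have pa : (0 : ℝ) < a.scale q := by exact_mod_cast ha.scale_pos
  have pb : (0 : ℝ) < b.scale q := by exact_mod_cast hb.scale_pos
  have pc : (0 : ℝ) < c.scale q := by exact_mod_cast hc.scale_pos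
  have lo : ∀ {e : Entry} {α ρ : ℝ}, e.Represents α ρ j q →
      (e.lo j q : ℝ) = e.scale q * (|α| - ρ) := fun h => by
    rw [Entry.lo, Int.cast_sub, h.abs_eq, h.radius_eq]; ring
  have hi : ∀ {e : Entry} {α ρ : ℝ}, e.Represents α ρ j q →
      (e.hi j q : ℝ) = e.scale q * (|α| + ρ) := fun h => by
    rw [Entry.hi, Int.cast_add, h.abs_eq, h.radius_eq]; ring
  have hσβγ : (σ : ℝ) * (β * γ) = |β| * |γ| := by
    have e1 := hb.neg_iff
    have e2 := hb.pos_iff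
    have e3 := hc.neg_iff
    have e4 := hc.pos_iff
    rcases lt_trichotomy β 0 with s | s | s <;> rcases lt_trichotomy γ 0 with s' | s' | s'
    · have : ¬ 0 < 0 - b.num * c.num := by nlinarith [e1.2 s, e3.2 s']
      rw [hσ, if_neg this, abs_of_neg s, abs_of_neg s']; push_cast; ring
    · simp [s']
    · have : 0 < 0 - b.num * c.num := by nlinarith [e1.2 s, e4.2 s']
      rw [hσ, if_pos this, abs_of_neg s, abs_of_pos s']; push_cast; ring
    · simp [s]
    · simp [s]
    · simp [s]
    · have : 0 < 0 - b.num * c.num := by nlinarith [e2.2 s, e3.2 s']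
      rw [hσ, if_pos this, abs_of_pos s, abs_of_neg s']; push_cast; ring
    · simp [s']
    · have : ¬ 0 < 0 - b.num * c.num := by nlinarith [e2.2 s, e4.2 s']
      rw [hσ, if_neg this, abs_of_pos s, abs_of_pos s']; push_cast; ring
  have pd : (0 : ℝ) < (a.scale q * (b.scale q * c.scale q) : ℝ) := by positivity
  have hA : (fun x : ℝ => ((ofEntries τ j q a b c).d : ℝ) *
      (((ofEntries τ j q a b c).τ : ℤ) * x)) '' PA k =
      Set.Icc ((ofEntries τ j q a b c).al : ℝ) (ofEntries τ j q a b c).ah := by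
    have hd : ((ofEntries τ j q a b c).d : ℝ) = a.scale q * (b.scale q * c.scale q) := by
      simp only [ofEntries]; push_cast; rfl
    rw [hd, hPA, image_mul_Icc pd (by simpa only [ofEntries, hsign] using hsignR)]
    simp only [ofEntries]
    push_cast
    rw [ha.center_eq, ha.radius_eq]
    congr 1 <;> ring
  have hW : (fun x : ℝ => ((ofEntries τ j q a b c).d : ℝ) * (σ * x)) '' PW k =
      Set.Icc ((ofEntries τ j q a b c).wl : ℝ) (ofEntries τ j q a b c).wh := by
    rw [← Set.image_image (fun x : ℝ => ((ofEntries τ j q a b c).d : ℝ) * x)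
      (fun x : ℝ => (σ : ℝ) * x), hPW, image_image2_mul_Icc hσR hσβγ,
      image2_mul_Icc (by linarith) (by linarith) (by linarith [abs_nonneg β])
        (by linarith [abs_nonneg γ])]
    simp only [ofEntries, minInt_eq]
    push_cast
    rw [Set.image_mul_left_Icc' pd, lo hb, lo hc, hi hb, hi hc,
      mul_min_of_nonneg _ _ pd.le, mul_min_of_nonneg _ _ pd.le, mul_min_of_nonneg _ _ pa.le,
      mul_min_of_nonneg _ _ pa.le]
    congr 1
    · congr 1
      · congr 1 <;> ring
      · ring
    · ring
  have nA : (PA k).Nonempty := hPA ▸ Set.nonempty_Icc.2 (by linarith)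
  have nW : (PW k).Nonempty :=
    hPW ▸ (Set.nonempty_Icc.2 (by linarith)).image2 (Set.nonempty_Icc.2 (by linarith))
  refine ⟨?_, ?_, ?_, ⟨σ, hσ1, hsign, hA, hW⟩, ?_⟩
  · simp only [ofEntries]; exact_mod_cast pd
  · have := nA.image (fun x : ℝ => ((ofEntries τ j q a b c).d : ℝ) *
      (((ofEntries τ j q a b c).τ : ℤ) * x))
    rw [hA, Set.nonempty_Icc] at this
    exact_mod_cast this
  · have : (0 : ℝ) ≤ ((ofEntries τ j q a b c).wh : ℝ) := by
      simp only [ofEntries]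
      push_cast
      rw [hi hb, hi hc]
      positivity
    exact_mod_cast this
  · have := nW.image (fun x : ℝ => ((ofEntries τ j q a b c).d : ℝ) * (σ * x))
    rw [hW, Set.nonempty_Icc] at this
    exact_mod_cast this

end Coef

/-! ### Zeros of multiaffine functions -/

section MultiAffine

variable {ι : Type*} [DecidableEq ι] {f : (ι → ℝ) → ℝ}

/-- A function is affine in each variable. -/
def MultiAffine (f : (ι → ℝ) → ℝ) : Prop := ∀ x i t,
  f (Function.update x i t) = (1 - t) * f (Function.update x i 0) + t * f (Function.update x i 1)

/-- The `0`-`1` vector of a set. -/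
def zeroOne (T : Finset ι) : ι → ℝ := fun i => if i ∈ T then 1 else 0

theorem update_zeroOne_zero {T : Finset ι} {i : ι} (hi : i ∉ T) :
    Function.update (zeroOne T) i 0 = zeroOne T := by
  funext k
  rcases eq_or_ne k i with rfl | hk
  · simp [zeroOne, hi]
  · simp [hk]

theorem update_zeroOne_one {T : Finset ι} {i : ι} :
    Function.update (zeroOne T) i 1 = zeroOne (insert i T) := by
  funext k
  rcases eq_or_ne k i with rfl | hk
  · simp [zeroOne]
  · simp [zeroOne, hk]

/-- Coordinates are freed one at a time: each value is an affine combination of two values at which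
that coordinate is 0 or 1. -/
theorem MultiAffine.eq_of_zeroOne [Fintype ι] (hf : MultiAffine f) {c : ℝ}
    (h : ∀ T : Finset ι, f (zeroOne T) = c) (x : ι → ℝ) : f x = c := by
  have key : ∀ (S : Finset ι) (x : ι → ℝ), (∀ i ∉ S, x i = 0 ∨ x i = 1) → f x = c := by
    intro S
    induction S using Finset.induction with
    | empty =>
      intro x hx
      rw [← h (Finset.univ.filter fun i => x i = 1)]
      congr 1
      funext i
      rcases hx i (Finset.notMem_empty i) with h | h <;> simp [zeroOne, h]
    | insert i S hi ih =>
      intro x hx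
      have e := hf x i (x i)
      rw [Function.update_eq_self] at e
      rw [e, ih, ih]
      · ring
      · intro k hk
        rcases eq_or_ne k i with rfl | hki
        · simp
        · simpa [hki] using hx k (by simp [hki, hk])
      · intro k hk
        rcases eq_or_ne k i with rfl | hki
        · simp
        · simpa [hki] using hx k (by simp [hki, hk])
  exact key Finset.univ x fun i hi => absurd (Finset.mem_univ i) hi

/-- If a multiaffine function has a zero, then it has one whose size is controlled by its values
at `0`-`1` vectors. -/
theorem MultiAffine.exists_small_zero [Fintype ι] (hf : MultiAffine f) {x : ι → ℝ} (hx : f x = 0) {P Q : ℝ}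
    (hP : |f (zeroOne ∅)| ≤ P) (hQ : 0 < Q)
    (hint : ∀ T : Finset ι, ∃ z : ℤ, Q * f (zeroOne T) = z) :
    ∃ y : ι → ℝ, f y = 0 ∧ ∀ i, |y i| ≤ max 1 (P * Q) := by
  set c := f (zeroOne ∅) with hc
  by_cases hc0 : c = 0
  · exact ⟨zeroOne ∅, hc0, fun i => by simp [zeroOne]⟩
  obtain ⟨T, hT⟩ : ∃ T : Finset ι, f (zeroOne T) ≠ c := by
    by_contra! h
    exact hc0 ((hf.eq_of_zeroOne h x).symm.trans hx)
  -- Adding elements one by one, stop where the value first leaves `c`; on the line through these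
  -- two vertices the function is affine and not constant.
  obtain ⟨T, i, hi, h1, h2⟩ : ∃ (T : Finset ι) (i : ι), i ∉ T ∧ f (zeroOne T) = c ∧
      f (zeroOne (insert i T)) ≠ c := by
    induction T using Finset.induction with
    | empty => exact absurd rfl hT
    | insert i T hi ih =>
      by_cases h : f (zeroOne T) = c
      · exact ⟨T, i, hi, h, hT⟩
      · exact ih h
  set e := f (zeroOne (insert i T)) - c with he
  have he0 : e ≠ 0 := sub_ne_zero.2 h2
  refine ⟨Function.update (zeroOne T) i (-c / e), ?_, fun k => ?_⟩
  · rw [hf, update_zeroOne_zero hi, update_zeroOne_one, h1]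
    have : f (zeroOne (insert i T)) = e + c := by rw [he]; ring
    rw [this]
    field_simp
    ring
  · rcases eq_or_ne k i with rfl | hk
    · rw [Function.update_self]
      refine le_max_of_le_right ?_
      obtain ⟨z, hz⟩ := hint (insert k T)
      obtain ⟨z', hz'⟩ := hint T
      have hze : Q * e = (z - z' : ℤ) := by
        rw [he, mul_sub, hz, ← h1, hz']; push_cast; ring
      have hz0 : z - z' ≠ 0 := by
        intro h0
        rw [h0, Int.cast_zero] at hze
        exact mul_ne_zero hQ.ne' he0 hze
      -- The slope `e` times `Q` is a nonzero integer, so `|e| ≥ 1 / Q` and the zero `-c / e` has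
      -- size at most `P * Q`.
      have h3 : (1 : ℝ) ≤ Q * |e| := by
        rw [← abs_of_pos hQ, ← abs_mul, hze, ← Int.cast_abs]
        exact_mod_cast Int.one_le_abs hz0
      rw [abs_div, abs_neg, div_le_iff₀ (abs_pos.2 he0)]
      have hP0 : 0 ≤ P := (abs_nonneg _).trans hP
      nlinarith
    · rw [Function.update_of_ne hk]
      refine le_max_of_le_left ?_
      unfold zeroOne
      split_ifs <;> simp

end MultiAffine

/-! ### A bound for finite regularity radii -/

section Bound

variable {n : ℕ}

/-- The determinant of `A + E ∘ Δ` as a function of the entries of `E`. -/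
noncomputable def perturbedDet (A Δ : Matrix (Fin n) (Fin n) ℝ) (x : Fin n × Fin n → ℝ) : ℝ :=
  (Matrix.of fun i j => A i j + x (i, j) * Δ i j).det

/-- Each coefficient affects a single entry, and the determinant is linear in the row of that entry.
-/
theorem multiAffine_perturbedDet (A Δ : Matrix (Fin n) (Fin n) ℝ) :
    MultiAffine (perturbedDet A Δ) := by
  rintro x ⟨i, j⟩ t
  set M : Matrix (Fin n) (Fin n) ℝ :=
    Matrix.of fun k l => A k l + Function.update x (i, j) 0 (k, l) * Δ k l with hM
  have key : ∀ t, perturbedDet A Δ (Function.update x (i, j) t) =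
      M.det + t * (Δ i j * (M.updateRow i (Pi.single j 1)).det) := by
    intro t
    have : (Matrix.of fun k l => A k l + Function.update x (i, j) t (k, l) * Δ k l) =
        M.updateRow i (M i + (t * Δ i j) • (Pi.single j 1 : Fin n → ℝ)) := by
      ext k l
      rcases eq_or_ne k i with rfl | hk
      · rcases eq_or_ne l j with rfl | hl
        · simp [hM]
        · simp [hM, hl]
      · simp [hM, hk]
    rw [perturbedDet, this, Matrix.det_updateRow_add, Matrix.det_updateRow_smul,
      Matrix.updateRow_eq_self]
    ring
  rw [key, key, key]
  ring

theorem intervalSingular_smul_iff {A Δ : Matrix (Fin n) (Fin n) ℝ} (hΔ : ∀ i j, 0 ≤ Δ i j) {δ : ℝ}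
    (hδ : 0 ≤ δ) : IntervalSingular A (δ • Δ) ↔
      ∃ x : Fin n × Fin n → ℝ, (∀ i, |x i| ≤ δ) ∧ perturbedDet A Δ x = 0 := by
  constructor
  · rintro ⟨M, hM, hdet⟩
    -- Where `Δ` vanishes the division yields the coefficient 0, which is right because that entry
    -- is fixed.
    refine ⟨fun p => (M p.1 p.2 - A p.1 p.2) / Δ p.1 p.2, fun ⟨i, j⟩ => ?_, ?_⟩
    · obtain ⟨h1, h2⟩ := hM i j
      simp only [Matrix.smul_apply, smul_eq_mul] at h1 h2
      rcases (hΔ i j).eq_or_lt with h | h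
      · simp [← h, hδ]
      · rw [abs_le]
        constructor
        · rw [le_div_iff₀ h]; linarith
        · rw [div_le_iff₀ h]; linarith
    · rw [← hdet, perturbedDet]
      congr 1
      ext i j
      obtain ⟨h1, h2⟩ := hM i j
      simp only [Matrix.smul_apply, smul_eq_mul] at h1 h2
      rcases (hΔ i j).eq_or_lt with h | h
      · rw [← h] at h1 h2
        simp only [Matrix.of_apply, ← h]
        linarith
      · simp only [Matrix.of_apply]
        field_simp
        ring
  · rintro ⟨x, hx, h⟩
    refine ⟨_, fun i j => ?_, h⟩
    have := abs_le.1 (hx (i, j))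
    simp only [Matrix.of_apply, Matrix.smul_apply, smul_eq_mul]
    constructor <;> nlinarith [hΔ i j]

theorem IntervalSingular.mono {A Δ : Matrix (Fin n) (Fin n) ℝ} (hΔ : ∀ i j, 0 ≤ Δ i j) {δ δ' : ℝ}
    (h : δ ≤ δ') (hs : IntervalSingular A (δ • Δ)) : IntervalSingular A (δ' • Δ) := by
  obtain ⟨M, hM, hdet⟩ := hs
  refine ⟨M, fun i j => ?_, hdet⟩
  have h1 := hM i j
  have h2 := mul_le_mul_of_nonneg_right h (hΔ i j)
  simp only [Matrix.smul_apply, smul_eq_mul] at h1 ⊢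
  constructor <;> linarith

theorem sum_le_prod_one_add {ι : Type*} (s : Finset ι) (f : ι → ℝ) (hf : ∀ i, 0 ≤ f i) :
    1 + ∑ i ∈ s, f i ≤ ∏ i ∈ s, (f i + 1) := by
  classical
  induction s using Finset.induction with
  | empty => simp
  | insert i s hi ih =>
    rw [Finset.sum_insert hi, Finset.prod_insert hi]
    have := Finset.sum_nonneg (s := s) fun i _ => hf i
    nlinarith [hf i]

/-- The permutation terms are among the nonnegative terms of the expanded product of column sums.
Passing from sums to products gives the multiplicative form of `inputBound`. -/
theorem abs_det_le (M : Matrix (Fin n) (Fin n) ℝ) : |M.det| ≤ ∏ i, ∏ j, (|M i j| + 1) := by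
  rw [Finset.prod_comm, Matrix.det_apply]
  calc |∑ σ : Equiv.Perm (Fin n), Equiv.Perm.sign σ • ∏ i, M (σ i) i|
      ≤ ∑ σ : Equiv.Perm (Fin n), |Equiv.Perm.sign σ • ∏ i, M (σ i) i| :=
        Finset.abs_sum_le_sum_abs _ _
    _ = ∑ σ : Equiv.Perm (Fin n), ∏ i, |M (σ i) i| := by
        refine Finset.sum_congr rfl fun σ _ => ?_
        rw [← Finset.abs_prod]
        rcases Int.units_eq_one_or (Equiv.Perm.sign σ) with h | h <;> simp [h]
    _ = ∑ g ∈ Finset.univ.map (⟨fun σ : Equiv.Perm (Fin n) => (σ : Fin n → Fin n),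
          DFunLike.coe_injective⟩ : Equiv.Perm (Fin n) ↪ (Fin n → Fin n)), ∏ i, |M (g i) i| := by
        rw [Finset.sum_map]; rfl
    _ ≤ ∑ g : Fin n → Fin n, ∏ i, |M (g i) i| :=
        Finset.sum_le_sum_of_subset_of_nonneg (Finset.subset_univ _)
          fun _ _ _ => Finset.prod_nonneg fun _ _ => abs_nonneg _
    _ = ∏ i, ∑ j, |M j i| := by
        rw [Finset.prod_univ_sum, Fintype.piFinset_univ]
    _ ≤ ∏ i, ∏ j, (|M j i| + 1) := by
        refine Finset.prod_le_prod (fun _ _ => Finset.sum_nonneg fun _ _ => abs_nonneg _)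
          fun i _ => ?_
        have := sum_le_prod_one_add Finset.univ (fun j => |M j i|) fun _ => abs_nonneg _
        linarith

theorem den_mul_eq_num (r : ℚ) : (r.den : ℝ) * r = r.num := by
  have : (r.den : ℚ) * r = r.num := by rw [mul_comm]; exact Rat.mul_den_eq_num r
  exact_mod_cast this

theorem abs_le_natAbs_num (r : ℚ) : |(r : ℝ)| ≤ (r.num.natAbs : ℕ) := by
  rw [Nat.cast_natAbs, Int.cast_abs, ← den_mul_eq_num, abs_mul, Nat.abs_cast]
  have h1 : (1 : ℝ) ≤ r.den := by exact_mod_cast r.den_pos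
  nlinarith [abs_nonneg (r : ℝ)]

/-- Scaling each row by the product of its denominators makes the matrix integral. -/
theorem exists_int_perturbedDet (A Δ : Matrix (Fin n) (Fin n) ℚ) (T : Finset (Fin n × Fin n)) :
    ∃ z : ℤ, ((∏ i, ∏ j, (A i j).den * (Δ i j).den : ℕ) : ℝ) *
      perturbedDet (A.map (fun q : ℚ => (q : ℝ))) (Δ.map (fun q : ℚ => (q : ℝ))) (zeroOne T) =
      z := by
  have key : ∀ i j, ∃ z : ℤ, ((∏ j, (A i j).den * (Δ i j).den : ℕ) : ℝ) *
      ((A i j : ℝ) + zeroOne T (i, j) * Δ i j) = z := by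
    intro i j
    obtain ⟨c, hc⟩ := Finset.dvd_prod_of_mem (fun j => (A i j).den * (Δ i j).den)
      (Finset.mem_univ j)
    refine ⟨c * ((A i j).num * (Δ i j).den +
      (if (i, j) ∈ T then 1 else 0) * ((A i j).den * (Δ i j).num)), ?_⟩
    rw [hc]
    have h1 := den_mul_eq_num (A i j)
    have h2 := den_mul_eq_num (Δ i j)
    unfold zeroOne
    push_cast
    rw [← h1, ← h2]
    split_ifs <;> ring
  choose Z hZ using key
  refine ⟨(Matrix.of Z).det, ?_⟩
  have h : ((Matrix.of Z).map (fun z : ℤ => (z : ℝ))).det = ((Matrix.of Z).det : ℝ) :=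
    ((Int.castRingHom ℝ).map_det (Matrix.of Z)).symm
  rw [← h, perturbedDet, Nat.cast_prod, ← Matrix.det_mul_column]
  congr 1
  ext i j
  simp only [Matrix.of_apply, Matrix.map_apply]
  exact hZ i j

theorem intervalSingular_of_le {A Δ : Matrix (Fin n) (Fin n) ℚ} (hΔ : ∀ i j, 0 ≤ Δ i j)
    {δ : ℝ} (hδ : 0 ≤ δ) (h : IntervalSingular (A.map (fun q : ℚ => (q : ℝ)))
      (δ • Δ.map (fun q : ℚ => (q : ℝ)))) {K : ℝ} (hK1 : 1 ≤ K)
    (hK : (∏ i, ∏ j, (((A i j).num.natAbs + 1 : ℕ) : ℝ)) *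
      (∏ i, ∏ j, (A i j).den * (Δ i j).den : ℕ) ≤ K) :
    IntervalSingular (A.map (fun q : ℚ => (q : ℝ))) (K • Δ.map (fun q : ℚ => (q : ℝ))) := by
  have hΔ' : ∀ i j, 0 ≤ Δ.map (fun q : ℚ => (q : ℝ)) i j := fun i j => by
    simpa using hΔ i j
  obtain ⟨x, -, hx⟩ := (intervalSingular_smul_iff hΔ' hδ).1 h
  have hP : |perturbedDet (A.map (fun q : ℚ => (q : ℝ))) (Δ.map (fun q : ℚ => (q : ℝ)))
      (zeroOne ∅)| ≤ ∏ i, ∏ j, (((A i j).num.natAbs + 1 : ℕ) : ℝ) := by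
    refine (abs_det_le _).trans ?_
    refine Finset.prod_le_prod (fun _ _ => Finset.prod_nonneg fun _ _ => by positivity)
      fun i _ => Finset.prod_le_prod (fun _ _ => by positivity) fun j _ => ?_
    simp only [zeroOne, Finset.notMem_empty, if_false, zero_mul, add_zero, Matrix.of_apply,
      Matrix.map_apply]
    have := abs_le_natAbs_num (A i j)
    push_cast at this ⊢
    linarith
  have hQ : (0 : ℝ) < (∏ i, ∏ j, (A i j).den * (Δ i j).den : ℕ) :=
    Nat.cast_pos.2 (Finset.prod_pos fun i _ => Finset.prod_pos fun j _ =>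
      Nat.mul_pos (A i j).den_pos (Δ i j).den_pos)
  obtain ⟨y, hy, hy'⟩ := (multiAffine_perturbedDet _ _).exists_small_zero hx hP hQ
    (exists_int_perturbedDet A Δ)
  exact (intervalSingular_smul_iff hΔ' (by linarith)).2
    ⟨y, fun i => (hy' i).trans (max_le hK1 hK), hy⟩

end Bound

/-- An upper bound for the finite regularity radii: the product of the absolute values of the
input, each increased by one. -/
def inputBound (l : List ℤ) : ℕ := (l.map fun z => z.natAbs + 1).prod

theorem inputBound_cons (z : ℤ) (l : List ℤ) :
    inputBound (z :: l) = (z.natAbs + 1) * inputBound l := by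
  simp [inputBound]

theorem one_le_inputBound (l : List ℤ) : 1 ≤ inputBound l := by
  refine Nat.one_le_iff_ne_zero.2 (List.prod_ne_zero ?_)
  simp

theorem inputBound_append (l l' : List ℤ) :
    inputBound (l ++ l') = inputBound l * inputBound l' := by
  simp [inputBound]

theorem inputBound_flatMap {α : Type*} (l : List α) (f : α → List ℤ) :
    inputBound (l.flatMap f) = (l.map fun a => inputBound (f a)).prod := by
  induction l with
  | nil => simp [inputBound]
  | cons a l ih => rw [List.flatMap_cons, inputBound_append, ih, List.map_cons, List.prod_cons]

theorem inputBound_encodeMatrix {n : ℕ} (M : Matrix (Fin n) (Fin n) ℚ) :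
    inputBound (encodeMatrix M) = ∏ i, ∏ j, ((M i j).num.natAbs + 1) * ((M i j).den + 1) := by
  simp only [encodeMatrix, inputBound_flatMap, Fin.prod_univ_def]
  simp [inputBound]

/-! ### The radius of an instance and bisection -/

namespace TridiagonalInstance

variable (x : TridiagonalInstance)

theorem le_inputBound : (∏ i, ∏ j, (((x.A i j).num.natAbs + 1 : ℕ) : ℝ)) *
    (∏ i, ∏ j, (x.A i j).den * (x.Δ i j).den : ℕ) ≤ inputBound x.encode := by
  have h : (∏ i, ∏ j, ((x.A i j).num.natAbs + 1)) * ∏ i, ∏ j, (x.A i j).den * (x.Δ i j).den ≤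
      inputBound x.encode := by
    rw [encode, inputBound_append, inputBound_append, inputBound_encodeMatrix,
      inputBound_encodeMatrix, mul_assoc]
    refine le_trans ?_ (Nat.le_mul_of_pos_left _ (one_le_inputBound _))
    simp only [← Finset.prod_mul_distrib]
    refine Finset.prod_le_prod' fun i _ => Finset.prod_le_prod' fun j _ => ?_
    rw [← mul_assoc]
    refine Nat.mul_le_mul (Nat.mul_le_mul le_rfl (Nat.le_succ _)) ?_
    nlinarith [Nat.zero_le ((x.Δ i j).num.natAbs * ((x.Δ i j).den + 1))]
  exact_mod_cast h

/-- The interval matrix of the instance at the parameter `δ` is singular. -/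
def SingularAt (δ : ℝ) : Prop := IntervalSingular (x.A.map (fun q : ℚ => (q : ℝ)))
  (δ • x.Δ.map (fun q : ℚ => (q : ℝ)))

variable {x}

theorem SingularAt.mono {δ δ' : ℝ} (h : x.SingularAt δ) (hδ : δ ≤ δ') : x.SingularAt δ' :=
  IntervalSingular.mono (fun i j => by simpa using x.nonneg i j) hδ h

theorem radius_le {δ : ℝ} (hδ : 0 ≤ δ) (h : x.SingularAt δ) : x.radius ≤ ENNReal.ofReal δ :=
  sInf_le ⟨δ.toNNReal, rfl, by rw [Real.coe_toNNReal δ hδ]; exact h⟩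

theorem le_radius {δ : ℝ} (h : ¬ x.SingularAt δ) : ENNReal.ofReal δ ≤ x.radius := by
  refine le_sInf ?_
  rintro _ ⟨r, rfl, hr⟩
  rw [ENNReal.ofReal, ENNReal.coe_le_coe]
  refine Real.toNNReal_le_iff_le_coe.2 (le_of_not_gt fun hlt => h ?_)
  exact SingularAt.mono (x := x) hr hlt.le

theorem singularAt_inputBound (h : x.radius ≠ ⊤) : x.SingularAt (inputBound x.encode) := by
  obtain ⟨_, ⟨r, rfl, hr⟩⟩ : {r : ℝ≥0∞ | ∃ δ : ℝ≥0, r = (δ : ℝ≥0∞) ∧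
      IntervalSingular (x.A.map (fun q : ℚ => (q : ℝ)))
        ((δ : ℝ) • x.Δ.map (fun q : ℚ => (q : ℝ)))}.Nonempty := by
    by_contra hne
    rw [Set.not_nonempty_iff_eq_empty] at hne
    refine h ?_
    rw [radius, regularityRadius, hne, sInf_empty]
  exact intervalSingular_of_le x.nonneg r.2 hr (by exact_mod_cast one_le_inputBound _)
    x.le_inputBound

/-- The answer found by bisection on the grid of multiples of `1 / q`. -/
theorem approximates_of_bisection {j : ℤ} (hj : 0 ≤ j)
    (hlo : j = 0 ∨ ¬ x.SingularAt ((j - 1 : ℤ) / (x.ε.den : ℤ)))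
    (hj' : j ≤ inputBound x.encode * x.ε.den + 1)
    (hhi : j = inputBound x.encode * x.ε.den + 1 ∨ x.SingularAt (j / (x.ε.den : ℤ))) :
    Approximates x.radius x.ε j
      (if 0 < (inputBound x.encode * x.ε.den + 1 : ℤ) - j then (x.ε.den : ℤ) else 0) := by
  have hq : (0 : ℝ) < ((x.ε.den : ℤ) : ℝ) := by exact_mod_cast x.ε.den_pos
  have hj0 : (0 : ℝ) ≤ j := by exact_mod_cast hj
  constructor
  · intro htop
    rw [if_neg]
    rcases hhi with h | h
    · omega
    · have := radius_le (div_nonneg hj0 hq.le) h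
      rw [htop, top_le_iff] at this
      exact absurd this ENNReal.ofReal_ne_top
  · intro hfin
    have hs := singularAt_inputBound hfin
    -- This value of `j` is a sentinel one past the grid: its predecessor is the parameter
    -- `inputBound`, which is singular when the radius is finite.
    have hne : j ≠ inputBound x.encode * x.ε.den + 1 := by
      rintro rfl
      rcases hlo with h | h
      · have : (0 : ℤ) ≤ inputBound x.encode * x.ε.den := by positivity
        omega
      · refine h ?_
        convert hs using 1
        push_cast at hq ⊢
        field_simp
        ring
    have hsing := hhi.resolve_left hne
    rw [if_pos (by omega)]
    refine ⟨by exact_mod_cast x.ε.den_pos, ?_⟩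
    have h1 := radius_le (div_nonneg hj0 hq.le) hsing
    have h2 : x.radius.toReal ≤ j / (x.ε.den : ℤ) :=
      ENNReal.toReal_le_of_le_ofReal (div_nonneg hj0 hq.le) h1
    have h3 : (j / (x.ε.den : ℤ) : ℝ) - 1 / (x.ε.den : ℤ) ≤ x.radius.toReal := by
      rcases hlo with rfl | h
      · have : (0 : ℝ) ≤ 1 / ((x.ε.den : ℤ) : ℝ) := by positivity
        have := ENNReal.toReal_nonneg (a := x.radius)
        simp only [Int.cast_zero, zero_div]
        linarith
      · have := (ENNReal.ofReal_le_iff_le_toReal hfin).1 (le_radius h)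
        refine le_trans (le_of_eq ?_) this
        push_cast
        ring
    -- The grid is fine enough because the numerator of `ε` is at least 1.
    have h4 : (1 / ((x.ε.den : ℤ) : ℝ)) ≤ (x.ε : ℝ) := by
      have h5 : (x.ε.den : ℝ) * x.ε = x.ε.num := den_mul_eq_num _
      have h6 : (1 : ℝ) ≤ x.ε.num := by exact_mod_cast Rat.num_pos.2 x.ε_pos
      rw [div_le_iff₀ hq]
      push_cast
      linarith
    rw [abs_le]
    constructor <;> linarith

end TridiagonalInstance

/-! ### Reading the input -/

theorem getElem?_flatMap_of_length {α β : Type*} (f : α → List β) (c : ℕ)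
    (hf : ∀ a, (f a).length = c) (l : List α) (i : ℕ) (hi : i < l.length) (r : ℕ) (hr : r < c) :
    (l.flatMap f)[c * i + r]? = (f l[i])[r]? := by
  induction l generalizing i with
  | nil => simp at hi
  | cons a l ih =>
    rw [List.flatMap_cons]
    cases i with
    | zero =>
      rw [List.getElem?_append_left (by rw [hf]; omega)]
      simp
    | succ i =>
      rw [List.getElem?_append_right (by rw [hf, mul_add]; omega), hf,
        show c * (i + 1) + r - c = c * i + r by rw [mul_add]; omega,
        ih i (by simpa using hi)]
      rfl

theorem length_flatMap_of_length {α β : Type*} (f : α → List β) (c : ℕ)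
    (hf : ∀ a, (f a).length = c) (l : List α) : (l.flatMap f).length = c * l.length := by
  induction l with
  | nil => simp
  | cons a l ih => rw [List.flatMap_cons, List.length_append, hf, ih, List.length_cons]; ring

theorem length_encodeMatrix {n : ℕ} (M : Matrix (Fin n) (Fin n) ℚ) :
    (encodeMatrix M).length = 2 * n * n := by
  rw [encodeMatrix, length_flatMap_of_length _ (2 * n), List.length_finRange]
  intro i
  rw [length_flatMap_of_length _ 2 (fun _ => rfl), List.length_finRange]

theorem getElem?_encodeMatrix {n : ℕ} (M : Matrix (Fin n) (Fin n) ℚ) (i j : Fin n) (r : ℕ)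
    (hr : r < 2) : (encodeMatrix M)[2 * (n * i + j) + r]? =
      ([(M i j).num, ((M i j).den : ℤ)] : List ℤ)[r]? := by
  have hl : ∀ i : Fin n, ((List.finRange n).flatMap fun j =>
      [(M i j).num, ((M i j).den : ℤ)]).length = 2 * n := fun i => by
    rw [length_flatMap_of_length _ 2 (fun _ => rfl), List.length_finRange]
  rw [encodeMatrix, show 2 * (n * (i : ℕ) + j) + r = 2 * n * i + (2 * j + r) by ring,
    getElem?_flatMap_of_length _ (2 * n) hl _ i (by simp) _ (by omega),
    getElem?_flatMap_of_length _ 2 (fun _ => rfl) _ j (by simp) _ hr]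
  simp

namespace TridiagonalInstance

variable (x : TridiagonalInstance)

/-- The initial memory. -/
def memory : ℤ → ℤ := (RAM.initial x.encode).mem

theorem length_encode : x.encode.length = 3 + 4 * (x.n * x.n) := by
  simp only [encode, List.length_append, length_encodeMatrix, List.length_cons, List.length_nil]
  ring

theorem memory_natCast (a : ℕ) : x.memory a = x.encode.getD a 0 := by
  simp [memory, RAM.initial]

theorem memory_zero : x.memory 0 = x.n := rfl

theorem memory_two : x.memory 2 = x.ε.den := rfl

theorem memory_A (i j : Fin x.n) (r : ℕ) (hr : r < 2) {a : ℤ}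
    (ha : a = 3 + 2 * (x.n * i + j) + r) :
    some (x.memory a) = ([(x.A i j).num, ((x.A i j).den : ℤ)] : List ℤ)[r]? := by
  have h := getElem?_encodeMatrix x.A i j r hr
  obtain rfl : a = ((3 + (2 * (x.n * i + j) + r) : ℕ) : ℤ) := by rw [ha]; push_cast; ring
  have hlt : 2 * (x.n * i + j) + r < (encodeMatrix x.A).length := by
    have h1 : x.n * (i : ℕ) + x.n ≤ x.n * x.n := by
      rw [← Nat.mul_succ]; exact Nat.mul_le_mul_left _ i.2
    rw [length_encodeMatrix, mul_assoc]
    omega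
  rw [memory_natCast, ← h, encode, List.append_assoc, List.getD_append_right _ _ _ _ (by simp),
    List.getD_append _ _ _ _ (by simpa using hlt), List.getD_eq_getElem?_getD]
  simp [hlt]

theorem memory_Δ (i j : Fin x.n) (r : ℕ) (hr : r < 2) {a : ℤ}
    (ha : a = 3 + 2 * (x.n * x.n) + 2 * (x.n * i + j) + r) :
    some (x.memory a) = ([(x.Δ i j).num, ((x.Δ i j).den : ℤ)] : List ℤ)[r]? := by
  have h := getElem?_encodeMatrix x.Δ i j r hr
  obtain rfl : a = ((3 + 2 * x.n * x.n + (2 * (x.n * i + j) + r) : ℕ) : ℤ) := by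
    rw [ha]; push_cast; ring
  have hlt : 2 * (x.n * i + j) + r < (encodeMatrix x.Δ).length := by
    have h1 : x.n * (i : ℕ) + x.n ≤ x.n * x.n := by
      rw [← Nat.mul_succ]; exact Nat.mul_le_mul_left _ i.2
    rw [length_encodeMatrix, mul_assoc]
    omega
  rw [memory_natCast, ← h, encode, List.getD_append_right _ _ _ _
    (by simp [length_encodeMatrix]; omega), List.getD_eq_getElem?_getD]
  have e : 3 + 2 * x.n * x.n + (2 * (x.n * i + j) + r) -
      ([(x.n : ℤ), x.ε.num, (x.ε.den : ℤ)] ++ encodeMatrix x.A).length =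
      2 * (x.n * i + j) + r := by
    simp [length_encodeMatrix]
    omega
  rw [e]
  simp [hlt]

end TridiagonalInstance

/-! ### The test on the stored entries -/

/-- The entry in row `i` and column `j` as stored in the memory. -/
def entryAt (m : ℤ → ℤ) (i j : ℤ) : Entry where
  num := m (3 + 2 * (m 0 * i + j))
  den := m (3 + 2 * (m 0 * i + j) + 1)
  num' := m (3 + 2 * (m 0 * m 0) + 2 * (m 0 * i + j))
  den' := m (3 + 2 * (m 0 * m 0) + 2 * (m 0 * i + j) + 1)

def predInt (k : ℤ) : ℤ := if 0 < k then k - 1 else 0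

/-- The coefficients of the step for the row `k` at the parameter `j / q`. -/
def coefAt (m : ℤ → ℤ) (τ j k : ℤ) : Coef :=
  Coef.ofEntries τ j (m 2) (entryAt m k k) (entryAt m (predInt k) k) (entryAt m k (predInt k))

namespace TridiagonalInstance

variable (x : TridiagonalInstance)

theorem entryAt_memory (i j : Fin x.n) : entryAt x.memory (i : ℕ) (j : ℕ) =
    ⟨(x.A i j).num, (x.A i j).den, (x.Δ i j).num, (x.Δ i j).den⟩ := by
  have h1 := x.memory_A i j 0 (by norm_num) (a := 3 + 2 * (x.n * i + j)) (by simp)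
  have h2 := x.memory_A i j 1 (by norm_num) (a := 3 + 2 * (x.n * i + j) + 1) (by simp)
  have h3 := x.memory_Δ i j 0 (by norm_num) (a := 3 + 2 * (x.n * x.n) + 2 * (x.n * i + j))
    (by simp)
  have h4 := x.memory_Δ i j 1 (by norm_num) (a := 3 + 2 * (x.n * x.n) + 2 * (x.n * i + j) + 1)
    (by simp)
  simp only [List.getElem?_cons_zero, List.getElem?_cons_succ, Option.some.injEq] at h1 h2 h3 h4
  simp only [entryAt, memory_zero, h1, h2, h3, h4]

/-- The real matrix `A` of the instance. -/
noncomputable def realA : Matrix (Fin x.n) (Fin x.n) ℝ := x.A.map (fun q : ℚ => (q : ℝ))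

/-- The radius matrix at the parameter `δ`. -/
noncomputable def radiusMatrix (δ : ℝ) : Matrix (Fin x.n) (Fin x.n) ℝ :=
  δ • x.Δ.map (fun q : ℚ => (q : ℝ))

theorem entryRange_eq (δ : ℝ) (i j : Fin x.n) : entryRange x.realA (x.radiusMatrix δ) i j =
    Set.Icc ((x.A i j : ℝ) - δ * x.Δ i j) (x.A i j + δ * x.Δ i j) := by
  simp [entryRange, extendZero, realA, radiusMatrix]

theorem describes_coefAt {τ j : ℤ} (hτ : τ = 1 ∨ τ = -1) (hj : 0 ≤ j) {k : ℕ} (hk : k < x.n) :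
    Test.Describes (diagRange x.realA (x.radiusMatrix (j / (x.ε.den : ℤ))))
      (prodRange x.realA (x.radiusMatrix (j / (x.ε.den : ℤ)))) k τ (coefAt x.memory τ j k) := by
  have hq : (0 : ℤ) < x.ε.den := by exact_mod_cast x.ε.den_pos
  have hk' : k - 1 < x.n := by omega
  -- `predInt` mirrors truncated subtraction, so row 0 needs no separate formulas and its addresses
  -- are valid.
  have e : predInt (k : ℤ) = ((k - 1 : ℕ) : ℤ) := by
    unfold predInt; split_ifs <;> omega
  have h1 := x.entryAt_memory ⟨k, hk⟩ ⟨k, hk⟩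
  have h2 := x.entryAt_memory ⟨k - 1, hk'⟩ ⟨k, hk⟩
  have h3 := x.entryAt_memory ⟨k, hk⟩ ⟨k - 1, hk'⟩
  have r1 := x.entryRange_eq (j / (x.ε.den : ℤ)) ⟨k, hk⟩ ⟨k, hk⟩
  have r2 := x.entryRange_eq (j / (x.ε.den : ℤ)) ⟨k - 1, hk'⟩ ⟨k, hk⟩
  have r3 := x.entryRange_eq (j / (x.ε.den : ℤ)) ⟨k, hk⟩ ⟨k - 1, hk'⟩
  have nn : ∀ a b, 0 ≤ ((j / (x.ε.den : ℤ) : ℝ)) * x.Δ a b := by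
    intro a b
    have hΔ : (0 : ℝ) ≤ x.Δ a b := by exact_mod_cast x.nonneg a b
    have hj' : (0 : ℝ) ≤ j := by exact_mod_cast hj
    positivity
  rw [coefAt, e, h1, h2, h3, memory_two]
  exact Coef.describes (Entry.represents _ _ hq) (Entry.represents _ _ hq)
    (Entry.represents _ _ hq) (nn _ _) (nn _ _) (nn _ _) hτ r1
    (by rw [prodRange]; exact congrArg₂ _ r2 r3)

/-- The state of the test after `k` rows. -/
def testAt (j : ℤ) : ℕ → Test
  | 0 => Test.init
  | k + 1 => (testAt j k).step (coefAt x.memory (testAt j k).τ j k)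

theorem inv_testAt {j : ℤ} (hj : 0 ≤ j) {k : ℕ} (hk : k ≤ x.n) :
    Test.Inv (diagRange x.realA (x.radiusMatrix (j / (x.ε.den : ℤ))))
      (prodRange x.realA (x.radiusMatrix (j / (x.ε.den : ℤ)))) k (x.testAt j k) := by
  induction k with
  | zero => exact Test.inv_init _ _
  | succ k ih =>
    have := ih (by omega)
    exact this.step (x.describes_coefAt this.sign hj (by omega))

theorem result_testAt_pos_iff {j : ℤ} (hj : 0 ≤ j) :
    0 < (x.testAt j x.n).result ↔ x.SingularAt (j / (x.ε.den : ℤ)) := by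
  rw [(x.inv_testAt hj le_rfl).result_pos_iff]
  have hj' : (0 : ℝ) ≤ j := by exact_mod_cast hj
  refine (intervalSingular_iff_reach (fun a b => ?_) fun a b h => ?_).symm
  · have hΔ : (0 : ℝ) ≤ x.Δ a b := by exact_mod_cast x.nonneg a b
    simp only [radiusMatrix, Matrix.smul_apply, Matrix.map_apply, smul_eq_mul]
    positivity
  · have h0 := x.tridiagonal a b h
    simp [realA, radiusMatrix, h0, x.zeroPattern a b h0]

end TridiagonalInstance

/-! ### Growth of the numbers in the test -/

namespace RAM

theorem bits_add_le_of_le {y z : ℤ} {b c : ℕ} (hy : bits y ≤ b) (hz : bits z ≤ c) :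
    bits (y + z) ≤ b + c := (bits_add_le y z).trans (Nat.add_le_add hy hz)

theorem bits_sub_le_of_le {y z : ℤ} {b c : ℕ} (hy : bits y ≤ b) (hz : bits z ≤ c) :
    bits (y - z) ≤ b + c := (Op.bits_eval_le .sub y z).trans (Nat.add_le_add hy hz)

theorem bits_mul_le_of_le {y z : ℤ} {b c : ℕ} (hy : bits y ≤ b) (hz : bits z ≤ c) :
    bits (y * z) ≤ b + c := (bits_mul_le y z).trans (Nat.add_le_add hy hz)

theorem bits_natCast_le (k : ℕ) : bits k ≤ k + 1 := by
  rw [bits_le_iff, Int.natAbs_natCast]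
  exact Nat.lt_two_pow_self

theorem bits_absInt (z : ℤ) : bits (absInt z) = bits z := by
  unfold absInt
  split_ifs
  · rfl
  · rw [zero_sub, bits_neg]

theorem bits_minInt_le {y z : ℤ} {b : ℕ} (hy : bits y ≤ b) (hz : bits z ≤ b) :
    bits (minInt y z) ≤ b := by
  unfold minInt
  split_ifs <;> assumption

theorem bits_le_of_natAbs_le_two_pow {z : ℤ} {b : ℕ} (h : z.natAbs ≤ 2 ^ b) : bits z ≤ b + 2 := by
  rw [show b + 2 = (b + 1) + 1 by ring, bits_le_iff]
  exact h.trans_lt (Nat.pow_lt_pow_right (by norm_num) (by omega))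

/-- Each factor is at most 2 to the power of its bit length. The upper end of the bisection
therefore has linearly many bits. -/
theorem inputBound_le (l : List ℤ) : inputBound l ≤ 2 ^ inputSize l := by
  induction l with
  | nil => simp [inputBound, inputSize]
  | cons z l ih =>
    simp only [inputBound, inputSize, List.map_cons, List.prod_cons, List.sum_cons] at ih ⊢
    rw [pow_add]
    refine Nat.mul_le_mul ?_ ih
    have := natAbs_lt_two_pow_bits z
    have h2 : 2 ^ (bits z - 1) ≤ 2 ^ bits z := Nat.pow_le_pow_right (by norm_num) (by omega)
    omega

theorem length_le_inputSize (l : List ℤ) : l.length ≤ inputSize l := by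
  induction l with
  | nil => simp
  | cons z l ih =>
    have := one_le_bits z
    simp only [inputSize, List.map_cons, List.sum_cons, List.length_cons] at ih ⊢
    omega

theorem bits_le_inputSize {l : List ℤ} {z : ℤ} (h : z ∈ l) : bits z ≤ inputSize l :=
  List.le_sum_of_mem (List.mem_map_of_mem h)

theorem bits_initial_mem_le (l : List ℤ) (a : ℤ) : bits ((initial l).mem a) ≤ inputSize l + 1 := by
  have h0 : bits 0 = 1 := rfl
  simp only [initial]
  split_ifs
  · rcases lt_or_ge a.toNat l.length with h | h
    · rw [List.getD_eq_getElem _ _ h]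
      exact (bits_le_inputSize (List.getElem_mem h)).trans (Nat.le_succ _)
    · rw [List.getD_eq_default _ _ h]; omega
  · omega

end RAM

open RAM

theorem Entry.bits_le {e : Entry} {j q : ℤ} {b c : ℕ} (h1 : bits e.num ≤ b) (h2 : bits e.den ≤ b)
    (h3 : bits e.num' ≤ b) (h4 : bits e.den' ≤ b) (hq : bits q ≤ b) (hj : bits j ≤ c) :
    bits (e.scale q) ≤ 3 * b ∧ bits (e.center q) ≤ 3 * b ∧ bits (e.radius j) ≤ 2 * b + c ∧
      bits (e.lo j q) ≤ 5 * b + c ∧ bits (e.hi j q) ≤ 5 * b + c := by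
  have hr : bits (e.radius j) ≤ c + (b + b) := bits_mul_le_of_le hj (bits_mul_le_of_le h3 h2)
  have ha : bits (absInt e.num * e.den' * q) ≤ b + b + b :=
    bits_mul_le_of_le (bits_mul_le_of_le (by rwa [bits_absInt]) h4) hq
  refine ⟨(bits_mul_le_of_le (bits_mul_le_of_le h2 h4) hq).trans (by omega),
    (bits_mul_le_of_le (bits_mul_le_of_le h1 h4) hq).trans (by omega), by omega,
    (bits_sub_le_of_le ha hr).trans (by omega), (bits_add_le_of_le ha hr).trans (by omega)⟩

/-- The longest coefficients are `wl` and `wh`: `3 * s` for the scale and `8 * s` for either factor.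
-/
theorem Coef.bits_ofEntries_le {τ j q : ℤ} {a b c : Entry} {s : ℕ} (hτ : τ = 1 ∨ τ = -1)
    (hq : bits q ≤ s) (hj : bits j ≤ 3 * s)
    (h : ∀ e ∈ [a, b, c], bits e.num ≤ s ∧ bits e.den ≤ s ∧ bits e.num' ≤ s ∧ bits e.den' ≤ s) :
    bits (ofEntries τ j q a b c).d ≤ 20 * s ∧ bits (ofEntries τ j q a b c).al ≤ 20 * s ∧
    bits (ofEntries τ j q a b c).ah ≤ 20 * s ∧ bits (ofEntries τ j q a b c).wl ≤ 20 * s ∧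
    bits (ofEntries τ j q a b c).wh ≤ 20 * s := by
  have key : ∀ e ∈ [a, b, c], _ := fun e he =>
    Entry.bits_le (h e he).1 (h e he).2.1 (h e he).2.2.1 (h e he).2.2.2 hq hj
  obtain ⟨a1, a2, a3, a4, a5⟩ := key a (by simp)
  obtain ⟨b1, b2, b3, b4, b5⟩ := key b (by simp)
  obtain ⟨c1, c2, c3, c4, c5⟩ := key c (by simp)
  have hs : 1 ≤ s := (one_le_bits q).trans hq
  have hsign : bits (sign τ b c) ≤ 2 := by
    unfold sign
    rcases hτ with rfl | rfl <;> split_ifs <;> decide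
  have hd := bits_mul_le_of_le b1 c1
  have hc := bits_mul_le_of_le hsign a2
  refine ⟨(bits_mul_le_of_le a1 hd).trans (by omega),
    (bits_mul_le_of_le (bits_sub_le_of_le hc a3) hd).trans (by omega),
    (bits_mul_le_of_le (bits_add_le_of_le hc a3) hd).trans (by omega),
    (bits_mul_le_of_le a1 (bits_minInt_le (bits_minInt_le (bits_mul_le_of_le b4 c5)
      (bits_mul_le_of_le b5 c4)) (bits_mul_le_of_le b4 c4))).trans (by omega),
    (bits_mul_le_of_le a1 (bits_mul_le_of_le b5 c5)).trans (by omega)⟩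

/-- The components of the state are bounded by `k` and `2 ^ (D k)`. -/
def St.Bounded (D k : ℕ) (s : St ℤ) : Prop :=
  s.m.natAbs ≤ k ∧ s.u.natAbs ≤ 2 ^ (D * k) ∧ s.v.natAbs ≤ 2 ^ (D * k)

/-- A step multiplies by numbers of at most `D` bits and forms one difference, hence `D + 1` bits
per row, without any cancellation of common factors. -/
theorem St.Bounded.next {D k : ℕ} {s : St ℤ} {d a w : ℤ} (h : s.Bounded (D + 1) k)
    (hd : d.natAbs ≤ 2 ^ D) (ha : a.natAbs ≤ 2 ^ D) (hw : w.natAbs ≤ 2 ^ D) :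
    (s.next d a w).Bounded (D + 1) (k + 1) := by
  obtain ⟨h1, h2, h3⟩ := h
  have e : 2 ^ ((D + 1) * (k + 1)) = 2 * (2 ^ D * 2 ^ ((D + 1) * k)) := by
    rw [mul_add, pow_add, mul_one, pow_succ]; ring
  have p1 : 1 ≤ 2 ^ D * 2 ^ ((D + 1) * k) := Nat.one_le_iff_ne_zero.2 (by positivity)
  have p2 := Nat.mul_le_mul hd h3
  have p3 := Nat.mul_le_mul ha h3
  have p4 := Nat.mul_le_mul hw h2
  rw [← Int.natAbs_mul] at p2 p3 p4
  unfold St.Bounded St.next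
  rw [e]
  generalize 2 ^ D * 2 ^ ((D + 1) * k) = X at *
  generalize d * s.v = y1 at *
  generalize a * s.v = y2 at *
  generalize w * s.u = y3 at *
  refine ⟨?_, ?_, ?_⟩ <;> simp only <;> split_ifs <;> omega

theorem Coef.natAbs_le_of_bits {z : ℤ} {b : ℕ} (h : bits z ≤ b) : z.natAbs ≤ 2 ^ b :=
  (natAbs_lt_two_pow_bits z).le.trans (Nat.pow_le_pow_right (by norm_num) (by omega))

/-- Bounds for the components of the state of the test. -/
structure Test.Bounded (D k : ℕ) (T : Test) : Prop where
  flag : T.flag = 0 ∨ T.flag = 1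
  τ : T.τ = 1 ∨ T.τ = -1
  L : T.L.Bounded D k
  U : T.U.Bounded D k

theorem Test.bounded_init (D : ℕ) : Test.init.Bounded D 0 := by
  refine ⟨.inl rfl, .inl rfl, ?_, ?_⟩ <;> simp [Test.init, St.Bounded]

theorem Test.Bounded.step {D k : ℕ} {T : Test} {c : Coef} (h : T.Bounded (D + 1) k)
    (hτ : c.τ = 1 ∨ c.τ = -1) (hd : bits c.d ≤ D) (hal : bits c.al ≤ D) (hah : bits c.ah ≤ D)
    (hwl : bits c.wl ≤ D) (hwh : bits c.wh ≤ D) : (T.step c).Bounded (D + 1) (k + 1) := by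
  refine ⟨?_, hτ, ?_, ?_⟩
  · simp only [Test.step]
    split_ifs <;> simp
  · obtain ⟨s, w, hs, hw, e⟩ := St.lower_eq c.d c.al c.wl c.wh T.L T.U
    simp only [Test.step, e]
    refine St.Bounded.next ?_ (Coef.natAbs_le_of_bits hd) (Coef.natAbs_le_of_bits hal)
      (Coef.natAbs_le_of_bits ?_)
    · rcases hs with rfl | rfl; exacts [h.L, h.U]
    · rcases hw with rfl | rfl <;> assumption
  · obtain ⟨s, w, hs, hw, e⟩ := St.upper_eq c.d c.ah c.wl c.wh T.L T.U
    simp only [Test.step, e]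
    refine St.Bounded.next ?_ (Coef.natAbs_le_of_bits hd) (Coef.natAbs_le_of_bits hah)
      (Coef.natAbs_le_of_bits ?_)
    · rcases hs with rfl | rfl; exacts [h.L, h.U]
    · rcases hw with rfl | rfl <;> assumption

namespace TridiagonalInstance

variable (x : TridiagonalInstance)

/-- The size of the input, increased by one. -/
def size : ℕ := inputSize x.encode + 1

theorem bits_memory_le (a : ℤ) : bits (x.memory a) ≤ x.size := bits_initial_mem_le _ a

theorem bits_entryAt_le (i j : ℤ) : bits (entryAt x.memory i j).num ≤ x.size ∧
    bits (entryAt x.memory i j).den ≤ x.size ∧ bits (entryAt x.memory i j).num' ≤ x.size ∧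
    bits (entryAt x.memory i j).den' ≤ x.size := by
  simp only [entryAt]
  exact ⟨x.bits_memory_le _, x.bits_memory_le _, x.bits_memory_le _, x.bits_memory_le _⟩

theorem n_lt_size : x.n < x.size := by
  have h1 := length_le_inputSize x.encode
  rw [length_encode] at h1
  unfold size
  nlinarith

theorem bounded_testAt {j : ℤ} (hj : bits j ≤ 3 * x.size) (k : ℕ) :
    (x.testAt j k).Bounded (20 * x.size + 1) k := by
  induction k with
  | zero => exact Test.bounded_init _
  | succ k ih =>
    obtain ⟨h1, h2, h3, h4, h5⟩ := Coef.bits_ofEntries_le (s := x.size) (τ := (x.testAt j k).τ)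
      (j := j) (q := x.memory 2) (a := entryAt x.memory k k)
      (b := entryAt x.memory (predInt k) k) (c := entryAt x.memory k (predInt k))
      ih.τ (x.bits_memory_le _) hj (by
        intro e he
        simp only [List.mem_cons, List.not_mem_nil, or_false] at he
        rcases he with rfl | rfl | rfl <;> exact x.bits_entryAt_le _ _)
    refine ih.step ?_ h1 h2 h3 h4 h5
    have := ih.τ
    simp only [coefAt, Coef.ofEntries, Coef.sign]
    split_ifs <;> omega

end TridiagonalInstance

namespace RAM

/-! ### Expressions for the test -/

section Expressions

variable {K : ℕ}

instance : Add (Ex K) := ⟨Ex.op .add⟩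

instance : Sub (Ex K) := ⟨Ex.op .sub⟩

instance : Mul (Ex K) := ⟨Ex.op .mul⟩

/-- Expressions for the components of a state. -/
structure StEx (K : ℕ) where
  m : Ex K
  u : Ex K
  v : Ex K

namespace StEx

def eval (m : ℤ → ℤ) (r : Fin K → ℤ) (s : StEx K) : St ℤ :=
  ⟨s.m.eval m r, s.u.eval m r, s.v.eval m r⟩

def next (d a w : Ex K) (s : StEx K) : StEx K :=
  ⟨.ite s.v (s.m + .lit 1) s.m,
   .ite s.v (d * s.v) (.ite (.lit 0 - s.v) (.lit 0 - d * s.v) (.lit 0)),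
   .ite s.v (a * s.v - w * s.u) (.ite (.lit 0 - s.v) (w * s.u - a * s.v) (.lit 1))⟩

/-- This is definitional because `St.next` uses only what expressions offer: tests for positivity,
and `0 - y` in place of negation. -/
theorem eval_next (m : ℤ → ℤ) (r : Fin K → ℤ) (d a w : Ex K) (s : StEx K) :
    (s.next d a w).eval m r = (s.eval m r).next (d.eval m r) (a.eval m r) (w.eval m r) := rfl

def turns (s : StEx K) : Ex K := .ite s.v (s.m + .lit 1) s.m

def le (s t : StEx K) : Ex K :=
  .ite (t.m - s.m) (.lit 1) (.ite (s.m - t.m) (.lit 0)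
    (.ite (s.v * t.u - t.v * s.u) (.lit 0) (.lit 1)))

def pick (c : Ex K) (s t : StEx K) : StEx K := ⟨.ite c s.m t.m, .ite c s.u t.u, .ite c s.v t.v⟩

def max (s t : StEx K) : StEx K := pick (le s t) t s

def min (s t : StEx K) : StEx K := pick (le s t) s t

theorem eval_max (m : ℤ → ℤ) (r : Fin K → ℤ) (s t : StEx K) :
    (s.max t).eval m r = (s.eval m r).maxZ (t.eval m r) := rfl

theorem eval_min (m : ℤ → ℤ) (r : Fin K → ℤ) (s t : StEx K) :
    (s.min t).eval m r = (s.eval m r).minZ (t.eval m r) := rfl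

def apart (s t : StEx K) : Ex K :=
  .ite (s.turns - t.turns) (.lit 0) (.ite (t.turns - s.turns) (.lit 0)
    (.ite t.v (.lit 1) (.ite (.lit 0 - t.v) (.lit 1) (.lit 0))))

def upper (d a wl wh : Ex K) (L U : StEx K) : StEx K :=
  ((L.next d a wl).max (L.next d a wh)).max ((U.next d a wl).max (U.next d a wh))

def lower (d a wl wh : Ex K) (L U : StEx K) : StEx K :=
  ((L.next d a wl).min (L.next d a wh)).min ((U.next d a wl).min (U.next d a wh))

theorem eval_upper (m : ℤ → ℤ) (r : Fin K → ℤ) (d a wl wh : Ex K) (L U : StEx K) :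
    (upper d a wl wh L U).eval m r = (L.eval m r).upper (d.eval m r) (a.eval m r) (wl.eval m r)
      (wh.eval m r) (U.eval m r) := by
  simp only [upper, St.upper, eval_max, eval_next]

theorem eval_lower (m : ℤ → ℤ) (r : Fin K → ℤ) (d a wl wh : Ex K) (L U : StEx K) :
    (lower d a wl wh L U).eval m r = (L.eval m r).lower (d.eval m r) (a.eval m r) (wl.eval m r)
      (wh.eval m r) (U.eval m r) := by
  simp only [lower, St.lower, eval_min, eval_next]

end StEx

/-- Expressions for an entry. -/
structure EntryEx (K : ℕ) where
  num : Ex K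
  den : Ex K
  num' : Ex K
  den' : Ex K

namespace EntryEx

def eval (m : ℤ → ℤ) (r : Fin K → ℤ) (e : EntryEx K) : Entry :=
  ⟨e.num.eval m r, e.den.eval m r, e.num'.eval m r, e.den'.eval m r⟩

def scale (q : Ex K) (e : EntryEx K) : Ex K := e.den * e.den' * q

def center (q : Ex K) (e : EntryEx K) : Ex K := e.num * e.den' * q

def radius (j : Ex K) (e : EntryEx K) : Ex K := j * (e.num' * e.den)

def abs (e : Ex K) : Ex K := .ite e e (.lit 0 - e)

def lo (j q : Ex K) (e : EntryEx K) : Ex K := abs e.num * e.den' * q - e.radius j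

def hi (j q : Ex K) (e : EntryEx K) : Ex K := abs e.num * e.den' * q + e.radius j

/-- The expression for the entry in row `i` and column `j`. -/
def ofIndex (i j : Ex K) : EntryEx K where
  num := .mem (.lit 3 + .lit 2 * (.mem (.lit 0) * i + j))
  den := .mem (.lit 3 + .lit 2 * (.mem (.lit 0) * i + j) + .lit 1)
  num' := .mem (.lit 3 + .lit 2 * (.mem (.lit 0) * .mem (.lit 0)) +
    .lit 2 * (.mem (.lit 0) * i + j))
  den' := .mem (.lit 3 + .lit 2 * (.mem (.lit 0) * .mem (.lit 0)) +
    .lit 2 * (.mem (.lit 0) * i + j) + .lit 1)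

end EntryEx

/-- Expressions for the coefficients of a step. -/
structure CoefEx (K : ℕ) where
  τ : Ex K
  d : Ex K
  al : Ex K
  ah : Ex K
  wl : Ex K
  wh : Ex K

namespace CoefEx

def eval (m : ℤ → ℤ) (r : Fin K → ℤ) (c : CoefEx K) : Coef :=
  ⟨c.τ.eval m r, c.d.eval m r, c.al.eval m r, c.ah.eval m r, c.wl.eval m r, c.wh.eval m r⟩

def min (e f : Ex K) : Ex K := .ite (f - e) e f

def sign (τ : Ex K) (b c : EntryEx K) : Ex K := .ite (.lit 0 - b.num * c.num) (.lit 0 - τ) τ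

def ofEntries (τ j q : Ex K) (a b c : EntryEx K) : CoefEx K where
  τ := sign τ b c
  d := a.scale q * (b.scale q * c.scale q)
  al := (sign τ b c * a.center q - a.radius j) * (b.scale q * c.scale q)
  ah := (sign τ b c * a.center q + a.radius j) * (b.scale q * c.scale q)
  wl := a.scale q * min (min (b.lo j q * c.hi j q) (b.hi j q * c.lo j q)) (b.lo j q * c.lo j q)
  wh := a.scale q * (b.hi j q * c.hi j q)

theorem eval_ofEntries (m : ℤ → ℤ) (r : Fin K → ℤ) (τ j q : Ex K) (a b c : EntryEx K) :
    (ofEntries τ j q a b c).eval m r = Coef.ofEntries (τ.eval m r) (j.eval m r) (q.eval m r)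
      (a.eval m r) (b.eval m r) (c.eval m r) := rfl

def pred (k : Ex K) : Ex K := .ite k (k - .lit 1) (.lit 0)

/-- The expressions for the coefficients of row `k`. -/
def ofIndex (τ j k : Ex K) : CoefEx K :=
  ofEntries τ j (.mem (.lit 2)) (EntryEx.ofIndex k k) (EntryEx.ofIndex (pred k) k) (EntryEx.ofIndex k (pred k))

theorem eval_ofIndex (m : ℤ → ℤ) (r : Fin K → ℤ) (τ j k : Ex K) :
    (CoefEx.ofIndex τ j k).eval m r = coefAt m (τ.eval m r) (j.eval m r) (k.eval m r) := by
  rw [CoefEx.ofIndex, eval_ofEntries]; rfl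

end CoefEx

/-- Expressions for the state of the test. -/
structure TestEx (K : ℕ) where
  flag : Ex K
  τ : Ex K
  L : StEx K
  U : StEx K

namespace TestEx

def eval (m : ℤ → ℤ) (r : Fin K → ℤ) (T : TestEx K) : Test :=
  ⟨T.flag.eval m r, T.τ.eval m r, T.L.eval m r, T.U.eval m r⟩

def step (c : CoefEx K) (T : TestEx K) : TestEx K where
  flag := .ite T.flag (.lit 1) (.ite c.wl (.lit 0) (.ite (T.L.apart T.U) (.lit 0) (.lit 1)))
  τ := c.τ
  L := T.L.lower c.d c.al c.wl c.wh T.U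
  U := T.L.upper c.d c.ah c.wl c.wh T.U

theorem eval_step (m : ℤ → ℤ) (r : Fin K → ℤ) (c : CoefEx K) (T : TestEx K) :
    (T.step c).eval m r = (T.eval m r).step (c.eval m r) := by
  simp only [step, Test.step, eval, StEx.eval_lower, StEx.eval_upper, Test.mk.injEq]
  exact ⟨rfl, rfl, rfl, rfl⟩

def result (T : TestEx K) : Ex K :=
  .ite T.flag (.lit 1) (.ite (T.L.apart T.U) (.lit 0) (.lit 1))

end TestEx

end Expressions

/-! ### The program -/

/-- The variables of the program: a loop counter, the bound `top`, the bisection state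
(`lo` and the gap `g`) and the state of the test. -/
def pack (rem top lo g : ℤ) (T : Test) : Fin 12 → ℤ :=
  ![rem, top, lo, g, T.flag, T.τ, T.L.m, T.L.u, T.L.v, T.U.m, T.U.u, T.U.v]

/-- The assignment of new values to all variables. -/
def packEx (rem top lo g : Ex 12) (T : TestEx 12) : Fin 12 → Ex 12 :=
  ![rem, top, lo, g, T.flag, T.τ, T.L.m, T.L.u, T.L.v, T.U.m, T.U.u, T.U.v]

theorem evalAll_packEx (m : ℤ → ℤ) (r : Fin 12 → ℤ) (rem top lo g : Ex 12) (T : TestEx 12) :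
    evalAll m (packEx rem top lo g T) r = pack (rem.eval m r) (top.eval m r) (lo.eval m r)
      (g.eval m r) (T.eval m r) := by
  funext i
  fin_cases i <;> rfl

def curTest : TestEx 12 := ⟨.var 4, .var 5, ⟨.var 6, .var 7, .var 8⟩, ⟨.var 9, .var 10, .var 11⟩⟩

theorem eval_curTest (m : ℤ → ℤ) (rem top lo g : ℤ) (T : Test) :
    curTest.eval m (pack rem top lo g T) = T := rfl

def initTest : TestEx 12 := ⟨.lit 0, .lit 1, ⟨.lit 0, .lit 0, .lit 1⟩, ⟨.lit 0, .lit 0, .lit 1⟩⟩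

/-- Half of the gap, rounded up. -/
def half : Ex 12 := .op .div (.var 3 + .lit 1) (.lit 2)

def startEx : Fin 12 → Ex 12 :=
  packEx (.lit 3 + .lit 4 * (.mem (.lit 0) * .mem (.lit 0))) (.lit 1) (.lit 0) (.lit 0) initTest

/-- The cells are read backwards, so the loop counter also provides the address. -/
def boundEx : Fin 12 → Ex 12 :=
  packEx (.var 0 - .lit 1) ((EntryEx.abs (.mem (.var 0 - .lit 1)) + .lit 1) * .var 1) (.lit 0)
    (.lit 0) initTest

/-- The lower end -1 needs no test and makes the parameter 0 a candidate. -/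
def bisectStartEx : Fin 12 → Ex 12 :=
  packEx (.lit 0) (.var 1 * .mem (.lit 2) + .lit 1) (.lit 0 - .lit 1)
    (.var 1 * .mem (.lit 2) + .lit 1) initTest

def testStartEx : Fin 12 → Ex 12 :=
  packEx (.mem (.lit 0)) (.var 1) (.var 2) (.var 3) initTest

def testStepEx : Fin 12 → Ex 12 :=
  packEx (.var 0 - .lit 1) (.var 1) (.var 2) (.var 3)
    (curTest.step (CoefEx.ofIndex (.var 5) (.var 2 + half) (.mem (.lit 0) - .var 0)))

/-- The gap counts the grid points strictly between the two ends, so the tested point is removed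
from either half. -/
def bisectEx : Fin 12 → Ex 12 :=
  packEx (.lit 0) (.var 1) (.ite curTest.result (.var 2) (.var 2 + half))
    (.ite curTest.result (half - .lit 1) (.var 3 - half)) initTest

def finishEx : Fin 12 → Ex 12 :=
  packEx (.var 2 + .lit 1) (.ite (.var 1 - (.var 2 + .lit 1)) (.mem (.lit 2)) (.lit 0)) (.lit 0)
    (.lit 0) initTest

def testProg : Prog := .seq (assign testStartEx) (.loop ((0 : Fin 12) : ℕ) (assign testStepEx))

def radiusProg : Prog :=
  .seq (.seq (.seq (.seq (assign startEx) (.loop ((0 : Fin 12) : ℕ) (assign boundEx)))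
    (assign bisectStartEx)) (.loop ((3 : Fin 12) : ℕ) (.seq testProg (assign bisectEx))))
    (assign finishEx)

theorem evalAll_startEx (m : ℤ → ℤ) (r : Fin 12 → ℤ) : evalAll m startEx r =
    pack (3 + 4 * (m 0 * m 0)) 1 0 0 Test.init := evalAll_packEx _ _ _ _ _ _ _

theorem evalAll_boundEx (m : ℤ → ℤ) (rem top lo g : ℤ) (T : Test) :
    evalAll m boundEx (pack rem top lo g T) =
      pack (rem - 1) ((absInt (m (rem - 1)) + 1) * top) 0 0 Test.init :=
  evalAll_packEx _ _ _ _ _ _ _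

theorem evalAll_bisectStartEx (m : ℤ → ℤ) (rem top lo g : ℤ) (T : Test) :
    evalAll m bisectStartEx (pack rem top lo g T) =
      pack 0 (top * m 2 + 1) (-1) (top * m 2 + 1) Test.init :=
  evalAll_packEx _ _ _ _ _ _ _

theorem evalAll_testStartEx (m : ℤ → ℤ) (rem top lo g : ℤ) (T : Test) :
    evalAll m testStartEx (pack rem top lo g T) = pack (m 0) top lo g Test.init :=
  evalAll_packEx _ _ _ _ _ _ _

theorem evalAll_testStepEx (m : ℤ → ℤ) (rem top lo g : ℤ) (T : Test) :
    evalAll m testStepEx (pack rem top lo g T) = pack (rem - 1) top lo g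
      (T.step (coefAt m T.τ (lo + (g + 1) / 2) (m 0 - rem))) := by
  rw [testStepEx, evalAll_packEx, TestEx.eval_step, CoefEx.eval_ofIndex, eval_curTest]
  rfl

theorem evalAll_bisectEx (m : ℤ → ℤ) (rem top lo g : ℤ) (T : Test) :
    evalAll m bisectEx (pack rem top lo g T) = pack 0 top
      (if 0 < T.result then lo else lo + (g + 1) / 2)
      (if 0 < T.result then (g + 1) / 2 - 1 else g - (g + 1) / 2) Test.init :=
  evalAll_packEx _ _ _ _ _ _ _

theorem evalAll_finishEx (m : ℤ → ℤ) (rem top lo g : ℤ) (T : Test) :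
    evalAll m finishEx (pack rem top lo g T) =
      pack (lo + 1) (if 0 < top - (lo + 1) then m 2 else 0) 0 0 Test.init :=
  evalAll_packEx _ _ _ _ _ _ _

theorem bits_pack_le {rem top lo g : ℤ} {T : Test} {D k B : ℕ} (h1 : bits rem ≤ B)
    (h2 : bits top ≤ B) (h3 : bits lo ≤ B) (h4 : bits g ≤ B) (hT : T.Bounded D k)
    (hk : k + 2 ≤ B) (hD : D * k + 2 ≤ B) (i : Fin 12) : bits (pack rem top lo g T i) ≤ B := by
  have hf : bits T.flag ≤ B := by
    have : bits T.flag ≤ 2 := by rcases hT.flag with h | h <;> rw [h] <;> decide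
    omega
  have hτ : bits T.τ ≤ B := by
    have : bits T.τ ≤ 2 := by rcases hT.τ with h | h <;> rw [h] <;> decide
    omega
  have hs : ∀ z : ℤ, z.natAbs ≤ 2 ^ (D * k) → bits z ≤ B := fun z hz =>
    (bits_le_of_natAbs_le_two_pow hz).trans hD
  have hm : ∀ z : ℤ, z.natAbs ≤ k → bits z ≤ B := fun z hz =>
    (bits_le_of_natAbs_le_two_pow (hz.trans Nat.lt_two_pow_self.le)).trans hk
  obtain ⟨hL1, hL2, hL3⟩ := hT.L
  obtain ⟨hU1, hU2, hU3⟩ := hT.U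
  fin_cases i
  exacts [h1, h2, h3, h4, hf, hτ, hm _ hL1, hs _ hL2, hs _ hL3, hm _ hU1, hs _ hU2, hs _ hU3]

end RAM

/-! ### Loop invariants and running time -/

namespace TridiagonalInstance

open RAM

variable (x : TridiagonalInstance)

/-- The exclusive upper bound of the bisection. -/
def top : ℤ := inputBound x.encode * x.ε.den + 1

/-- A bound for the bit lengths of all numbers that occur in a run. -/
def bitBound : ℕ := 30 * x.size ^ 2

theorem four_le_size : 4 ≤ x.size := by
  have h1 := length_le_inputSize x.encode
  rw [length_encode] at h1
  unfold size
  omega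

theorem size_le_bitBound : 30 * x.size ≤ x.bitBound := by
  unfold bitBound
  have := x.four_le_size
  nlinarith

theorem bits_inputBound_le : bits (inputBound x.encode) ≤ x.size + 1 :=
  bits_le_of_natAbs_le_two_pow (by simpa using inputBound_le x.encode)

theorem top_pos : 1 ≤ x.top := by
  have : (0 : ℤ) ≤ inputBound x.encode * x.ε.den := by positivity
  unfold top
  omega

theorem bits_le_of_le_top {z : ℤ} (h : -1 ≤ z) (h' : z ≤ x.top) : bits z ≤ 3 * x.size := by
  have h1 : bits x.top ≤ (x.size + 1 + x.size) + 2 :=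
    bits_add_le_of_le (bits_mul_le_of_le x.bits_inputBound_le (x.bits_memory_le 2)) (by decide)
  have h2 := x.four_le_size
  have h3 := x.top_pos
  exact (bits_le_of_natAbs_le (by omega)).trans (h1.trans (by omega))

/-- After `k ≤ n < size` rows the states have about `(20 * size + 1) * k` bits; this is why
`bitBound` is quadratic. -/
theorem bits_pack_testAt_le {rem t lo g j : ℤ} {k : ℕ} (h1 : bits rem ≤ 3 * x.size)
    (h2 : bits t ≤ 3 * x.size) (h3 : bits lo ≤ 3 * x.size) (h4 : bits g ≤ 3 * x.size)
    (hj : bits j ≤ 3 * x.size) (hk : k ≤ x.n) (i : Fin 12) :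
    bits (pack rem t lo g (x.testAt j k) i) ≤ x.bitBound := by
  have h5 := x.size_le_bitBound
  have h6 := x.n_lt_size
  refine bits_pack_le (by omega) (by omega) (by omega) (by omega) (x.bounded_testAt hj k)
    (by omega) ?_ i
  have h7 : (20 * x.size + 1) * k ≤ (20 * x.size + 1) * x.size :=
    Nat.mul_le_mul_left _ (by omega)
  have h8 := x.four_le_size
  unfold bitBound
  nlinarith

theorem bits_zero_le : bits 0 ≤ 3 * x.size := by
  have : bits 0 = 1 := rfl
  have := x.four_le_size
  omega

theorem bits_pack_init_le {rem t lo g : ℤ} (h1 : bits rem ≤ 3 * x.size)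
    (h2 : bits t ≤ 3 * x.size) (h3 : bits lo ≤ 3 * x.size) (h4 : bits g ≤ 3 * x.size)
    (i : Fin 12) : bits (pack rem t lo g Test.init i) ≤ x.bitBound :=
  x.bits_pack_testAt_le (j := 0) (k := 0) h1 h2 h3 h4 x.bits_zero_le (Nat.zero_le _) i

theorem bits_natCast_le_of_le {k : ℕ} (h : k < x.size) : bits k ≤ 3 * x.size :=
  (bits_natCast_le k).trans (by omega)

theorem bits_memory_le_bitBound (a : ℤ) : bits (x.memory a) ≤ x.bitBound :=
  (x.bits_memory_le a).trans (by have := x.size_le_bitBound; omega)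

theorem one_le_bitBound : 1 ≤ x.bitBound := by
  have := x.size_le_bitBound
  have := x.four_le_size
  omega

theorem length_lt_size : x.encode.length < x.size := Nat.lt_succ_of_le (length_le_inputSize _)

/-- The first loop computes the bound `inputBound`. -/
theorem reaches_boundLoop : ∃ c : ℕ, ∀ x : TridiagonalInstance, Reaches x.memory
    (.loop ((0 : Fin 12) : ℕ) (assign boundEx)) (pack (3 + 4 * (x.n * x.n)) 1 0 0 Test.init)
    (pack 0 (inputBound x.encode) 0 0 Test.init) (c * x.bitBound ^ 3) := by
  obtain ⟨c, hc⟩ := reaches_assign boundEx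
  refine ⟨c + 2, fun x => ?_⟩
  have hdrop : ∀ f, bits (inputBound (x.encode.drop f)) ≤ 3 * x.size := by
    intro f
    have h1 : inputBound (x.encode.drop f) ≤ inputBound x.encode := by
      conv_rhs => rw [← List.take_append_drop f x.encode, inputBound_append]
      exact Nat.le_mul_of_pos_left _ (one_le_inputBound _)
    have := x.four_le_size
    exact (bits_le_of_natAbs_le (z := inputBound x.encode) (by simpa using h1)).trans
      (x.bits_inputBound_le.trans (by omega))
  -- The counter is the fuel; the cells from `f` onwards have already been multiplied in.
  let I : ℕ → (Fin 12 → ℤ) → Prop := fun f r => f ≤ x.encode.length ∧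
    r = pack f (inputBound (x.encode.drop f)) 0 0 Test.init
  have hbits : ∀ f r, I f r → ∀ i, bits (r i) ≤ x.bitBound := by
    rintro f r ⟨hf, rfl⟩
    exact x.bits_pack_init_le (x.bits_natCast_le_of_le (hf.trans_lt x.length_lt_size)) (hdrop f)
      x.bits_zero_le x.bits_zero_le
  obtain ⟨f', r', ⟨hf', rfl⟩, h0, hr⟩ := reaches_loop (m := x.memory) (P := assign boundEx)
    (x := (0 : Fin 12)) (T := c * x.bitBound ^ 2) (B := x.bitBound) I
    (fun f r h => hbits f r h 0) (by
      intro f r hI hpos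
      have hb := hbits f r hI
      obtain ⟨hf, rfl⟩ := hI
      replace hpos : (0 : ℤ) < f := hpos
      obtain ⟨f, rfl⟩ : ∃ f', f = f' + 1 := ⟨f - 1, by omega⟩
      refine ⟨f, _, rfl, ⟨by omega, rfl⟩, ?_⟩
      convert hc x.memory _ x.bitBound x.one_le_bitBound hb x.bits_memory_le_bitBound using 1
      rw [evalAll_boundEx, Nat.cast_add, Nat.cast_one, add_sub_cancel_right, memory_natCast,
        List.getD_eq_getElem _ _ (by omega), List.drop_eq_getElem_cons (by omega : f < _)]
      congr 1
      rw [inputBound_cons]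
      push_cast
      rw [absInt_eq])
    x.encode.length (pack (3 + 4 * (x.n * x.n)) 1 0 0 Test.init)
    ⟨le_rfl, by rw [List.drop_length, length_encode]; push_cast; rfl⟩
  replace h0 : (f' : ℤ) ≤ 0 := h0
  obtain rfl : f' = 0 := by omega
  refine hr.mono ?_
  have h1 : x.encode.length ≤ x.bitBound := by
    have := x.length_lt_size
    have := x.size_le_bitBound
    omega
  have h2 := x.one_le_bitBound
  calc _ ≤ x.bitBound * (c * x.bitBound ^ 2 + x.bitBound) + x.bitBound := by gcongr
    _ = c * x.bitBound ^ 3 + x.bitBound ^ 2 + x.bitBound := by ring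
    _ ≤ c * x.bitBound ^ 3 + x.bitBound ^ 3 + x.bitBound ^ 3 := by
        gcongr
        · norm_num
        · exact Nat.le_self_pow (by norm_num) _
    _ = _ := by ring

/-- The test for the parameter in the middle of the current interval. -/
theorem reaches_testProg : ∃ c : ℕ, ∀ (x : TridiagonalInstance) (lo g : ℤ), -1 ≤ lo → 0 < g →
    lo + g + 1 ≤ x.top → Reaches x.memory testProg (pack 0 x.top lo g Test.init)
      (pack 0 x.top lo g (x.testAt (lo + (g + 1) / 2) x.n)) (c * x.bitBound ^ 3) := by
  obtain ⟨c, hc⟩ := reaches_assign testStepEx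
  obtain ⟨c', hc'⟩ := reaches_assign testStartEx
  refine ⟨c + c' + 2, fun x lo g hlo hg htop => ?_⟩
  have bt := x.bits_le_of_le_top (by have := x.top_pos; omega) (le_refl x.top)
  have bl := x.bits_le_of_le_top hlo (by omega)
  have bg := x.bits_le_of_le_top (z := g) (by omega) (by omega)
  have bj := x.bits_le_of_le_top (z := lo + (g + 1) / 2) (by omega) (by omega)
  let I : ℕ → (Fin 12 → ℤ) → Prop := fun f r => f ≤ x.n ∧
    r = pack f x.top lo g (x.testAt (lo + (g + 1) / 2) (x.n - f))
  have hbits : ∀ f r, I f r → ∀ i, bits (r i) ≤ x.bitBound := by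
    rintro f r ⟨hf, rfl⟩
    exact x.bits_pack_testAt_le (x.bits_natCast_le_of_le (hf.trans_lt x.n_lt_size)) bt bl bg bj
      (Nat.sub_le _ _)
  obtain ⟨f', r', ⟨hf', rfl⟩, h0, hr⟩ := reaches_loop (m := x.memory) (P := assign testStepEx)
    (x := (0 : Fin 12)) (T := c * x.bitBound ^ 2) (B := x.bitBound) I
    (fun f r h => hbits f r h 0) (by
      intro f r hI hpos
      have hb := hbits f r hI
      obtain ⟨hf, rfl⟩ := hI
      replace hpos : (0 : ℤ) < f := hpos
      obtain ⟨f, rfl⟩ : ∃ f', f = f' + 1 := ⟨f - 1, by omega⟩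
      refine ⟨f, _, rfl, ⟨by omega, rfl⟩, ?_⟩
      convert hc x.memory _ x.bitBound x.one_le_bitBound hb x.bits_memory_le_bitBound using 1
      rw [evalAll_testStepEx, memory_zero, show x.n - f = x.n - (f + 1) + 1 by omega, testAt,
        Nat.cast_sub hf]
      congr 1
      push_cast
      ring)
    x.n (pack x.n x.top lo g Test.init) ⟨le_rfl, by rw [Nat.sub_self]; rfl⟩
  replace h0 : (f' : ℤ) ≤ 0 := h0
  obtain rfl : f' = 0 := by omega
  have h3 := hc' x.memory _ x.bitBound x.one_le_bitBound
    (x.bits_pack_init_le x.bits_zero_le bt bl bg) x.bits_memory_le_bitBound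
  rw [evalAll_testStartEx, memory_zero] at h3
  refine (h3.seq hr).mono ?_
  have h1 : x.n ≤ x.bitBound := by
    have := x.n_lt_size
    have := x.size_le_bitBound
    omega
  have h2 := x.one_le_bitBound
  calc _ ≤ c' * x.bitBound ^ 2 +
        (x.bitBound * (c * x.bitBound ^ 2 + x.bitBound) + x.bitBound) := by gcongr
    _ = c' * x.bitBound ^ 2 + (c * x.bitBound ^ 3 + x.bitBound ^ 2 + x.bitBound) := by ring
    _ ≤ c' * x.bitBound ^ 3 + (c * x.bitBound ^ 3 + x.bitBound ^ 3 + x.bitBound ^ 3) := by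
        gcongr
        · norm_num
        · norm_num
        · exact Nat.le_self_pow (by norm_num) _
    _ = _ := by ring

/-- The invariant of the bisection. -/
structure Bisection (f : ℕ) (lo g : ℤ) : Prop where
  lo_ge : -1 ≤ lo
  g_nonneg : 0 ≤ g
  le_top : lo + g + 1 ≤ x.top
  regular : lo = -1 ∨ ¬ x.SingularAt (lo / (x.ε.den : ℤ))
  singular : lo + g + 1 = x.top ∨ x.SingularAt ((lo + g + 1 : ℤ) / (x.ε.den : ℤ))
  fuel : g.natAbs < 2 ^ f

/-- The bisection loop. -/
theorem reaches_bisectLoop : ∃ c : ℕ, ∀ x : TridiagonalInstance, ∃ lo : ℤ,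
    x.Bisection 0 lo 0 ∧ Reaches x.memory
      (.loop ((3 : Fin 12) : ℕ) (.seq testProg (assign bisectEx)))
      (pack 0 x.top (-1) x.top Test.init) (pack 0 x.top lo 0 Test.init)
      (c * x.bitBound ^ 4) := by
  obtain ⟨c, hc⟩ := reaches_testProg
  obtain ⟨c', hc'⟩ := reaches_assign bisectEx
  refine ⟨c + c' + 2, fun x => ?_⟩
  have bt := x.bits_le_of_le_top (by have := x.top_pos; omega) (le_refl x.top)
  let I : ℕ → (Fin 12 → ℤ) → Prop := fun f r => ∃ lo g, x.Bisection f lo g ∧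
    r = pack 0 x.top lo g Test.init
  have h2 := x.one_le_bitBound
  have e : x.bitBound ^ 2 ≤ x.bitBound ^ 3 := Nat.pow_le_pow_right h2 (by norm_num)
  obtain ⟨f', r', ⟨lo, g, hI, rfl⟩, h0, hr⟩ := reaches_loop (m := x.memory)
    (P := .seq testProg (assign bisectEx)) (x := (3 : Fin 12)) (T := (c + c') * x.bitBound ^ 3)
    (B := x.bitBound) I (by
      rintro f r ⟨lo, g, h, rfl⟩
      have h1 := h.lo_ge
      have h3 := h.g_nonneg
      have h4 := h.le_top
      exact x.bits_pack_init_le x.bits_zero_le bt (x.bits_le_of_le_top h1 (by omega))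
        (x.bits_le_of_le_top (by omega) (by omega)) 3) (by
      rintro f r ⟨lo, g, h, rfl⟩ hpos
      replace hpos : 0 < g := hpos
      have h1 := h.lo_ge
      have h4 := h.le_top
      have h5 := h.fuel
      obtain ⟨f, rfl⟩ : ∃ f', f = f' + 1 := by
        cases f with
        | zero => rw [pow_zero] at h5; omega
        | succ f => exact ⟨f, rfl⟩
      rw [pow_succ] at h5
      -- Rounding up gives `j > lo`, so `j ≥ 0` as the test requires. Either new gap is at most `g /
      -- 2`, which consumes one unit of fuel.
      set j := lo + (g + 1) / 2 with hj
      have bj := x.bits_le_of_le_top (z := j) (by omega) (by omega)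
      have hsing := x.result_testAt_pos_iff (j := j) (by omega)
      have hrun := (hc x lo g h1 hpos h4).seq (hc' x.memory _ x.bitBound h2
        (x.bits_pack_testAt_le x.bits_zero_le bt (x.bits_le_of_le_top h1 (by omega))
          (x.bits_le_of_le_top (z := g) (by omega) (by omega)) bj le_rfl)
        x.bits_memory_le_bitBound)
      rw [evalAll_bisectEx] at hrun
      refine ⟨f, _, rfl, ⟨_, _, ?_, rfl⟩, hrun.mono ?_⟩
      · by_cases hs : x.SingularAt (j / (x.ε.den : ℤ))
        · rw [if_pos (hsing.2 hs), if_pos (hsing.2 hs)]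
          refine ⟨h1, by omega, by omega, h.regular, .inr ?_, by omega⟩
          rwa [show lo + ((g + 1) / 2 - 1) + 1 = j by omega]
        · rw [if_neg (mt hsing.1 hs), if_neg (mt hsing.1 hs)]
          refine ⟨by omega, by omega, by omega, .inr hs, ?_, by omega⟩
          rw [show j + (g - (g + 1) / 2) + 1 = lo + g + 1 by omega]
          exact h.singular
      · rw [add_mul]
        gcongr)
    -- The initial fuel bounds the bit length of `top`, hence the number of tests.
    (3 * x.size) (pack 0 x.top (-1) x.top Test.init) ⟨-1, x.top, ⟨le_rfl, by
      have := x.top_pos; omega, by omega, .inl rfl, .inl (by omega),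
      (natAbs_lt_two_pow_bits _).trans_le (Nat.pow_le_pow_right (by norm_num) (by omega))⟩, rfl⟩
  replace h0 : g ≤ 0 := h0
  obtain rfl : g = 0 := le_antisymm h0 hI.g_nonneg
  refine ⟨lo, ⟨hI.lo_ge, le_rfl, hI.le_top, hI.regular, hI.singular, by simp⟩, hr.mono ?_⟩
  have h1 : 3 * x.size ≤ x.bitBound := by
    have := x.size_le_bitBound
    omega
  calc _ ≤ x.bitBound * ((c + c') * x.bitBound ^ 3 + x.bitBound) + x.bitBound := by gcongr
    _ = (c + c') * x.bitBound ^ 4 + x.bitBound ^ 2 + x.bitBound := by ring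
    _ ≤ (c + c') * x.bitBound ^ 4 + x.bitBound ^ 4 + x.bitBound ^ 4 := by
        gcongr
        · norm_num
        · exact Nat.le_self_pow (by norm_num) _
    _ = _ := by ring

/-- The whole program. -/
theorem reaches_radiusProg : ∃ c : ℕ, ∀ x : TridiagonalInstance, ∃ lo : ℤ,
    x.Bisection 0 lo 0 ∧ Reaches x.memory radiusProg (fun _ : Fin 12 => 0)
      (pack (lo + 1) (if 0 < x.top - (lo + 1) then (x.ε.den : ℤ) else 0) 0 0 Test.init)
      (c * x.bitBound ^ 4) := by
  obtain ⟨c₁, h₁⟩ := reaches_assign startEx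
  obtain ⟨c₂, h₂⟩ := reaches_boundLoop
  obtain ⟨c₃, h₃⟩ := reaches_assign bisectStartEx
  obtain ⟨c₄, h₄⟩ := reaches_bisectLoop
  obtain ⟨c₅, h₅⟩ := reaches_assign finishEx
  refine ⟨c₁ + c₂ + c₃ + c₄ + c₅, fun x => ?_⟩
  have hB := x.one_le_bitBound
  have bz := x.bits_zero_le
  have bt := x.bits_le_of_le_top (by have := x.top_pos; omega) (le_refl x.top)
  obtain ⟨lo, hlo, hr⟩ := h₄ x
  refine ⟨lo, hlo, ?_⟩
  have r₁ := h₁ x.memory (fun _ => 0) x.bitBound hB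
    (fun _ => bz.trans (by have := x.size_le_bitBound; omega)) x.bits_memory_le_bitBound
  have r₃ := h₃ x.memory (pack 0 (inputBound x.encode) 0 0 Test.init) x.bitBound hB
    (x.bits_pack_init_le bz (x.bits_inputBound_le.trans (by have := x.four_le_size; omega)) bz bz)
    x.bits_memory_le_bitBound
  have r₅ := h₅ x.memory (pack 0 x.top lo 0 Test.init) x.bitBound hB
    (x.bits_pack_init_le bz bt (x.bits_le_of_le_top hlo.lo_ge (by have := hlo.le_top; omega)) bz)
    x.bits_memory_le_bitBound
  rw [evalAll_startEx, memory_zero] at r₁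
  rw [evalAll_bisectStartEx, memory_two] at r₃
  rw [evalAll_finishEx, memory_two] at r₅
  refine ((((r₁.seq (h₂ x)).seq r₃).seq hr).seq r₅).mono ?_
  have e : x.bitBound ^ 2 ≤ x.bitBound ^ 4 := Nat.pow_le_pow_right hB (by norm_num)
  have e' : x.bitBound ^ 3 ≤ x.bitBound ^ 4 := Nat.pow_le_pow_right hB (by norm_num)
  simp only [add_mul]
  gcongr

end TridiagonalInstance

theorem mainTheorem3 :
    RAM.SolvableInPolyTime TridiagonalInstance.encode
      (fun (x : TridiagonalInstance) (p q : ℤ) => Approximates x.radius (x.ε : ℝ) p q) := by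
  obtain ⟨c, hc⟩ := TridiagonalInstance.reaches_radiusProg
  -- Two powers of `bitBound` pay for an assignment, one for the rows of a test and one for the
  -- number of tests.
  refine ⟨RAM.radiusProg, .C c * (.C 30 * (.X + 1) ^ 2) ^ 4, fun x => ?_⟩
  obtain ⟨lo, hlo, hr⟩ := hc x
  obtain ⟨s, t, hrun, ⟨-, hs⟩, ht⟩ := hr (RAM.initial x.encode) ⟨rfl, fun _ => rfl⟩
  refine ⟨s, t, hrun, ?_, ?_⟩
  · simpa [TridiagonalInstance.bitBound, TridiagonalInstance.size] using ht
  · have h0 : s.reg 0 = lo + 1 := hs 0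
    have h1 : s.reg 1 = if 0 < x.top - (lo + 1) then (x.ε.den : ℤ) else 0 := hs 1
    have h2 := hlo.lo_ge
    have h3 := hlo.le_top
    have h4 := hlo.singular
    rw [h0, h1]
    refine TridiagonalInstance.approximates_of_bisection (by omega) ?_ ?_ ?_
    · rw [add_sub_cancel_right]
      exact hlo.regular.imp (by omega) id
    · rw [add_zero] at h3
      exact h3
    · rw [add_zero] at h4
      exact h4
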